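/- **Theorem.** Let $R$ be a commutative unital ring. An associative superdialgebra over $R$ is an $R$-module $D=D_{\bar0}\oplus D_{\bar1}$ with two associative, parity-preserving $R$-bilinear operations $\dashv,\vdash$ satisfying $a\dashv(b\dashv c)=a\dashv(b\vdash c)$, $(a\vdash b)\dashv c=a\vdash(b\dashv c)$, $(a\dashv b)\vdash c=(a\vdash b)\vdash c$; it is unital if an element $1\in D_{\bar0}$ with $a\dashv1=a=1\vdash a$ for all $a$ is chosen. Let $D$ be a unital associative superdialgebra over $R$ that has an $R$-basis containing $1$. For an integer $k\ge0$ let $D_k$ be the quotient of $D$ by the ideal generated by the elements $ka$ ($a\in D$) and $a\dashv b-(-1)^{|a||b|}\,b\vdash a$ ($a,b$ homogeneous), and let $\Pi$ be the parity change functor. A Leibniz superalgebra is an $R$-module $L=L_{\bar0}\oplus L_{\bar1}$ with an even bilinear bracket satisfying $[x,[y,z]]=[[x,y],z]-(-1)^{|y||z|}[[x,z],y]$ for homogeneous $x,y,z$. Its second homology with trivial coefficients is $\mathrm{HL}_2(L)=\operatorname{Ker}\delta_2/\operatorname{Im}\delta_3$, where $\delta_2(x\otimes y)=[x,y]$ and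 $\delta_3(x\otimes y\otimes z)=-[x,y]\otimes z+x\otimes[y,z]+(-1)^{|y||z|}[x,z]\otimes y$. For $m+n\ge3$ let $|i|=\bar0$ for $1\le i\le m$ and $|i|=\bar1$ for $m<i\le m+n$. The Steinberg Leibniz superalgebra $\mathfrak{st}(m,n,D)$ is the Leibniz superalgebra over $R$ generated by elements $F_{ij}(a)$ ($1\le i\ne j\le m+n$, $a\in D$ homogeneous) of parity $|i|+|j|+|a|$, subject to the relations: $a\mapsto F_{ij}(a)$ is $R$-linear, and $$[F_{ij}(a),F_{kl}(b)]=\begin{cases}F_{il}(a\dashv b)&\text{if } i\ne l,\ j=k,\\ -(-1)^{|F_{ij}(a)||F_{kl}(b)|}F_{kj}(b\vdash a)&\text{if } i=l,\ j\neq k,\\ 0&\text{if } i\ne l,\ j\ne k.\end{cases}$$ Then there are isomorphisms of $R$-supermodules $$\mathrm{HL}_2\big(\mathfrak{st}(m,n,D)\big)\cong\begin{cases}0&\text{for } m+n\ge5 \text{ or } (m,n)=(2,1),\\ D_3^{6}&\text{for }(m,n)=(3,0),\\ D_2^{6}&\text{for }(m,n)=(4,0),\\ \Pi(D_2)^{6}&\text{for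 }(m,n)=(3,1),\\ D_2^{4}\oplus D_0^{2}&\text{for }(m,n)=(2,2).\end{cases}$$ -/

import Mathlib

open scoped TensorProduct

noncomputable section

/-- The sign `(-1)^{pq}` for parities `p`, `q`. -/
def koszulSign (p q : ZMod 2) : ℤ := (-1) ^ (p.val * q.val)

/-- An associative superdialgebra structure on the `R`-module `D`: `left a b` is `a ⊣ b`,
`right a b` is `a ⊢ b`, and `gr 0`, `gr 1` are the even and the odd part. -/
structure Superdialgebra (R D : Type*) [CommRing R] [AddCommGroup D] [Module R D] where
  left : D →ₗ[R] D →ₗ[R] D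
  right : D →ₗ[R] D →ₗ[R] D
  left_assoc : ∀ a b c, left (left a b) c = left a (left b c)
  right_assoc : ∀ a b c, right (right a b) c = right a (right b c)
  left_left : ∀ a b c, left a (left b c) = left a (right b c)
  right_left : ∀ a b c, left (right a b) c = right a (left b c)
  right_right : ∀ a b c, right (left a b) c = right (right a b) c
  gr : ZMod 2 → Submodule R D
  isCompl : IsCompl (gr 0) (gr 1)
  left_mem : ∀ {p q a b}, a ∈ gr p → b ∈ gr q → left a b ∈ gr (p + q)
  right_mem : ∀ {p q a b}, a ∈ gr p → b ∈ gr q → right a b ∈ gr (p + q)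

/-- A superdialgebra with a chosen (even) bar-unit. -/
structure UnitalSuperdialgebra (R D : Type*) [CommRing R] [AddCommGroup D] [Module R D]
    extends Superdialgebra R D where
  one : D
  one_mem : one ∈ gr 0
  left_one : ∀ a, left a one = a
  one_right : ∀ a, right one a = a

namespace Superdialgebra

variable {R D : Type*} [CommRing R] [AddCommGroup D] [Module R D] (𝒟 : Superdialgebra R D)

/-- The generators `m a` and `a ⊣ b - (-1)^{|a||b|} b ⊢ a` of the ideal `I_m`. -/
def idealGenerators (m : ℕ) : Set D :=
  {x | ∃ a, x = (m : R) • a} ∪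
  {x | ∃ p q, ∃ a ∈ 𝒟.gr p, ∃ b ∈ 𝒟.gr q, x = 𝒟.left a b - koszulSign p q • 𝒟.right b a}

/-- A two-sided ideal for both operations. -/
def IsIdeal (I : Submodule R D) : Prop :=
  ∀ x y, (x ∈ I ∨ y ∈ I) → 𝒟.left x y ∈ I ∧ 𝒟.right x y ∈ I

/-- `I_m`, the ideal generated by `m a` and `a ⊣ b - (-1)^{|a||b|} b ⊢ a`. -/
def idealOf (m : ℕ) : Submodule R D :=
  sInf {I | 𝒟.IsIdeal I ∧ 𝒟.idealGenerators m ⊆ I}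

/-- The quotient `D_m = D / I_m`. -/
abbrev Quot (m : ℕ) : Type _ := D ⧸ 𝒟.idealOf m

/-- The parity components of `D_m`. -/
def quotGr (m : ℕ) (p : ZMod 2) : Submodule R (𝒟.Quot m) :=
  (𝒟.gr p).map (𝒟.idealOf m).mkQ

end Superdialgebra

/-- A Leibniz superalgebra structure on the `R`-module `L`. -/
structure LeibnizSuperalgebra (R L : Type*) [CommRing R] [AddCommGroup L] [Module R L] where
  gr : ZMod 2 → Submodule R L
  isCompl : IsCompl (gr 0) (gr 1)
  bracket : L →ₗ[R] L →ₗ[R] L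
  bracket_mem : ∀ {p q x y}, x ∈ gr p → y ∈ gr q → bracket x y ∈ gr (p + q)
  leibniz : ∀ {p q r x y z}, x ∈ gr p → y ∈ gr q → z ∈ gr r →
    bracket x (bracket y z) =
      bracket (bracket x y) z - koszulSign q r • bracket (bracket x z) y

/-- Isomorphism of `R`-supermodules: an `R`-linear isomorphism preserving parity. -/
def SuperIso {R M N : Type*} [CommRing R] [AddCommGroup M] [Module R M] [AddCommGroup N]
    [Module R N] (grM : ZMod 2 → Submodule R M) (grN : ZMod 2 → Submodule R N) : Prop :=
  ∃ e : M ≃ₗ[R] N, ∀ p, (grM p).map (e : M →ₗ[R] N) = grN p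

/-- Grading of a direct power. -/
def powGr {R M : Type*} [CommRing R] [AddCommGroup M] [Module R M]
    (gr : ZMod 2 → Submodule R M) (k : ℕ) (p : ZMod 2) : Submodule R (Fin k → M) :=
  Submodule.pi Set.univ fun _ => gr p

/-- Grading of a direct sum. -/
def sumGr {R M N : Type*} [CommRing R] [AddCommGroup M] [Module R M] [AddCommGroup N]
    [Module R N] (grM : ZMod 2 → Submodule R M) (grN : ZMod 2 → Submodule R N) (p : ZMod 2) :
    Submodule R (M × N) :=
  (grM p).prod (grN p)

/-- The parity change functor `Π` on gradings. -/
def parityChange {R M : Type*} [CommRing R] [AddCommGroup M] [Module R M]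
    (gr : ZMod 2 → Submodule R M) (p : ZMod 2) : Submodule R M :=
  gr (p + 1)

/-! ### Second homology with trivial coefficients -/

namespace LeibnizSuperalgebra

variable {R L : Type*} [CommRing R] [AddCommGroup L] [Module R L] (𝓛 : LeibnizSuperalgebra R L)

/-- The projection onto the component of parity `p`. -/
def proj (p : ZMod 2) : L →ₗ[R] L :=
  if p = 0 then (𝓛.gr 0).projection (𝓛.gr 1) 𝓛.isCompl
  else (𝓛.gr 1).projection (𝓛.gr 0) 𝓛.isCompl.symm

/-- The signed flip `y ⊗ z ↦ (-1)^{|y||z|} z ⊗ y`. -/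
def signedFlip : L ⊗[R] L →ₗ[R] L ⊗[R] L :=
  ∑ p : ZMod 2, ∑ q : ZMod 2, koszulSign p q •
    ((TensorProduct.comm R L L).toLinearMap ∘ₗ TensorProduct.map (𝓛.proj p) (𝓛.proj q))

/-- `δ₂ (x ⊗ y) = [x, y]`. -/
def delta2 : L ⊗[R] L →ₗ[R] L := TensorProduct.lift 𝓛.bracket

/-- `x ⊗ (y ⊗ z) ↦ [x, y] ⊗ z`. -/
def bracketLeft : L ⊗[R] (L ⊗[R] L) →ₗ[R] L ⊗[R] L :=
  (𝓛.delta2.rTensor L) ∘ₗ (TensorProduct.assoc R L L L).symm.toLinearMap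

/-- `δ₃ (x ⊗ y ⊗ z) = -[x, y] ⊗ z + x ⊗ [y, z] + (-1)^{|y||z|} [x, z] ⊗ y`. -/
def delta3 : L ⊗[R] (L ⊗[R] L) →ₗ[R] L ⊗[R] L :=
  -𝓛.bracketLeft + 𝓛.delta2.lTensor L + 𝓛.bracketLeft ∘ₗ 𝓛.signedFlip.lTensor L

theorem proj_apply {p q : ZMod 2} {x : L} (hx : x ∈ 𝓛.gr q) :
    𝓛.proj p x = if p = q then x else 0 := by
  have h2 : ∀ t : ZMod 2, t = 0 ∨ t = 1 := by decide
  have h10 : (1 : ZMod 2) ≠ 0 := by decide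
  rcases h2 p with rfl | rfl <;> rcases h2 q with rfl | rfl
  · simpa [proj] using Submodule.projection_apply_left 𝓛.isCompl ⟨x, hx⟩
  · simpa [proj, h10.symm] using hx
  · simpa [proj, h10] using hx
  · simpa [proj, h10] using Submodule.projection_apply_left 𝓛.isCompl.symm ⟨x, hx⟩

theorem signedFlip_tmul {p q : ZMod 2} {y z : L} (hy : y ∈ 𝓛.gr p) (hz : z ∈ 𝓛.gr q) :
    𝓛.signedFlip (y ⊗ₜ[R] z) = koszulSign p q • z ⊗ₜ[R] y := by
  simp only [signedFlip, LinearMap.sum_apply, LinearMap.smul_apply, LinearMap.comp_apply,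
    TensorProduct.map_tmul, 𝓛.proj_apply hy, 𝓛.proj_apply hz]
  rw [Finset.sum_eq_single p, Finset.sum_eq_single q]
  · simp
  · intro b _ hb; simp [hb]
  · simp
  · intro b _ hb; simp [hb]
  · simp

theorem delta3_tmul {q r : ZMod 2} {x y z : L} (hy : y ∈ 𝓛.gr q) (hz : z ∈ 𝓛.gr r) :
    𝓛.delta3 (x ⊗ₜ[R] (y ⊗ₜ[R] z)) = -(𝓛.bracket x y ⊗ₜ[R] z) + x ⊗ₜ[R] 𝓛.bracket y z
      + koszulSign q r • (𝓛.bracket x z ⊗ₜ[R] y) := by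
  simp [delta3, bracketLeft, delta2, 𝓛.signedFlip_tmul hy hz]

/-- `HL₂(L) = Ker δ₂ / Im δ₃`. -/
abbrev HL2 : Type _ :=
  LinearMap.ker 𝓛.delta2 ⧸ (LinearMap.range 𝓛.delta3).submoduleOf (LinearMap.ker 𝓛.delta2)

/-- The component of parity `p` of `L ⊗ L`. -/
def tensorGr (p : ZMod 2) : Submodule R (L ⊗[R] L) :=
  Submodule.span R {t | ∃ q r, q + r = p ∧ ∃ x ∈ 𝓛.gr q, ∃ y ∈ 𝓛.gr r, t = x ⊗ₜ[R] y}

/-- The component of parity `p` of `HL₂(L)`: the classes of the cycles of parity `p`. -/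
def HL2Gr (p : ZMod 2) : Submodule R 𝓛.HL2 :=
  ((𝓛.tensorGr p).submoduleOf (LinearMap.ker 𝓛.delta2)).map
    ((LinearMap.range 𝓛.delta3).submoduleOf (LinearMap.ker 𝓛.delta2)).mkQ

end LeibnizSuperalgebra

/-! ### Leibniz superalgebras given by generators and relations -/

namespace LeibnizPresentation

variable (R : Type*) [CommRing R] {X : Type*} (deg : X → ZMod 2)

/-- The parity of a nonassociative word. -/
def wordDeg : FreeMagma X → ZMod 2
  | .of x => deg x
  | .mul u v => wordDeg u + wordDeg v

/-- The parity components of the free nonassociative algebra on the graded set `X`. -/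
def freeGr (p : ZMod 2) : Submodule R (FreeNonUnitalNonAssocAlgebra R X) :=
  Submodule.span R {t | ∃ w, wordDeg deg w = p ∧ t = MonoidAlgebra.single w 1}

/-- The Leibniz relators `x(yz) - (xy)z + (-1)^{|y||z|} (xz)y`. -/
def leibnizRelators : Set (FreeNonUnitalNonAssocAlgebra R X) :=
  {t | ∃ p q r, ∃ x ∈ freeGr R deg p, ∃ y ∈ freeGr R deg q, ∃ z ∈ freeGr R deg r,
    t = x * (y * z) - x * y * z + koszulSign q r • (x * z * y)}

variable {R}

/-- A two-sided ideal of the free nonassociative algebra. -/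
def IsIdeal (I : Submodule R (FreeNonUnitalNonAssocAlgebra R X)) : Prop :=
  ∀ x y, (x ∈ I ∨ y ∈ I) → x * y ∈ I

variable (rel : Set (FreeNonUnitalNonAssocAlgebra R X))

/-- The ideal generated by the relators `rel` and the Leibniz relators. -/
def relIdeal : Submodule R (FreeNonUnitalNonAssocAlgebra R X) :=
  sInf {I | IsIdeal I ∧ rel ⊆ I ∧ leibnizRelators R deg ⊆ I}

/-- The module underlying the Leibniz superalgebra generated by `X` subject to `rel`. -/
abbrev Carrier : Type _ := FreeNonUnitalNonAssocAlgebra R X ⧸ relIdeal deg rel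

variable {deg rel}

theorem relIdeal_isIdeal : IsIdeal (relIdeal deg rel) := by
  intro x y h
  simp only [relIdeal, Submodule.mem_sInf] at h ⊢
  intro I hI
  exact hI.1 x y (h.imp (fun h => h I hI) (fun h => h I hI))

theorem subset_relIdeal : rel ⊆ relIdeal deg rel := by
  intro x h
  simp only [relIdeal, SetLike.mem_coe, Submodule.mem_sInf]
  intro I hI
  exact hI.2.1 h

theorem leibniz_subset_relIdeal : leibnizRelators R deg ⊆ relIdeal deg rel := by
  intro x h
  simp only [relIdeal, SetLike.mem_coe, Submodule.mem_sInf]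
  intro I hI
  exact hI.2.2 h

theorem freeGr_mul {p q : ZMod 2} {x y : FreeNonUnitalNonAssocAlgebra R X}
    (hx : x ∈ freeGr R deg p) (hy : y ∈ freeGr R deg q) : x * y ∈ freeGr R deg (p + q) := by
  induction hx using Submodule.span_induction with
  | mem x hx =>
    obtain ⟨u, hu, rfl⟩ := hx
    induction hy using Submodule.span_induction with
    | mem y hy =>
      obtain ⟨v, hv, rfl⟩ := hy
      rw [MonoidAlgebra.single_mul_single, one_mul]
      exact Submodule.subset_span ⟨u * v, by rw [← hu, ← hv]; rfl, rfl⟩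
    | zero => rw [mul_zero]; exact Submodule.zero_mem _
    | add a b _ _ ha hb => rw [mul_add]; exact Submodule.add_mem _ ha hb
    | smul c a _ ha => rw [mul_smul_comm]; exact Submodule.smul_mem _ _ ha
  | zero => rw [zero_mul]; exact Submodule.zero_mem _
  | add a b _ _ ha hb => rw [add_mul]; exact Submodule.add_mem _ ha hb
  | smul c a _ ha => rw [smul_mul_assoc]; exact Submodule.smul_mem _ _ ha

theorem of_mem_freeGr (x : X) :
    FreeNonUnitalNonAssocAlgebra.of R x ∈ freeGr R deg (deg x) :=
  Submodule.subset_span ⟨FreeMagma.of x, rfl, rfl⟩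

theorem coeff_eq_zero {p : ZMod 2} {x : FreeNonUnitalNonAssocAlgebra R X}
    (hx : x ∈ freeGr R deg p) (w : FreeMagma X) (hw : wordDeg deg w ≠ p) : x.coeff w = 0 := by
  induction hx using Submodule.span_induction with
  | mem x hx =>
    obtain ⟨u, rfl, rfl⟩ := hx
    have hne : u ≠ w := fun h => hw (by rw [h])
    simp [MonoidAlgebra.coeff_single, hne]
  | zero => simp
  | add a b _ _ ha hb => simp [ha, hb]
  | smul c a _ ha => simp [ha]

theorem freeGr_isCompl : IsCompl (freeGr R deg 0) (freeGr R deg 1) := by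
  constructor
  · rw [Submodule.disjoint_def]
    intro x h0 h1
    ext w
    by_cases h : wordDeg deg w = 0
    · exact coeff_eq_zero h1 w (by rw [h]; decide)
    · exact coeff_eq_zero h0 w h
  · rw [codisjoint_iff, eq_top_iff]
    rintro x -
    induction x using MonoidAlgebra.induction_linear with
    | zero => exact zero_mem _
    | add a b ha hb => exact add_mem ha hb
    | single w r =>
      have hr : (MonoidAlgebra.single w r : FreeNonUnitalNonAssocAlgebra R X) =
          r • MonoidAlgebra.single w 1 := by simp
      rw [hr]
      refine Submodule.smul_mem _ _ ?_
      have h2 : ∀ t : ZMod 2, t = 0 ∨ t = 1 := by decide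
      rcases h2 (wordDeg deg w) with h | h
      · exact Submodule.mem_sup_left (Submodule.subset_span ⟨w, h, rfl⟩)
      · exact Submodule.mem_sup_right (Submodule.subset_span ⟨w, h, rfl⟩)

theorem exists_freeGr (x : FreeNonUnitalNonAssocAlgebra R X) :
    ∃ a ∈ freeGr R deg 0, ∃ b ∈ freeGr R deg 1, a + b = x :=
  Submodule.mem_sup.1 ((freeGr_isCompl (R := R) (deg := deg)).sup_eq_top ▸ Submodule.mem_top)

theorem relIdeal_homogeneous (hrel : ∀ t ∈ rel, ∃ p, t ∈ freeGr R deg p) :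
    relIdeal deg rel ≤
      relIdeal deg rel ⊓ freeGr R deg 0 ⊔ relIdeal deg rel ⊓ freeGr R deg 1 := by
  set S := relIdeal deg rel with hS
  set T := S ⊓ freeGr R deg 0 ⊔ S ⊓ freeGr R deg 1 with hT
  have key : ∀ (p : ZMod 2) t, t ∈ S → t ∈ freeGr R deg p → t ∈ T := by
    intro p t h1 h2
    fin_cases p
    · exact Submodule.mem_sup_left ⟨h1, h2⟩
    · exact Submodule.mem_sup_right ⟨h1, h2⟩
  have hid := relIdeal_isIdeal (deg := deg) (rel := rel)
  refine sInf_le ⟨?_, ?_, ?_⟩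
  · rintro x y (h | h)
    · obtain ⟨a, ha, b, hb, rfl⟩ := Submodule.mem_sup.1 h
      obtain ⟨c, hc, d, hd, rfl⟩ := exists_freeGr (deg := deg) y
      rw [add_mul, mul_add, mul_add]
      exact add_mem
        (add_mem (key _ _ (hid _ _ (.inl ha.1)) (freeGr_mul ha.2 hc))
          (key _ _ (hid _ _ (.inl ha.1)) (freeGr_mul ha.2 hd)))
        (add_mem (key _ _ (hid _ _ (.inl hb.1)) (freeGr_mul hb.2 hc))
          (key _ _ (hid _ _ (.inl hb.1)) (freeGr_mul hb.2 hd)))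
    · obtain ⟨a, ha, b, hb, rfl⟩ := Submodule.mem_sup.1 h
      obtain ⟨c, hc, d, hd, rfl⟩ := exists_freeGr (deg := deg) x
      rw [add_mul, mul_add, mul_add]
      exact add_mem
        (add_mem (key _ _ (hid _ _ (.inr ha.1)) (freeGr_mul hc ha.2))
          (key _ _ (hid _ _ (.inr hb.1)) (freeGr_mul hc hb.2)))
        (add_mem (key _ _ (hid _ _ (.inr ha.1)) (freeGr_mul hd ha.2))
          (key _ _ (hid _ _ (.inr hb.1)) (freeGr_mul hd hb.2)))
  · intro t ht
    obtain ⟨p, hp⟩ := hrel t ht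
    exact key p t (subset_relIdeal ht) hp
  · intro t ht
    have hts := leibniz_subset_relIdeal (rel := rel) ht
    obtain ⟨p, q, r, x, hx, y, hy, z, hz, rfl⟩ := ht
    refine key (p + (q + r)) _ hts ?_
    have h1 := freeGr_mul hx (freeGr_mul hy hz)
    have h2 := freeGr_mul (freeGr_mul hx hy) hz
    have h3 := freeGr_mul (freeGr_mul hx hz) hy
    rw [show p + q + r = p + (q + r) by ring] at h2
    rw [show p + r + q = p + (q + r) by ring] at h3
    exact add_mem (sub_mem h1 h2) (zsmul_mem h3 _)

variable (deg rel) in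
/-- The bracket of the presented Leibniz superalgebra, induced by the free multiplication. -/
def bracket : Carrier deg rel →ₗ[R] Carrier deg rel →ₗ[R] Carrier deg rel :=
  (relIdeal deg rel).liftQ
    { toFun := fun x => (relIdeal deg rel).mapQ (relIdeal deg rel) (LinearMap.mul R _ x)
        (fun _ hy => relIdeal_isIdeal _ _ (.inr hy))
      map_add' := fun x y => by
        refine Submodule.linearMap_qext _ (LinearMap.ext fun z => ?_)
        exact congrArg (relIdeal deg rel).mkQ (add_mul x y z)
      map_smul' := fun c x => by
        refine Submodule.linearMap_qext _ (LinearMap.ext fun z => ?_)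
        exact congrArg (relIdeal deg rel).mkQ (smul_mul_assoc c x z) }
    (by
      intro x hx
      rw [LinearMap.mem_ker]
      refine Submodule.linearMap_qext _ (LinearMap.ext fun z => ?_)
      exact (Submodule.Quotient.mk_eq_zero _).2 (relIdeal_isIdeal x z (.inl hx)))

theorem bracket_mk (x y : FreeNonUnitalNonAssocAlgebra R X) :
    bracket deg rel ((relIdeal deg rel).mkQ x) ((relIdeal deg rel).mkQ y) =
      (relIdeal deg rel).mkQ (x * y) := rfl

variable (deg rel) in
/-- The Leibniz superalgebra generated by the graded set `X` subject to the homogeneous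
relators `rel`. -/
def leibnizSuperalgebra (hrel : ∀ t ∈ rel, ∃ p, t ∈ freeGr R deg p) :
    LeibnizSuperalgebra R (Carrier deg rel) where
  gr p := (freeGr R deg p).map (relIdeal deg rel).mkQ
  isCompl := by
    constructor
    · rw [Submodule.disjoint_def]
      rintro _ ⟨a, ha, rfl⟩ ⟨b, hb, hab⟩
      have h : a - b ∈ relIdeal deg rel := by
        rw [← Submodule.Quotient.eq]; exact hab.symm
      obtain ⟨s, hs, t, ht, hst⟩ := Submodule.mem_sup.1 (relIdeal_homogeneous hrel h)
      have h0 : a - s = 0 := by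
        refine Submodule.disjoint_def.1 (freeGr_isCompl (R := R) (deg := deg)).disjoint _
          (sub_mem ha hs.2) ?_
        have : a - s = b + t := by
          rw [sub_eq_iff_eq_add, add_assoc, add_comm t s, hst]; abel
        rw [this]
        exact add_mem hb ht.2
      rw [sub_eq_zero.1 h0]
      simpa using hs.1
    · rw [codisjoint_iff, ← Submodule.map_sup, freeGr_isCompl.sup_eq_top, Submodule.map_top,
        Submodule.range_mkQ]
  bracket := bracket deg rel
  bracket_mem := by
    rintro p q _ _ ⟨x, hx, rfl⟩ ⟨y, hy, rfl⟩
    exact ⟨x * y, freeGr_mul hx hy, rfl⟩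
  leibniz := by
    rintro p q r _ _ _ ⟨x, hx, rfl⟩ ⟨y, hy, rfl⟩ ⟨z, hz, rfl⟩
    simp only [bracket_mk]
    have := leibniz_subset_relIdeal (rel := rel) ⟨p, q, r, x, hx, y, hy, z, hz, rfl⟩
    have h0 := (Submodule.Quotient.mk_eq_zero _).2 this
    rw [← sub_eq_zero, ← h0, ← Submodule.mkQ_apply, map_add, map_sub, map_zsmul]
    abel

end LeibnizPresentation

/-! ### The Steinberg Leibniz superalgebra -/

namespace UnitalSuperdialgebra

variable {R D : Type*} [CommRing R] [AddCommGroup D] [Module R D]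
  (𝒟 : UnitalSuperdialgebra R D) (m n : ℕ)

/-- The parity of an index: the first `m` indices are even, the last `n` are odd. -/
def indexDeg : Fin m ⊕ Fin n → ZMod 2 := Sum.elim (fun _ => 0) (fun _ => 1)

/-- The generators `F_{ij}(a)`, with `i ≠ j` and `a` homogeneous of parity `p`. -/
structure SteinbergGen where
  i : Fin m ⊕ Fin n
  j : Fin m ⊕ Fin n
  ne : i ≠ j
  p : ZMod 2
  a : 𝒟.gr p

variable {m n}

/-- `|F_{ij}(a)| = |i| + |j| + |a|`. -/
def SteinbergGen.deg (g : 𝒟.SteinbergGen m n) : ZMod 2 :=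
  indexDeg m n g.i + indexDeg m n g.j + g.p

/-- `F_{ij}(a)` in the free nonassociative algebra, for `a` of parity `p`. -/
def F {i j : Fin m ⊕ Fin n} (h : i ≠ j) {p : ZMod 2} (a : 𝒟.gr p) :
    FreeNonUnitalNonAssocAlgebra R (𝒟.SteinbergGen m n) :=
  FreeNonUnitalNonAssocAlgebra.of R ⟨i, j, h, p, a⟩

/-- `a ⊣ b` for homogeneous `a`, `b`. -/
def hleft {p q : ZMod 2} (a : 𝒟.gr p) (b : 𝒟.gr q) : 𝒟.gr (p + q) :=
  ⟨𝒟.left a b, 𝒟.left_mem a.2 b.2⟩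

/-- `a ⊢ b` for homogeneous `a`, `b`. -/
def hright {p q : ZMod 2} (a : 𝒟.gr p) (b : 𝒟.gr q) : 𝒟.gr (p + q) :=
  ⟨𝒟.right a b, 𝒟.right_mem a.2 b.2⟩

variable (m n) in
/-- The defining relators of `𝔰𝔱(m, n, D)`. -/
inductive SteinbergRelator : FreeNonUnitalNonAssocAlgebra R (𝒟.SteinbergGen m n) → Prop
  | add {i j : Fin m ⊕ Fin n} (h : i ≠ j) {p : ZMod 2} (a b : 𝒟.gr p) :
      SteinbergRelator (𝒟.F h (a + b) - 𝒟.F h a - 𝒟.F h b)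
  | smul {i j : Fin m ⊕ Fin n} (h : i ≠ j) {p : ZMod 2} (c : R) (a : 𝒟.gr p) :
      SteinbergRelator (𝒟.F h (c • a) - c • 𝒟.F h a)
  /-- `[F_{ij}(a), F_{jl}(b)] = F_{il}(a ⊣ b)` for `i ≠ l`. -/
  | left {i j l : Fin m ⊕ Fin n} (hij : i ≠ j) (hjl : j ≠ l) (hil : i ≠ l) {p q : ZMod 2}
      (a : 𝒟.gr p) (b : 𝒟.gr q) :
      SteinbergRelator (𝒟.F hij a * 𝒟.F hjl b - 𝒟.F hil (𝒟.hleft a b))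
  /-- `[F_{ij}(a), F_{ki}(b)] = -(-1)^{|F_{ij}(a)||F_{ki}(b)|} F_{kj}(b ⊢ a)` for `j ≠ k`. -/
  | right {i j k : Fin m ⊕ Fin n} (hij : i ≠ j) (hki : k ≠ i) (hkj : k ≠ j) {p q : ZMod 2}
      (a : 𝒟.gr p) (b : 𝒟.gr q) :
      SteinbergRelator (𝒟.F hij a * 𝒟.F hki b +
        koszulSign (indexDeg m n i + indexDeg m n j + p) (indexDeg m n k + indexDeg m n i + q) •
          𝒟.F hkj (𝒟.hright b a))
  /-- `[F_{ij}(a), F_{kl}(b)] = 0` for `i ≠ l` and `j ≠ k`. -/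
  | zero {i j k l : Fin m ⊕ Fin n} (hij : i ≠ j) (hkl : k ≠ l) (hil : i ≠ l) (hjk : j ≠ k)
      {p q : ZMod 2} (a : 𝒟.gr p) (b : 𝒟.gr q) :
      SteinbergRelator (𝒟.F hij a * 𝒟.F hkl b)

theorem F_mem {i j : Fin m ⊕ Fin n} (h : i ≠ j) {p : ZMod 2} (a : 𝒟.gr p) :
    𝒟.F h a ∈ LeibnizPresentation.freeGr R (SteinbergGen.deg 𝒟)
      (indexDeg m n i + indexDeg m n j + p) :=
  LeibnizPresentation.of_mem_freeGr (deg := SteinbergGen.deg 𝒟) (⟨i, j, h, p, a⟩ :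
    𝒟.SteinbergGen m n)

theorem steinbergRelator_homogeneous :
    ∀ t ∈ {t | 𝒟.SteinbergRelator m n t},
      ∃ p, t ∈ LeibnizPresentation.freeGr R (SteinbergGen.deg 𝒟) p := by
  have two : ∀ x : ZMod 2, x + x = 0 := by decide
  intro t ht
  cases ht with
  | add h a b => exact ⟨_, sub_mem (sub_mem (𝒟.F_mem h _) (𝒟.F_mem h _)) (𝒟.F_mem h _)⟩
  | smul h c a => exact ⟨_, sub_mem (𝒟.F_mem h _) (Submodule.smul_mem _ _ (𝒟.F_mem h _))⟩
  | @left i j l hij hjl hil p q a b =>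
    refine ⟨_, sub_mem (LeibnizPresentation.freeGr_mul (𝒟.F_mem hij a) (𝒟.F_mem hjl b)) ?_⟩
    convert 𝒟.F_mem hil (𝒟.hleft a b) using 2
    linear_combination two (indexDeg m n j)
  | @right i j k hij hki hkj p q a b =>
    refine ⟨_, add_mem (LeibnizPresentation.freeGr_mul (𝒟.F_mem hij a) (𝒟.F_mem hki b))
      (zsmul_mem ?_ _)⟩
    convert 𝒟.F_mem hkj (𝒟.hright b a) using 2
    linear_combination two (indexDeg m n i)
  | zero hij hkl _ _ a b =>
    exact ⟨_, LeibnizPresentation.freeGr_mul (𝒟.F_mem hij a) (𝒟.F_mem hkl b)⟩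

variable (m n) in
/-- The Steinberg Leibniz superalgebra `𝔰𝔱(m, n, D)`. -/
def steinberg : LeibnizSuperalgebra R
    (LeibnizPresentation.Carrier (SteinbergGen.deg 𝒟) {t | 𝒟.SteinbergRelator m n t}) :=
  LeibnizPresentation.leibnizSuperalgebra (SteinbergGen.deg 𝒟) {t | 𝒟.SteinbergRelator m n t}
    𝒟.steinbergRelator_homogeneous

end UnitalSuperdialgebra

end

/-!
The proof computes `U = (L ⊗ L) / Im δ₃` for `L = 𝔰𝔱(m, n, D)`: the bracket induces a map `U → L`
whose kernel is `HL₂(L)`. Write `φ_{ijkl}(a, b)` (`clsF`) for the class of `F_{ij}(a) ⊗ F_{kl}(b)`.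

*Upper bound.* The even elements `[F_{pq}(1), F_{qp}(1)]` act diagonally on the generators
(`bracket_tor`). The classes of `-F_{ij}(a) ⊗ [F_{ir}(1), F_{ri}(1)]` lift the generators
`F_{ij}(a)` to `U`, and comparing weights shows that the lifts satisfy all defining relations of `L`
except possibly those of the form `[F_{ij}(a), F_{kl}(b)] = 0` with `i ≠ l`, `j ≠ k`. Therefore
`HL₂(L)` is spanned by the elements `φ_{ijkl}(a, b)` with `i ≠ l`, `j ≠ k`
(`UnitalSuperdialgebra.ker_covBracket_le`). Such an element is annihilated by the weight of
`F_{ij}(a) ⊗ F_{kl}(b)` under every diagonal element (`weight_smul_cls`). If `(i, j) = (k, l)`, it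
is zero (`cls_same_eq_zero`). Otherwise some weight is invertible unless `m + n = 4` and the four
indices are distinct, or `m + n = 3`, all indices have the same parity, and exactly one of `i = k`,
`j = l` holds; this gives the vanishing of `HL₂` in the first case of the theorem
(`subsingleton_hl2`). In the exceptional cases the Leibniz identity gives `φ(a, b) = ± φ(a ⊣ b, 1)`
and that `φ(·, 1)` is invariant, up to the Koszul sign, under permutations of the factors of a
product. So `φ(·, 1)` factors through `D_N`, where the number `N ∈ {0, 2, 3}` annihilates it by the
weight argument (`idealOf_le_ker_clsF`, `idealOf_le_ker_clsF_row`); and the quadruples with the same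
sources `{i, k}` and sinks `{j, l}` give the same submodule (`clsF_mem_range`, `clsF_row_swap`).

*Lower bound.* The map `F_{ij}(a) ↦ a e_{ij}` sends `L` to the matrices over `D` whose supertrace
lies in the ideal `I_N` (`toMatrix`). For each exceptional choice of sources and sinks there is a
2-cocycle on these matrices with values in `D_N`, of the form
`(a e_{ij}, b e_{kl}) ↦ ± ε_{ijkl} [a ⊣ b]` (`weightForm`). Since `a ⊣ b = (-1)^{|a||b|} b ⊢ a` in `D_N`, the cocycle identity is a finite
statement about integers modulo `N` (`IsWeightCocycle`). The resulting maps `U → D_N` are dual to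
the spanning elements `φ_{ijkl}(a, 1)`, which proves the isomorphism (`superIso_hl2_pi`).
-/

noncomputable section

/-! ### Signs and gradings -/

theorem koszulSign_comm (p q : ZMod 2) : koszulSign p q = koszulSign q p := by
  revert p q; decide

theorem koszulSign_add_left (p q r : ZMod 2) :
    koszulSign (p + q) r = koszulSign p r * koszulSign q r := by
  revert p q r; decide

theorem koszulSign_add_right (p q r : ZMod 2) :
    koszulSign p (q + r) = koszulSign p q * koszulSign p r := by
  revert p q r; decide

theorem koszulSign_mul_self (p q : ZMod 2) : koszulSign p q * koszulSign p q = 1 := by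
  revert p q; decide

@[simp] theorem koszulSign_zero_left (p : ZMod 2) : koszulSign 0 p = 1 := by
  revert p; decide

@[simp] theorem koszulSign_zero_right (p : ZMod 2) : koszulSign p 0 = 1 := by
  revert p; decide

theorem zmod_two_eq_zero_or_one (p : ZMod 2) : p = 0 ∨ p = 1 := by
  revert p; decide

theorem zmod_two_add_self (p : ZMod 2) : p + p = 0 := by
  revert p; decide

/-- Every element is the sum of an even and an odd one, so that a linear map is determined by its
values on homogeneous elements. -/
theorem induction_homogeneous {R M : Type*} [CommRing R] [AddCommGroup M] [Module R M]
    {gr : ZMod 2 → Submodule R M} (hgr : IsCompl (gr 0) (gr 1)) {P : M → Prop}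
    (hom : ∀ p, ∀ x ∈ gr p, P x) (add : ∀ x y, P x → P y → P (x + y)) (x : M) : P x := by
  obtain ⟨a, ha, b, hb, rfl⟩ := Submodule.mem_sup.1 (hgr.sup_eq_top ▸ Submodule.mem_top (x := x))
  exact add _ _ (hom 0 a ha) (hom 1 b hb)

/-! ### The quotient of `L ⊗ L` by the image of `δ₃` -/

namespace LeibnizSuperalgebra

variable {R L : Type*} [CommRing R] [AddCommGroup L] [Module R L] (𝓛 : LeibnizSuperalgebra R L)

/-- The module `(L ⊗ L) / Im δ₃`; `HL₂(L)` is the kernel of the map `covBracket` from it to `L`. -/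
abbrev Cov : Type _ := (L ⊗[R] L) ⧸ LinearMap.range 𝓛.delta3

/-- The class of `x ⊗ y` modulo `Im δ₃`. -/
def cls : L →ₗ[R] L →ₗ[R] 𝓛.Cov :=
  (TensorProduct.mk R L L).compr₂ (LinearMap.range 𝓛.delta3).mkQ

theorem cls_apply (x y : L) : 𝓛.cls x y = (LinearMap.range 𝓛.delta3).mkQ (x ⊗ₜ[R] y) := rfl

theorem cls_leibniz {q r : ZMod 2} (x : L) {y z : L} (hy : y ∈ 𝓛.gr q) (hz : z ∈ 𝓛.gr r) :
    𝓛.cls x (𝓛.bracket y z) =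
      𝓛.cls (𝓛.bracket x y) z - koszulSign q r • 𝓛.cls (𝓛.bracket x z) y := by
  have h : (LinearMap.range 𝓛.delta3).mkQ (𝓛.delta3 (x ⊗ₜ[R] (y ⊗ₜ[R] z))) = 0 :=
    (Submodule.Quotient.mk_eq_zero _).2 ⟨_, rfl⟩
  rw [𝓛.delta3_tmul hy hz, map_add, map_add, map_neg, map_zsmul] at h
  simp only [cls_apply]
  rw [← sub_eq_zero, ← h]
  abel

/-- A linear map killing the elements `δ₃ (x ⊗ y ⊗ z)` with `x`, `y`, `z` homogeneous kills the
image of `δ₃`. -/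
theorem range_delta3_le_ker {W : Type*} [AddCommGroup W] [Module R W] (f : L ⊗[R] L →ₗ[R] W)
    (h : ∀ p q r, ∀ x ∈ 𝓛.gr p, ∀ y ∈ 𝓛.gr q, ∀ z ∈ 𝓛.gr r,
      f (x ⊗ₜ[R] 𝓛.bracket y z) = f (𝓛.bracket x y ⊗ₜ[R] z)
        - koszulSign q r • f (𝓛.bracket x z ⊗ₜ[R] y)) :
    LinearMap.range 𝓛.delta3 ≤ LinearMap.ker f := by
  rw [LinearMap.range_le_ker_iff]
  refine TensorProduct.ext' fun x t => ?_
  induction t using TensorProduct.induction_on with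
  | zero => simp
  | add a b ha hb => rw [TensorProduct.tmul_add, map_add, map_add, ha, hb]
  | tmul y z =>
    refine induction_homogeneous 𝓛.isCompl (P := fun x => (f ∘ₗ 𝓛.delta3) (x ⊗ₜ[R] (y ⊗ₜ[R] z)) =
      (0 : L ⊗[R] (L ⊗[R] L) →ₗ[R] W) (x ⊗ₜ[R] (y ⊗ₜ[R] z))) (fun p x hx => ?_)
      (fun a b ha hb => by rw [TensorProduct.add_tmul, map_add, map_add, ha, hb]) x
    refine induction_homogeneous 𝓛.isCompl (P := fun y => (f ∘ₗ 𝓛.delta3) (x ⊗ₜ[R] (y ⊗ₜ[R] z)) =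
      (0 : L ⊗[R] (L ⊗[R] L) →ₗ[R] W) (x ⊗ₜ[R] (y ⊗ₜ[R] z))) (fun q y hy => ?_)
      (fun a b ha hb => by
        rw [TensorProduct.add_tmul, TensorProduct.tmul_add, map_add, map_add, ha, hb]) y
    refine induction_homogeneous 𝓛.isCompl (P := fun z => (f ∘ₗ 𝓛.delta3) (x ⊗ₜ[R] (y ⊗ₜ[R] z)) =
      (0 : L ⊗[R] (L ⊗[R] L) →ₗ[R] W) (x ⊗ₜ[R] (y ⊗ₜ[R] z))) (fun r z hz => ?_)
      (fun a b ha hb => by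
        rw [TensorProduct.tmul_add, TensorProduct.tmul_add, map_add, map_add, ha, hb]) z
    rw [LinearMap.comp_apply, 𝓛.delta3_tmul hy hz, LinearMap.zero_apply, map_add, map_add, map_neg,
      map_zsmul, h p q r x hx y hy z hz]
    abel

theorem range_delta3_le_ker_delta2 : LinearMap.range 𝓛.delta3 ≤ LinearMap.ker 𝓛.delta2 :=
  𝓛.range_delta3_le_ker _ fun _ _ _ _ hx _ hy _ hz => 𝓛.leibniz hx hy hz

/-- The map `(L ⊗ L) / Im δ₃ → L` induced by the bracket. -/
def covBracket : 𝓛.Cov →ₗ[R] L :=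
  (LinearMap.range 𝓛.delta3).liftQ 𝓛.delta2 𝓛.range_delta3_le_ker_delta2

@[simp] theorem covBracket_cls (x y : L) : 𝓛.covBracket (𝓛.cls x y) = 𝓛.bracket x y := rfl

/-- If `h` acts from the right on `x` and `y` by the scalars `α` and `β`, then it acts on the class
of `x ⊗ y` by `α + β`. -/
theorem cls_weight {q : ZMod 2} {x y h : L} {α β : ℤ} (hy : y ∈ 𝓛.gr q) (hh : h ∈ 𝓛.gr 0)
    (hx' : 𝓛.bracket x h = α • x) (hy' : 𝓛.bracket y h = β • y) :
    (α + β) • 𝓛.cls x y = 𝓛.cls (𝓛.bracket x y) h := by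
  have := 𝓛.cls_leibniz x hy hh
  rw [hx', hy', koszulSign_zero_right, one_smul, map_zsmul, map_zsmul, LinearMap.smul_apply] at this
  rw [add_smul, this]
  abel

/-- The inclusion of `HL₂(L)` into `(L ⊗ L) / Im δ₃`. -/
def hl2Incl : 𝓛.HL2 →ₗ[R] 𝓛.Cov :=
  Submodule.mapQ _ _ (LinearMap.ker 𝓛.delta2).subtype le_rfl

theorem hl2Incl_injective : Function.Injective 𝓛.hl2Incl := by
  rw [← LinearMap.ker_eq_bot, LinearMap.ker_eq_bot']
  intro u hu
  obtain ⟨⟨t, ht⟩, rfl⟩ := Submodule.mkQ_surjective _ u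
  have hu' : (LinearMap.range 𝓛.delta3).mkQ t = 0 := hu
  rw [Submodule.mkQ_apply, Submodule.Quotient.mk_eq_zero] at hu'
  exact (Submodule.Quotient.mk_eq_zero _).2 hu'

theorem covBracket_hl2Incl (u : 𝓛.HL2) : 𝓛.covBracket (𝓛.hl2Incl u) = 0 := by
  obtain ⟨⟨t, ht⟩, rfl⟩ := Submodule.mkQ_surjective _ u
  exact ht

theorem exists_hl2Incl {u : 𝓛.Cov} (hu : 𝓛.covBracket u = 0) : ∃ v, 𝓛.hl2Incl v = u := by
  obtain ⟨t, rfl⟩ := Submodule.mkQ_surjective _ u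
  exact ⟨Submodule.Quotient.mk ⟨t, hu⟩, rfl⟩

theorem hl2_subsingleton (h : LinearMap.ker 𝓛.covBracket ≤ ⊥) : Subsingleton 𝓛.HL2 := by
  refine ⟨fun u v => 𝓛.hl2Incl_injective ?_⟩
  rw [(Submodule.mem_bot R).1 (h (𝓛.covBracket_hl2Incl u)),
    (Submodule.mem_bot R).1 (h (𝓛.covBracket_hl2Incl v))]

/-- A criterion for an isomorphism of `HL₂(L)` with `W`: a map `Ψ` given by a 2-cocycle together
with a section `ω` of it onto the kernel of the bracket, both compatible with the parities. -/
theorem superIso_hl2 {W : Type*} [AddCommGroup W] [Module R W] {gr : ZMod 2 → Submodule R W}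
    (Ψ : 𝓛.Cov →ₗ[R] W) (ω : W →ₗ[R] 𝓛.Cov)
    (hω : LinearMap.ker 𝓛.covBracket = LinearMap.range ω) (hΨω : ∀ w, Ψ (ω w) = w)
    (hΨ : ∀ p q, ∀ x ∈ 𝓛.gr p, ∀ y ∈ 𝓛.gr q, Ψ (𝓛.cls x y) ∈ gr (p + q))
    (hωgr : ∀ p, ∀ w ∈ gr p, ω w ∈ (𝓛.tensorGr p).map (LinearMap.range 𝓛.delta3).mkQ) :
    SuperIso 𝓛.HL2Gr gr := by
  have hΨgr : ∀ p, ∀ t ∈ 𝓛.tensorGr p, Ψ ((LinearMap.range 𝓛.delta3).mkQ t) ∈ gr p := by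
    intro p t ht
    induction ht using Submodule.span_induction with
    | mem t ht =>
      obtain ⟨q, r, rfl, x, hx, y, hy, rfl⟩ := ht
      exact hΨ q r x hx y hy
    | zero => rw [map_zero, map_zero]; exact zero_mem _
    | add a b _ _ ha hb => rw [map_add, map_add]; exact add_mem ha hb
    | smul c a _ ha => rw [map_smul, map_smul]; exact Submodule.smul_mem _ _ ha
  have hbij : Function.Bijective (Ψ ∘ₗ 𝓛.hl2Incl) := by
    constructor
    · intro u v huv
      have hu : 𝓛.hl2Incl u ∈ LinearMap.range ω := hω ▸ 𝓛.covBracket_hl2Incl u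
      have hv : 𝓛.hl2Incl v ∈ LinearMap.range ω := hω ▸ 𝓛.covBracket_hl2Incl v
      obtain ⟨a, ha⟩ := hu
      obtain ⟨b, hb⟩ := hv
      refine 𝓛.hl2Incl_injective ?_
      rw [LinearMap.comp_apply, LinearMap.comp_apply, ← ha, ← hb, hΨω, hΨω] at huv
      rw [← ha, ← hb, huv]
    · intro w
      have hw : ω w ∈ LinearMap.ker 𝓛.covBracket := hω ▸ ⟨w, rfl⟩
      obtain ⟨v, hv⟩ := 𝓛.exists_hl2Incl hw
      exact ⟨v, by rw [LinearMap.comp_apply, hv, hΨω]⟩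
  refine ⟨LinearEquiv.ofBijective _ hbij, fun p => le_antisymm ?_ ?_⟩
  · rintro _ ⟨_, ⟨⟨t, ht⟩, htp, rfl⟩, rfl⟩
    exact hΨgr p t htp
  · intro w hw
    obtain ⟨t, ht, htw⟩ := hωgr p w hw
    have hker : ω w ∈ LinearMap.ker 𝓛.covBracket := hω ▸ ⟨w, rfl⟩
    rw [← htw] at hker
    refine ⟨Submodule.Quotient.mk ⟨t, hker⟩, ⟨⟨t, hker⟩, ht, rfl⟩, ?_⟩
    change Ψ ((LinearMap.range 𝓛.delta3).mkQ t) = w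
    rw [htw, hΨω]

end LeibnizSuperalgebra

theorem SuperIso.trans {R M N P : Type*} [CommRing R] [AddCommGroup M] [Module R M]
    [AddCommGroup N] [Module R N] [AddCommGroup P] [Module R P] {grM : ZMod 2 → Submodule R M}
    {grN : ZMod 2 → Submodule R N} {grP : ZMod 2 → Submodule R P} (h : SuperIso grM grN)
    (h' : SuperIso grN grP) : SuperIso grM grP := by
  obtain ⟨e, he⟩ := h
  obtain ⟨f, hf⟩ := h'
  refine ⟨e.trans f, fun p => ?_⟩
  rw [← hf p, ← he p, ← Submodule.map_comp]
  rfl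

/-! ### Presented Leibniz superalgebras -/

namespace LeibnizPresentation

variable {R : Type*} [CommRing R] {X : Type*}

/-- The linear extension of a function on words. -/
def wordLift {V : Type*} [AddCommGroup V] [Module R V] (f : FreeMagma X → V) :
    FreeNonUnitalNonAssocAlgebra R X →ₗ[R] V :=
  (Finsupp.lift V R (FreeMagma X) f) ∘ₗ (MonoidAlgebra.coeffLinearEquiv R).toLinearMap

@[simp] theorem wordLift_single {V : Type*} [AddCommGroup V] [Module R V] (f : FreeMagma X → V)
    (w : FreeMagma X) (c : R) : wordLift f (MonoidAlgebra.single w c) = c • f w := by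
  simp [wordLift]

@[simp] theorem wordLift_of {V : Type*} [AddCommGroup V] [Module R V] (f : FreeMagma X → V)
    (x : X) : wordLift f (FreeNonUnitalNonAssocAlgebra.of R x) = f (.of x) := by
  have : FreeNonUnitalNonAssocAlgebra.of R x = MonoidAlgebra.single (FreeMagma.of x) 1 := rfl
  rw [this, wordLift_single, one_smul]

/-- A function on words that is multiplicative for a bilinear operation extends to a multiplicative
linear map. -/
theorem wordLift_mul {V V' : Type*} [AddCommGroup V] [Module R V] [AddCommGroup V'] [Module R V']
    (f : FreeMagma X → V) (g : FreeMagma X → V') (β : V' →ₗ[R] V' →ₗ[R] V)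
    (hf : ∀ u v, f (u * v) = β (g u) (g v)) (x y : FreeNonUnitalNonAssocAlgebra R X) :
    wordLift f (x * y) = β (wordLift g x) (wordLift g y) := by
  induction x using MonoidAlgebra.induction_linear with
  | zero => simp
  | add a b ha hb => rw [add_mul, map_add, ha, hb, map_add, map_add, LinearMap.add_apply]
  | single u c =>
    induction y using MonoidAlgebra.induction_linear with
    | zero => simp
    | add a b ha hb => rw [mul_add, map_add, ha, hb, map_add, map_add]
    | single v d => simp [MonoidAlgebra.single_mul_single, hf, smul_smul, mul_comm c d]

theorem wordLift_mkQ (S : Submodule R (FreeNonUnitalNonAssocAlgebra R X)) :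
    wordLift (fun w => S.mkQ (MonoidAlgebra.single w 1)) = S.mkQ := by
  refine LinearMap.ext fun x => ?_
  induction x using MonoidAlgebra.induction_linear with
  | zero => simp
  | add a b ha hb => rw [map_add, map_add, ha, hb]
  | single u c => rw [wordLift_single, ← map_smul]; simp

variable {deg : X → ZMod 2} {rel : Set (FreeNonUnitalNonAssocAlgebra R X)}

variable (deg rel) in
/-- A lift of the free algebra along the map `(L ⊗ L) / Im δ₃ → L`, where `L` is the Leibniz
superalgebra presented by `rel`: generators are sent to prescribed elements, and a product `u v` to
the class of `u ⊗ v`. -/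
def covLift (hrel : ∀ t ∈ rel, ∃ p, t ∈ freeGr R deg p)
    (g : X → (leibnizSuperalgebra deg rel hrel).Cov) :
    FreeNonUnitalNonAssocAlgebra R X →ₗ[R] (leibnizSuperalgebra deg rel hrel).Cov :=
  wordLift fun w => match w with
    | .of x => g x
    | .mul u v => (leibnizSuperalgebra deg rel hrel).cls
      ((relIdeal deg rel).mkQ (MonoidAlgebra.single u 1))
      ((relIdeal deg rel).mkQ (MonoidAlgebra.single v 1))

variable {hrel : ∀ t ∈ rel, ∃ p, t ∈ freeGr R deg p}
  {g : X → (leibnizSuperalgebra deg rel hrel).Cov}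

theorem covLift_of (x : X) :
    covLift deg rel hrel g (FreeNonUnitalNonAssocAlgebra.of R x) = g x :=
  wordLift_of _ x

theorem covLift_mul (x y : FreeNonUnitalNonAssocAlgebra R X) :
    covLift deg rel hrel g (x * y) =
      (leibnizSuperalgebra deg rel hrel).cls ((relIdeal deg rel).mkQ x)
        ((relIdeal deg rel).mkQ y) := by
  unfold covLift
  rw [wordLift_mul (V' := Carrier deg rel) _
    (fun w => (relIdeal deg rel).mkQ (MonoidAlgebra.single w 1))
    (leibnizSuperalgebra deg rel hrel).cls (fun u v => rfl) x y, wordLift_mkQ]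

theorem mkQ_mem_gr {p : ZMod 2} {x : FreeNonUnitalNonAssocAlgebra R X}
    (hx : x ∈ freeGr R deg p) :
    (relIdeal deg rel).mkQ x ∈ (leibnizSuperalgebra deg rel hrel).gr p :=
  ⟨x, hx, rfl⟩

theorem mkQ_eq_zero {x : FreeNonUnitalNonAssocAlgebra R X} (hx : x ∈ relIdeal deg rel) :
    (relIdeal deg rel).mkQ x = 0 :=
  (Submodule.Quotient.mk_eq_zero _).2 hx

/-- If the defining relations of `L` hold in `(L ⊗ L) / Im δ₃` modulo a submodule `N` for suitable
lifts of the generators, then `N` contains the kernel of `(L ⊗ L) / Im δ₃ → L`: the lifts define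
a map `s` from `L` modulo `N`, and `s ∘ covBracket` is the identity modulo `N`, since both send the
class of `x ⊗ y` to the product of the lifts of `x` and `y`. -/
theorem ker_covBracket_le (hrel : ∀ t ∈ rel, ∃ p, t ∈ freeGr R deg p)
    (g : X → (leibnizSuperalgebra deg rel hrel).Cov)
    (N : Submodule R (leibnizSuperalgebra deg rel hrel).Cov)
    (hN : ∀ t ∈ rel, covLift deg rel hrel g t ∈ N) :
    LinearMap.ker (leibnizSuperalgebra deg rel hrel).covBracket ≤ N := by
  have hI : relIdeal deg rel ≤ relIdeal deg rel ⊓ N.comap (covLift deg rel hrel g) := by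
    refine sInf_le ⟨?_, fun t ht => ⟨subset_relIdeal ht, hN t ht⟩, fun t ht => ?_⟩
    · intro x y hxy
      refine ⟨relIdeal_isIdeal x y (hxy.imp (·.1) (·.1)), ?_⟩
      rw [SetLike.mem_coe, Submodule.mem_comap, covLift_mul]
      rcases hxy with h | h
      · rw [mkQ_eq_zero h.1, map_zero, LinearMap.zero_apply]
        exact zero_mem _
      · rw [mkQ_eq_zero h.1, map_zero]
        exact zero_mem _
    · refine ⟨leibniz_subset_relIdeal ht, ?_⟩
      obtain ⟨p, q, r, x, hx, y, hy, z, hz, rfl⟩ := ht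
      rw [SetLike.mem_coe, Submodule.mem_comap, map_add, map_sub, map_zsmul, covLift_mul,
        covLift_mul, covLift_mul]
      have := (leibnizSuperalgebra deg rel hrel).cls_leibniz ((relIdeal deg rel).mkQ x)
        (mkQ_mem_gr (hrel := hrel) hy) (mkQ_mem_gr (hrel := hrel) hz)
      have e : ∀ a b, (leibnizSuperalgebra deg rel hrel).bracket ((relIdeal deg rel).mkQ a)
        ((relIdeal deg rel).mkQ b) = (relIdeal deg rel).mkQ (a * b) := fun a b => rfl
      rw [e, e, e] at this
      rw [this]
      convert zero_mem N using 1
      abel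
  let s : Carrier deg rel →ₗ[R] (leibnizSuperalgebra deg rel hrel).Cov ⧸ N :=
    (relIdeal deg rel).liftQ (N.mkQ ∘ₗ covLift deg rel hrel g) fun t ht =>
      (Submodule.Quotient.mk_eq_zero N).2 (hI ht).2
  have hs : s ∘ₗ (leibnizSuperalgebra deg rel hrel).covBracket = N.mkQ := by
    refine Submodule.linearMap_qext _ (TensorProduct.ext' fun x y => ?_)
    obtain ⟨x, rfl⟩ := Submodule.mkQ_surjective _ x
    obtain ⟨y, rfl⟩ := Submodule.mkQ_surjective _ y
    exact congrArg N.mkQ (covLift_mul (hrel := hrel) (g := g) x y)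
  intro u hu
  rw [← Submodule.Quotient.mk_eq_zero N, ← Submodule.mkQ_apply, ← hs, LinearMap.comp_apply,
    LinearMap.mem_ker.1 hu, map_zero]

end LeibnizPresentation

/-! ### Brackets in the Steinberg Leibniz superalgebra -/

namespace UnitalSuperdialgebra

variable {R D : Type*} [CommRing R] [AddCommGroup D] [Module R D]
  (𝒟 : UnitalSuperdialgebra R D) (m n : ℕ)

/-- The module underlying `𝔰𝔱(m, n, D)`. -/
abbrev St : Type _ :=
  LeibnizPresentation.Carrier (SteinbergGen.deg 𝒟) {t | 𝒟.SteinbergRelator m n t}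

variable {m n}

theorem mkQ_eq_mkQ {x y : FreeNonUnitalNonAssocAlgebra R (𝒟.SteinbergGen m n)}
    (h : 𝒟.SteinbergRelator m n (x - y)) :
    (LeibnizPresentation.relIdeal (SteinbergGen.deg 𝒟) {t | 𝒟.SteinbergRelator m n t}).mkQ x =
    (LeibnizPresentation.relIdeal (SteinbergGen.deg 𝒟) {t | 𝒟.SteinbergRelator m n t}).mkQ y := by
  rw [← sub_eq_zero, ← map_sub]
  exact LeibnizPresentation.mkQ_eq_zero (LeibnizPresentation.subset_relIdeal h)

/-- The linear map `a ↦ F_{ij}(a)` on the elements of parity `p`. -/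
def stHom {i j : Fin m ⊕ Fin n} (h : i ≠ j) (p : ZMod 2) : 𝒟.gr p →ₗ[R] 𝒟.St m n where
  toFun a := (LeibnizPresentation.relIdeal _ _).mkQ (𝒟.F h a)
  map_add' a b := by
    rw [← map_add]
    exact 𝒟.mkQ_eq_mkQ (by rw [← sub_sub]; exact .add h a b)
  map_smul' c a := by
    rw [RingHom.id_apply, ← map_smul]
    exact 𝒟.mkQ_eq_mkQ (.smul h c a)

/-- The linear map `a ↦ F_{ij}(a)` from `D` to `𝔰𝔱(m, n, D)`. -/
def stF {i j : Fin m ⊕ Fin n} (h : i ≠ j) : D →ₗ[R] 𝒟.St m n :=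
  LinearMap.ofIsCompl 𝒟.isCompl (𝒟.stHom h 0) (𝒟.stHom h 1)

theorem stF_apply {i j : Fin m ⊕ Fin n} (h : i ≠ j) {p : ZMod 2} {a : D} (ha : a ∈ 𝒟.gr p) :
    𝒟.stF h a = (LeibnizPresentation.relIdeal _ _).mkQ (𝒟.F h ⟨a, ha⟩) := by
  rcases zmod_two_eq_zero_or_one p with rfl | rfl
  · exact LinearMap.ofIsCompl_apply_left 𝒟.isCompl (⟨a, ha⟩ : 𝒟.gr 0)
  · exact LinearMap.ofIsCompl_apply_right 𝒟.isCompl (⟨a, ha⟩ : 𝒟.gr 1)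

theorem stF_mem {i j : Fin m ⊕ Fin n} (h : i ≠ j) {p : ZMod 2} {a : D} (ha : a ∈ 𝒟.gr p) :
    𝒟.stF h a ∈ (𝒟.steinberg m n).gr (indexDeg m n i + indexDeg m n j + p) := by
  rw [𝒟.stF_apply h ha]
  exact LeibnizPresentation.mkQ_mem_gr (𝒟.F_mem h _)

theorem bracket_left {i j l : Fin m ⊕ Fin n} (hij : i ≠ j) (hjl : j ≠ l) (hil : i ≠ l)
    {p q : ZMod 2} {a b : D} (ha : a ∈ 𝒟.gr p) (hb : b ∈ 𝒟.gr q) :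
    (𝒟.steinberg m n).bracket (𝒟.stF hij a) (𝒟.stF hjl b) = 𝒟.stF hil (𝒟.left a b) := by
  rw [𝒟.stF_apply hij ha, 𝒟.stF_apply hjl hb, 𝒟.stF_apply hil (𝒟.left_mem ha hb)]
  exact 𝒟.mkQ_eq_mkQ (.left hij hjl hil ⟨a, ha⟩ ⟨b, hb⟩)

theorem bracket_right {i j k : Fin m ⊕ Fin n} (hij : i ≠ j) (hki : k ≠ i) (hkj : k ≠ j)
    {p q : ZMod 2} {a b : D} (ha : a ∈ 𝒟.gr p) (hb : b ∈ 𝒟.gr q) :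
    (𝒟.steinberg m n).bracket (𝒟.stF hij a) (𝒟.stF hki b) =
      -(koszulSign (indexDeg m n i + indexDeg m n j + p) (indexDeg m n k + indexDeg m n i + q) •
        𝒟.stF hkj (𝒟.right b a)) := by
  rw [𝒟.stF_apply hij ha, 𝒟.stF_apply hki hb, 𝒟.stF_apply hkj (𝒟.right_mem hb ha), ← map_zsmul,
    ← map_neg]
  refine 𝒟.mkQ_eq_mkQ ?_
  rw [sub_neg_eq_add]
  have := SteinbergRelator.right hij hki hkj ⟨a, ha⟩ ⟨b, hb⟩
  exact this

theorem bracket_zero {i j k l : Fin m ⊕ Fin n} (hij : i ≠ j) (hkl : k ≠ l) (hil : i ≠ l)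
    (hjk : j ≠ k) {p q : ZMod 2} {a b : D} (ha : a ∈ 𝒟.gr p) (hb : b ∈ 𝒟.gr q) :
    (𝒟.steinberg m n).bracket (𝒟.stF hij a) (𝒟.stF hkl b) = 0 := by
  rw [𝒟.stF_apply hij ha, 𝒟.stF_apply hkl hb]
  exact LeibnizPresentation.mkQ_eq_zero
    (LeibnizPresentation.subset_relIdeal (.zero hij hkl hil hjk ⟨a, ha⟩ ⟨b, hb⟩))

/-- The element `[F_{pq}(1), F_{qp}(1)]`, which acts diagonally on the `F_{kl}(a)`. -/
def tor {p q : Fin m ⊕ Fin n} (h : p ≠ q) : 𝒟.St m n :=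
  (𝒟.steinberg m n).bracket (𝒟.stF h 𝒟.one) (𝒟.stF h.symm 𝒟.one)

theorem tor_mem {p q : Fin m ⊕ Fin n} (h : p ≠ q) : 𝒟.tor h ∈ (𝒟.steinberg m n).gr 0 := by
  have := (𝒟.steinberg m n).bracket_mem (𝒟.stF_mem h 𝒟.one_mem) (𝒟.stF_mem h.symm 𝒟.one_mem)
  rw [← tor] at this
  convert this using 2
  generalize indexDeg m n p = u
  generalize indexDeg m n q = v
  revert u v; decide

variable (m n) in
/-- The diagonal entries of `[F_{pq}(1), F_{qp}(1)]`: `1` at `p` and `-(-1)^{|p|+|q|}` at `q`. -/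
def weight (p q k : Fin m ⊕ Fin n) : ℤ :=
  if k = p then 1 else if k = q then
    -koszulSign (indexDeg m n p + indexDeg m n q) (indexDeg m n p + indexDeg m n q) else 0

theorem bracket_bracket_even {q r : ZMod 2} {x y h : 𝒟.St m n}
    (hx : x ∈ (𝒟.steinberg m n).gr q) (hy : y ∈ (𝒟.steinberg m n).gr r)
    (hh : h ∈ (𝒟.steinberg m n).gr 0) :
    (𝒟.steinberg m n).bracket ((𝒟.steinberg m n).bracket x y) h =
      (𝒟.steinberg m n).bracket x ((𝒟.steinberg m n).bracket y h) +
        (𝒟.steinberg m n).bracket ((𝒟.steinberg m n).bracket x h) y := by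
  rw [(𝒟.steinberg m n).leibniz hx hy hh, koszulSign_zero_right, one_smul, sub_add_cancel]

/-- The case of `bracket_tor` in which at most one of the indices of `F_{kl}(a)` meets `{p, q}`. -/
theorem bracket_tor_aux {p q k l : Fin m ⊕ Fin n} (h : p ≠ q) (hkl : k ≠ l)
    (h1 : ¬(k = p ∧ l = q)) (h2 : ¬(k = q ∧ l = p)) {α : ZMod 2} {a : D} (ha : a ∈ 𝒟.gr α) :
    (𝒟.steinberg m n).bracket (𝒟.stF hkl a) (𝒟.tor h) =
      (weight m n p q l - weight m n p q k) • 𝒟.stF hkl a := by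
  have hone := 𝒟.one_mem
  have hleft : 𝒟.left a 𝒟.one = a := 𝒟.left_one a
  have hright : 𝒟.right 𝒟.one a = a := 𝒟.one_right a
  rw [tor, (𝒟.steinberg m n).leibniz (𝒟.stF_mem hkl ha) (𝒟.stF_mem h hone)
    (𝒟.stF_mem h.symm hone)]
  by_cases hkp : k = p
  · subst hkp
    have hlq : l ≠ q := fun e => h1 ⟨rfl, e⟩
    rw [𝒟.bracket_zero hkl h h hkl.symm ha hone, 𝒟.bracket_right hkl h.symm hlq.symm ha hone,
      hright]
    simp only [map_zero, map_zsmul, LinearMap.zero_apply, LinearMap.smul_apply,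
      𝒟.bracket_right hlq.symm h hkl ha hone, hright, smul_smul, zero_sub, ← neg_smul]
    congr 1
    simp only [weight, if_neg hkl.symm, if_neg hlq, if_true]
    generalize indexDeg m n k = u
    generalize indexDeg m n q = v
    generalize indexDeg m n l = w
    clear hone ha
    revert u v w α; decide
  by_cases hkq : k = q
  · subst hkq
    have hlp : l ≠ p := fun e => h2 ⟨rfl, e⟩
    rw [𝒟.bracket_zero hkl h.symm h.symm hkl.symm ha hone, 𝒟.bracket_right hkl h hlp.symm ha hone,
      hright]
    simp only [map_zero, map_neg, map_zsmul, LinearMap.zero_apply, LinearMap.neg_apply,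
      LinearMap.smul_apply, 𝒟.bracket_right hlp.symm h.symm hkl ha hone, hright, smul_neg,
      smul_smul, neg_neg, sub_zero, smul_zero]
    congr 1
    simp only [weight, if_neg hkl.symm, if_neg hlp, if_neg hkp, if_true]
    generalize indexDeg m n k = u
    generalize indexDeg m n p = v
    generalize indexDeg m n l = w
    clear hone ha
    revert u v w α; decide
  by_cases hlp : l = p
  · subst hlp
    rw [𝒟.bracket_zero hkl h.symm hkl h ha hone, 𝒟.bracket_left hkl h hkq ha hone, hleft,
      𝒟.bracket_left hkq h.symm hkl ha hone, hleft]
    simp [weight, hkq, hkp]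
  by_cases hlq : l = q
  · subst hlq
    rw [𝒟.bracket_zero hkl h hkl h.symm ha hone, 𝒟.bracket_left hkl h.symm hkp ha hone, hleft,
      𝒟.bracket_left hkp h hkl ha hone, hleft, add_zero, add_zero,
      add_comm (indexDeg m n l) (indexDeg m n p)]
    simp [weight, hkq, hkp, hlp]
  · rw [𝒟.bracket_zero hkl h.symm hkp hlq ha hone, 𝒟.bracket_zero hkl h hkq hlp ha hone]
    simp [weight, hkq, hkp, hlp, hlq]

/-- The right action of `[F_{pq}(1), F_{qp}(1)]` on `F_{kl}(a)`. If `{k, l} = {p, q}`, this follows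
from the other cases by writing `F_{kl}(a) = [F_{kr}(a), F_{rl}(1)]`. -/
theorem bracket_tor (hthird : ∀ i j : Fin m ⊕ Fin n, ∃ r, r ≠ i ∧ r ≠ j)
    {p q k l : Fin m ⊕ Fin n} (h : p ≠ q) (hkl : k ≠ l) {α : ZMod 2} {a : D} (ha : a ∈ 𝒟.gr α) :
    (𝒟.steinberg m n).bracket (𝒟.stF hkl a) (𝒟.tor h) =
      (weight m n p q l - weight m n p q k) • 𝒟.stF hkl a := by
  by_cases hpq : (k = p ∧ l = q) ∨ (k = q ∧ l = p)
  · obtain ⟨r, hrk, hrl⟩ := hthird k l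
    have hr : r ≠ p ∧ r ≠ q := by
      rcases hpq with ⟨rfl, rfl⟩ | ⟨rfl, rfl⟩
      · exact ⟨hrk, hrl⟩
      · exact ⟨hrl, hrk⟩
    have hF : 𝒟.stF hkl a =
        (𝒟.steinberg m n).bracket (𝒟.stF hrk.symm a) (𝒟.stF hrl 𝒟.one) := by
      rw [𝒟.bracket_left hrk.symm hrl hkl ha 𝒟.one_mem]
      exact congrArg _ (𝒟.left_one a).symm
    rw [hF, 𝒟.bracket_bracket_even (𝒟.stF_mem _ ha) (𝒟.stF_mem _ 𝒟.one_mem) (𝒟.tor_mem h),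
      𝒟.bracket_tor_aux h hrl (fun e => hr.1 e.1) (fun e => hr.2 e.1) 𝒟.one_mem,
      𝒟.bracket_tor_aux h hrk.symm (fun e => hr.2 e.2) (fun e => hr.1 e.2) ha,
      map_zsmul, map_zsmul, LinearMap.smul_apply, ← add_smul]
    congr 1
    abel
  · rw [not_or] at hpq
    exact 𝒟.bracket_tor_aux h hkl hpq.1 hpq.2 ha

/-- The class of `F_{ij}(a) ⊗ F_{kl}(b)` as a function of the weight of `F_{ij}(a) ⊗ F_{kl}(b)`. -/
theorem cls_tor (hthird : ∀ i j : Fin m ⊕ Fin n, ∃ r, r ≠ i ∧ r ≠ j)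
    {p q i j k l : Fin m ⊕ Fin n} (h : p ≠ q) (hij : i ≠ j) (hkl : k ≠ l) {α β : ZMod 2} {a b : D}
    (ha : a ∈ 𝒟.gr α) (hb : b ∈ 𝒟.gr β) :
    (weight m n p q j - weight m n p q i + (weight m n p q l - weight m n p q k)) •
        (𝒟.steinberg m n).cls (𝒟.stF hij a) (𝒟.stF hkl b) =
      (𝒟.steinberg m n).cls ((𝒟.steinberg m n).bracket (𝒟.stF hij a) (𝒟.stF hkl b)) (𝒟.tor h) :=
  (𝒟.steinberg m n).cls_weight (𝒟.stF_mem _ hb) (𝒟.tor_mem h) (𝒟.bracket_tor hthird h hij ha)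
    (𝒟.bracket_tor hthird h hkl hb)

/-- The lift to `(L ⊗ L) / Im δ₃` of the free algebra on the generators of `L = 𝔰𝔱(m, n, D)`
determined by a choice of lifts of the generators. -/
def stCovLift (g : 𝒟.SteinbergGen m n → (𝒟.steinberg m n).Cov) :
    FreeNonUnitalNonAssocAlgebra R (𝒟.SteinbergGen m n) →ₗ[R] (𝒟.steinberg m n).Cov :=
  LeibnizPresentation.covLift _ _ 𝒟.steinbergRelator_homogeneous g

theorem stCovLift_F (g : 𝒟.SteinbergGen m n → (𝒟.steinberg m n).Cov) {i j : Fin m ⊕ Fin n}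
    (h : i ≠ j) {p : ZMod 2} (a : 𝒟.gr p) : 𝒟.stCovLift g (𝒟.F h a) = g ⟨i, j, h, p, a⟩ :=
  LeibnizPresentation.covLift_of _

theorem stCovLift_F_mul_F (g : 𝒟.SteinbergGen m n → (𝒟.steinberg m n).Cov)
    {i j k l : Fin m ⊕ Fin n} (h : i ≠ j) (h' : k ≠ l) {p q : ZMod 2} (a : 𝒟.gr p) (b : 𝒟.gr q) :
    𝒟.stCovLift g (𝒟.F h a * 𝒟.F h' b) =
      (𝒟.steinberg m n).cls (𝒟.stF h (a : D)) (𝒟.stF h' (b : D)) := by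
  rw [𝒟.stF_apply h a.2, 𝒟.stF_apply h' b.2]
  exact LeibnizPresentation.covLift_mul _ _

theorem ker_covBracket_le_of_relator (g : 𝒟.SteinbergGen m n → (𝒟.steinberg m n).Cov)
    (N : Submodule R (𝒟.steinberg m n).Cov)
    (hN : ∀ t, 𝒟.SteinbergRelator m n t → 𝒟.stCovLift g t ∈ N) :
    LinearMap.ker (𝒟.steinberg m n).covBracket ≤ N :=
  LeibnizPresentation.ker_covBracket_le 𝒟.steinbergRelator_homogeneous g N hN

/-- The kernel of `(L ⊗ L) / Im δ₃ → L` for `L = 𝔰𝔱(m, n, D)` is contained in every submodule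
containing the classes of `F_{ij}(a) ⊗ F_{kl}(b)` for `i ≠ l`, `j ≠ k`. The generator `F_{ij}(a)` is
lifted to `-F_{ij}(a) ⊗ [F_{ir}(1), F_{ri}(1)]`, which does not depend on `r`; the other relations
hold because `[F_{ir}(1), F_{ri}(1)]` acts by `-1` on tensors of the weight of `F_{ij}`. -/
theorem ker_covBracket_le (hthird : ∀ i j : Fin m ⊕ Fin n, ∃ r, r ≠ i ∧ r ≠ j)
    (N : Submodule R (𝒟.steinberg m n).Cov)
    (hN : ∀ i j k l, ∀ (hij : i ≠ j) (hkl : k ≠ l), i ≠ l → j ≠ k → ∀ α β, ∀ a ∈ 𝒟.gr α,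
      ∀ b ∈ 𝒟.gr β, (𝒟.steinberg m n).cls (𝒟.stF hij a) (𝒟.stF hkl b) ∈ N) :
    LinearMap.ker (𝒟.steinberg m n).covBracket ≤ N := by
  choose r hr using hthird
  have hthird : ∀ i j : Fin m ⊕ Fin n, ∃ r, r ≠ i ∧ r ≠ j := fun i j => ⟨r i j, hr i j⟩
  let g : 𝒟.SteinbergGen m n → (𝒟.steinberg m n).Cov := fun x =>
    -(𝒟.steinberg m n).cls (𝒟.stF x.ne (x.a : D)) (𝒟.tor (hr x.i x.j).1.symm)
  have hg : ∀ {i j : Fin m ⊕ Fin n} (h : i ≠ j) {p : ZMod 2} (a : 𝒟.gr p),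
      𝒟.stCovLift g (𝒟.F h a) =
        -(𝒟.steinberg m n).cls (𝒟.stF h (a : D)) (𝒟.tor (hr i j).1.symm) := fun h p a =>
    𝒟.stCovLift_F g h a
  have hmul := fun {i j k l : Fin m ⊕ Fin n} (h : i ≠ j) (h' : k ≠ l) {p q : ZMod 2} (a : 𝒟.gr p)
    (b : 𝒟.gr q) => 𝒟.stCovLift_F_mul_F g h h' a b
  refine 𝒟.ker_covBracket_le_of_relator g N ?_
  intro t ht
  cases ht with
  | add h a b =>
    rw [map_sub, map_sub, hg, hg, hg, Submodule.coe_add, map_add, map_add, LinearMap.add_apply]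
    convert zero_mem N using 1
    abel
  | smul h c a =>
    rw [map_sub, map_smul, hg, hg, Submodule.coe_smul, map_smul, map_smul, LinearMap.smul_apply]
    convert zero_mem N using 1
    rw [smul_neg]
    abel
  | @left i j l hij hjl hil p q a b =>
    have h := 𝒟.cls_tor hthird (hr i l).1.symm hij hjl a.2 b.2
    rw [𝒟.bracket_left hij hjl hil a.2 b.2] at h
    rw [map_sub, hmul, hg]
    convert zero_mem N using 1
    rw [sub_neg_eq_add]
    have hw : weight m n i (r i l) l = 0 := by simp [weight, hil.symm, (hr i l).2.symm]
    have hw' : weight m n i (r i l) i = 1 := by simp [weight]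
    rw [hw, hw', show ∀ x : ℤ, x - 1 + (0 - x) = -1 by intro x; ring, neg_smul, one_smul] at h
    rw [hleft, ← h]
    exact add_neg_cancel _
  | @right i j k hij hki hkj p q a b =>
    have h := 𝒟.cls_tor hthird (hr k j).1.symm hij hki a.2 b.2
    rw [𝒟.bracket_right hij hki hkj a.2 b.2] at h
    rw [map_add, map_zsmul, hmul, hg]
    convert zero_mem N using 1
    have hw : weight m n k (r k j) j = 0 := by simp [weight, hkj.symm, (hr k j).2.symm]
    have hw' : weight m n k (r k j) k = 1 := by simp [weight]
    rw [hw, hw', show ∀ x : ℤ, 0 - x + (x - 1) = -1 by intro x; ring, neg_smul, one_smul, map_neg,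
      map_zsmul, LinearMap.neg_apply, LinearMap.smul_apply, neg_inj] at h
    rw [hright, h, smul_neg]
    exact add_neg_cancel _
  | zero hij hkl hil hjk a b =>
    rw [hmul]
    exact hN _ _ _ _ hij hkl hil hjk _ _ a a.2 b b.2

/-- The class of `F_{ij}(a) ⊗ F_{kl}(b)` is a cycle for `i ≠ l`, `j ≠ k`, and so is annihilated by
the values of its weight. -/
theorem weight_smul_cls (hthird : ∀ i j : Fin m ⊕ Fin n, ∃ r, r ≠ i ∧ r ≠ j)
    {p q i j k l : Fin m ⊕ Fin n} (h : p ≠ q) (hij : i ≠ j) (hkl : k ≠ l) (hil : i ≠ l)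
    (hjk : j ≠ k) {α β : ZMod 2} {a b : D} (ha : a ∈ 𝒟.gr α) (hb : b ∈ 𝒟.gr β) :
    (weight m n p q j - weight m n p q i + (weight m n p q l - weight m n p q k)) •
        (𝒟.steinberg m n).cls (𝒟.stF hij a) (𝒟.stF hkl b) = 0 := by
  rw [𝒟.cls_tor hthird h hij hkl ha hb, 𝒟.bracket_zero hij hkl hil hjk ha hb, map_zero,
    LinearMap.zero_apply]

theorem cls_eq_zero_of_weight (hthird : ∀ i j : Fin m ⊕ Fin n, ∃ r, r ≠ i ∧ r ≠ j)
    {p q i j k l : Fin m ⊕ Fin n} (h : p ≠ q) (hij : i ≠ j) (hkl : k ≠ l) (hil : i ≠ l)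
    (hjk : j ≠ k)
    (hw : IsUnit (weight m n p q j - weight m n p q i + (weight m n p q l - weight m n p q k)))
    {α β : ZMod 2} {a b : D} (ha : a ∈ 𝒟.gr α) (hb : b ∈ 𝒟.gr β) :
    (𝒟.steinberg m n).cls (𝒟.stF hij a) (𝒟.stF hkl b) = 0 := by
  have h0 := 𝒟.weight_smul_cls hthird h hij hkl hil hjk ha hb
  obtain e | e := Int.isUnit_iff.1 hw
  · rwa [e, one_smul] at h0
  · rwa [e, neg_smul, one_smul, neg_eq_zero] at h0

theorem cls_same_eq_zero (hthird : ∀ i j : Fin m ⊕ Fin n, ∃ r, r ≠ i ∧ r ≠ j)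
    {i j : Fin m ⊕ Fin n} (hij : i ≠ j) {α β : ZMod 2} {a b : D} (ha : a ∈ 𝒟.gr α)
    (hb : b ∈ 𝒟.gr β) : (𝒟.steinberg m n).cls (𝒟.stF hij a) (𝒟.stF hij b) = 0 := by
  obtain ⟨r, hri, hrj⟩ := hthird i j
  have hF : 𝒟.stF hij b =
      (𝒟.steinberg m n).bracket (𝒟.stF hri.symm b) (𝒟.stF hrj 𝒟.one) := by
    rw [𝒟.bracket_left hri.symm hrj hij hb 𝒟.one_mem]
    exact congrArg _ (𝒟.left_one b).symm
  rw [hF, (𝒟.steinberg m n).cls_leibniz _ (𝒟.stF_mem _ hb) (𝒟.stF_mem _ 𝒟.one_mem),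
    𝒟.bracket_zero hij hri.symm hri.symm hij.symm ha hb,
    𝒟.bracket_zero hij hrj hij hrj.symm ha 𝒟.one_mem]
  simp

end UnitalSuperdialgebra

/-! ### Linear maps killing the ideal `I_N`, and the vanishing of `HL₂` -/

/-- A linear map on `D` that is symmetric in the sense of `hcomm` and `hswap` and killed by `N`
vanishes on the ideal `I_N`. The elements `x` with `φ (x ⊣ d) = φ (c ⊣ (x ⊣ d)) = 0` for all `c`,
`d` form, after passing to homogeneous components, an ideal containing the generators of `I_N`. -/
theorem UnitalSuperdialgebra.idealOf_le_ker {R D V : Type*} [CommRing R] [AddCommGroup D]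
    [Module R D] [AddCommGroup V] [Module R V] (𝒟 : UnitalSuperdialgebra R D) (φ : D →ₗ[R] V)
    (N : ℕ) (hN : ∀ a, (N : ℤ) • φ a = 0)
    (hcomm : ∀ p q, ∀ a ∈ 𝒟.gr p, ∀ b ∈ 𝒟.gr q,
      φ (𝒟.left a b) = koszulSign p q • φ (𝒟.right b a))
    (hswap : ∀ p q r, ∀ a ∈ 𝒟.gr p, ∀ b ∈ 𝒟.gr q, ∀ c ∈ 𝒟.gr r,
      φ (𝒟.left (𝒟.left a b) c) = koszulSign q r • φ (𝒟.left (𝒟.left a c) b)) :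
    𝒟.idealOf N ≤ LinearMap.ker φ := by
  have hcomm' : ∀ p q, ∀ a ∈ 𝒟.gr p, ∀ b ∈ 𝒟.gr q,
      φ (𝒟.right b a) = koszulSign p q • φ (𝒟.left a b) := by
    intro p q a ha b hb
    rw [hcomm p q a ha b hb, smul_smul, koszulSign_mul_self, one_smul]
  let K : Submodule R D :=
    { carrier := {x | ∀ r t, ∀ d ∈ 𝒟.gr r, ∀ c ∈ 𝒟.gr t,
        φ (𝒟.left x d) = 0 ∧ φ (𝒟.left c (𝒟.left x d)) = 0}
      zero_mem' := fun r t d _ c _ => by simp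
      add_mem' := fun {x y} hx hy r t d hd c hc => by
        simp [(hx r t d hd c hc).1, (hx r t d hd c hc).2, (hy r t d hd c hc).1,
          (hy r t d hd c hc).2]
      smul_mem' := fun e x hx r t d hd c hc => by
        simp [(hx r t d hd c hc).1, (hx r t d hd c hc).2] }
  have hKφ : ∀ x ∈ K, φ x = 0 := fun x hx => by
    simpa [𝒟.left_one] using (hx 0 0 _ 𝒟.one_mem _ 𝒟.one_mem).1
  have hKφ' : ∀ x ∈ K, ∀ t, ∀ c ∈ 𝒟.gr t, φ (𝒟.left c x) = 0 := fun x hx t c hc => by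
    simpa [𝒟.left_one] using (hx 0 t _ 𝒟.one_mem c hc).2
  have key : ∀ p q x y, x ∈ K → x ∈ 𝒟.gr p → y ∈ 𝒟.gr q →
      (𝒟.left x y ∈ K ∧ 𝒟.right x y ∈ K) ∧ 𝒟.left y x ∈ K ∧ 𝒟.right y x ∈ K := by
    intro p q x y hK hx hy
    refine ⟨⟨?_, ?_⟩, ?_, ?_⟩
    · intro r t d hd c hc
      rw [𝒟.left_assoc]
      exact hK _ t _ (𝒟.left_mem hy hd) c hc
    · intro r t d hd c hc
      rw [𝒟.right_left, ← 𝒟.left_left, hcomm' _ _ _ (𝒟.left_mem hy hd) _ hx,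
        hKφ' x hK _ _ (𝒟.left_mem hy hd), smul_zero]
      exact ⟨rfl, (hK _ t _ (𝒟.left_mem hy hd) c hc).2⟩
    · intro r t d hd c hc
      rw [𝒟.left_assoc, ← 𝒟.left_assoc c]
      exact ⟨(hK r q d hd y hy).2, (hK r _ d hd _ (𝒟.left_mem hc hy)).2⟩
    · intro r t d hd c hc
      rw [𝒟.right_left, ← 𝒟.left_left, ← 𝒟.left_assoc c,
        hcomm' _ _ _ (𝒟.left_mem hx hd) _ hy, 𝒟.left_assoc,
        (hK _ t _ (𝒟.left_mem hd hy) c hc).1, smul_zero]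
      exact ⟨rfl, (hK r _ d hd _ (𝒟.left_mem hc hy)).2⟩
  set T : Submodule R D := K ⊓ 𝒟.gr 0 ⊔ K ⊓ 𝒟.gr 1 with hT
  have hI : 𝒟.idealOf N ≤ T := by
    have hmem : ∀ p x, x ∈ K → x ∈ 𝒟.gr p → x ∈ T := by
      intro p x hK hx
      rcases zmod_two_eq_zero_or_one p with rfl | rfl
      · exact Submodule.mem_sup_left ⟨hK, hx⟩
      · exact Submodule.mem_sup_right ⟨hK, hx⟩
    have hideal : ∀ x ∈ T, ∀ y,
        (𝒟.left x y ∈ T ∧ 𝒟.right x y ∈ T) ∧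
        𝒟.left y x ∈ T ∧ 𝒟.right y x ∈ T := by
      intro x hx y
      obtain ⟨u, hu, v, hv, huv⟩ := Submodule.mem_sup.1 hx
      refine induction_homogeneous 𝒟.isCompl (P := fun y =>
          (𝒟.left x y ∈ T ∧ 𝒟.right x y ∈ T) ∧ 𝒟.left y x ∈ T ∧ 𝒟.right y x ∈ T)
        (fun q y hy => ?_) ?_ y
      · have h0 := key 0 q u y hu.1 hu.2 hy
        have h1 := key 1 q v y hv.1 hv.2 hy
        simp only [← huv, map_add, LinearMap.add_apply]
        exact ⟨⟨add_mem (hmem _ _ h0.1.1 (𝒟.left_mem hu.2 hy))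
            (hmem _ _ h1.1.1 (𝒟.left_mem hv.2 hy)),
          add_mem (hmem _ _ h0.1.2 (𝒟.right_mem hu.2 hy))
            (hmem _ _ h1.1.2 (𝒟.right_mem hv.2 hy))⟩,
          add_mem (hmem _ _ h0.2.1 (𝒟.left_mem hy hu.2))
            (hmem _ _ h1.2.1 (𝒟.left_mem hy hv.2)),
          add_mem (hmem _ _ h0.2.2 (𝒟.right_mem hy hu.2))
            (hmem _ _ h1.2.2 (𝒟.right_mem hy hv.2))⟩
      · rintro y z ⟨⟨h1, h2⟩, h3, h4⟩ ⟨⟨h1', h2'⟩, h3', h4'⟩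
        rw [map_add, map_add, map_add, map_add, LinearMap.add_apply, LinearMap.add_apply]
        exact ⟨⟨add_mem h1 h1', add_mem h2 h2'⟩, add_mem h3 h3', add_mem h4 h4'⟩
    refine sInf_le ⟨?_, ?_⟩
    · rintro x y (h | h)
      · exact (hideal x h y).1
      · exact (hideal y h x).2
    · rintro _ (⟨a, rfl⟩ | ⟨p, q, a, ha, b, hb, rfl⟩)
      · refine induction_homogeneous 𝒟.isCompl (P := fun a => (N : R) • a ∈ _)
          (fun p a ha => ?_) (fun x y hx hy => by rw [smul_add]; exact add_mem hx hy) a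
        refine hmem p _ ?_ (Submodule.smul_mem _ _ ha)
        have hN' : ∀ a, (N : R) • φ a = 0 := fun a => by
          rw [← hN a, Nat.cast_smul_eq_nsmul, natCast_zsmul]
        intro r t d _ c _
        simp [hN']
      · refine hmem (p + q) _ ?_ (sub_mem (𝒟.left_mem ha hb)
          (zsmul_mem (add_comm q p ▸ 𝒟.right_mem hb ha) _))
        intro r t d hd c hc
        have e1 : φ (𝒟.left (𝒟.right b a) d) = koszulSign p q • φ (𝒟.left (𝒟.left a b) d) := by
          rw [𝒟.right_left, hcomm' _ _ _ (𝒟.left_mem ha hd) _ hb, hswap _ _ _ a ha d hd b hb,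
            smul_smul]
          congr 1
          clear ha hb hd hc
          revert p q r; decide
        have e2 : φ (𝒟.left c (𝒟.left (𝒟.right b a) d)) =
            koszulSign p q • φ (𝒟.left c (𝒟.left (𝒟.left a b) d)) := by
          rw [𝒟.right_left, ← 𝒟.left_left, ← 𝒟.left_assoc c,
            hswap _ _ _ c hc b hb _ (𝒟.left_mem ha hd), 𝒟.left_assoc a, ← 𝒟.left_assoc c,
            ← 𝒟.left_assoc c, hswap _ _ _ _ (𝒟.left_mem hc ha) d hd b hb, 𝒟.left_assoc _ b,
            smul_smul]
          congr 1
          clear ha hb hd hc e1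
          revert p q r; decide
        simp only [map_sub, map_zsmul, LinearMap.sub_apply, LinearMap.smul_apply, e1, e2, smul_smul,
          koszulSign_mul_self, one_smul, sub_self, and_self]
  intro x hx
  obtain ⟨u, hu, v, hv, rfl⟩ := Submodule.mem_sup.1 (hI hx)
  rw [LinearMap.mem_ker, map_add, hKφ u hu.1, hKφ v hv.1, add_zero]

namespace UnitalSuperdialgebra

variable {R D : Type*} [CommRing R] [AddCommGroup D] [Module R D]
  (𝒟 : UnitalSuperdialgebra R D) {m n : ℕ}

/-- The class of `F_{ij}(a) ⊗ F_{kl}(b)`, as a bilinear map in `a` and `b`. -/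
def clsF {i j k l : Fin m ⊕ Fin n} (hij : i ≠ j) (hkl : k ≠ l) :
    D →ₗ[R] D →ₗ[R] (𝒟.steinberg m n).Cov :=
  (𝒟.steinberg m n).cls.compl₁₂ (𝒟.stF hij) (𝒟.stF hkl)

theorem clsF_apply {i j k l : Fin m ⊕ Fin n} (hij : i ≠ j) (hkl : k ≠ l) (a b : D) :
    𝒟.clsF hij hkl a b = (𝒟.steinberg m n).cls (𝒟.stF hij a) (𝒟.stF hkl b) := rfl

theorem covBracket_clsF {i j k l : Fin m ⊕ Fin n} (hij : i ≠ j) (hkl : k ≠ l) (hil : i ≠ l)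
    (hjk : j ≠ k) (a b : D) : (𝒟.steinberg m n).covBracket (𝒟.clsF hij hkl a b) = 0 := by
  rw [clsF_apply, LeibnizSuperalgebra.covBracket_cls]
  refine induction_homogeneous 𝒟.isCompl
    (P := fun a => (𝒟.steinberg m n).bracket (𝒟.stF hij a) (𝒟.stF hkl b) = 0) (fun p a ha => ?_)
    (fun x y hx hy => by rw [map_add, map_add, LinearMap.add_apply, hx, hy, add_zero]) a
  refine induction_homogeneous 𝒟.isCompl
    (P := fun b => (𝒟.steinberg m n).bracket (𝒟.stF hij a) (𝒟.stF hkl b) = 0) (fun q b hb => ?_)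
    (fun x y hx hy => by rw [map_add, map_add, hx, hy, add_zero]) b
  exact 𝒟.bracket_zero hij hkl hil hjk ha hb

/-- An index `r` distinct from `i`, `j`, `k`, `l` provides a diagonal element of weight `±1` on
`F_{ij}(a) ⊗ F_{kl}(b)`, unless both factors have the same indices. -/
theorem clsF_eq_zero_of_index (hthird : ∀ i j : Fin m ⊕ Fin n, ∃ r, r ≠ i ∧ r ≠ j)
    {i j k l r : Fin m ⊕ Fin n} (hij : i ≠ j) (hkl : k ≠ l) (hil : i ≠ l) (hjk : j ≠ k)
    (hri : r ≠ i) (hrj : r ≠ j) (hrk : r ≠ k) (hrl : r ≠ l) {α β : ZMod 2} {a b : D}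
    (ha : a ∈ 𝒟.gr α) (hb : b ∈ 𝒟.gr β) : 𝒟.clsF hij hkl a b = 0 := by
  by_cases hik : i = k
  · subst hik
    by_cases hjl : j = l
    · subst hjl
      exact 𝒟.cls_same_eq_zero hthird hij ha hb
    · refine 𝒟.cls_eq_zero_of_weight hthird hrj.symm hij hkl hil hjk ?_ ha hb
      simp [weight, hij, hri.symm, hrl.symm, Ne.symm hjl]
  · refine 𝒟.cls_eq_zero_of_weight hthird hri.symm hij hkl hil hjk ?_ ha hb
    simp [weight, hij.symm, hrj.symm, hil.symm, hrl.symm, Ne.symm hik, hrk.symm]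

/-- For `i` and `j` of different parities, the weight of `F_{ij}(a) ⊗ F_{il}(b)` under
`[F_{ij}(1), F_{ji}(1)]` is `-1` instead of `-3`. -/
theorem clsF_eq_zero_of_row (hthird : ∀ i j : Fin m ⊕ Fin n, ∃ r, r ≠ i ∧ r ≠ j)
    {i j l : Fin m ⊕ Fin n} (hij : i ≠ j) (hil : i ≠ l) (hjl : j ≠ l)
    (hπ : indexDeg m n i ≠ indexDeg m n j ∨ indexDeg m n i ≠ indexDeg m n l)
    {α β : ZMod 2} {a b : D} (ha : a ∈ 𝒟.gr α) (hb : b ∈ 𝒟.gr β) :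
    𝒟.clsF hij hil a b = 0 := by
  have hodd : ∀ u v : ZMod 2, u ≠ v → koszulSign (u + v) (u + v) = -1 := by decide
  rcases hπ with h | h
  · refine 𝒟.cls_eq_zero_of_weight hthird hij hij hil hil hij.symm ?_ ha hb
    simp [weight, hij.symm, hil.symm, hjl.symm, hodd _ _ h]
  · refine 𝒟.cls_eq_zero_of_weight hthird hil hij hil hil hij.symm ?_ ha hb
    simp [weight, hij.symm, hil.symm, hjl, hodd _ _ h]

theorem clsF_eq_zero_of_column (hthird : ∀ i j : Fin m ⊕ Fin n, ∃ r, r ≠ i ∧ r ≠ j)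
    {i j k : Fin m ⊕ Fin n} (hij : i ≠ j) (hkj : k ≠ j) (hik : i ≠ k)
    (hπ : indexDeg m n j ≠ indexDeg m n i ∨ indexDeg m n j ≠ indexDeg m n k)
    {α β : ZMod 2} {a b : D} (ha : a ∈ 𝒟.gr α) (hb : b ∈ 𝒟.gr β) :
    𝒟.clsF hij hkj a b = 0 := by
  have hodd : ∀ u v : ZMod 2, u ≠ v → koszulSign (u + v) (u + v) = -1 := by decide
  rcases hπ with h | h
  · refine 𝒟.cls_eq_zero_of_weight hthird hij.symm hij hkj hij hkj.symm ?_ ha hb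
    simp [weight, hij, hkj, hik.symm, hodd _ _ h]
  · refine 𝒟.cls_eq_zero_of_weight hthird hkj.symm hij hkj hij hkj.symm ?_ ha hb
    simp [weight, hij, hkj, hik, hodd _ _ h]

theorem exists_notMem_of_card_lt (s : Finset (Fin m ⊕ Fin n)) (hs : s.card < m + n) :
    ∃ r, r ∉ s := by
  by_contra! h
  have : s = Finset.univ := Finset.eq_univ_iff_forall.2 h
  rw [this, Finset.card_univ, Fintype.card_sum, Fintype.card_fin, Fintype.card_fin] at hs
  exact lt_irrefl _ hs

theorem exists_third (h : 3 ≤ m + n) (i j : Fin m ⊕ Fin n) : ∃ r, r ≠ i ∧ r ≠ j := by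
  obtain ⟨r, hr⟩ := exists_notMem_of_card_lt ({i, j} : Finset _) (Finset.card_le_two.trans_lt h)
  exact ⟨r, by simpa using hr⟩

theorem subsingleton_hl2 (h : 5 ≤ m + n ∨ (m = 2 ∧ n = 1)) :
    Subsingleton (𝒟.steinberg m n).HL2 := by
  have hthird : ∀ i j : Fin m ⊕ Fin n, ∃ r, r ≠ i ∧ r ≠ j := exists_third (by omega)
  refine (𝒟.steinberg m n).hl2_subsingleton (𝒟.ker_covBracket_le hthird ⊥ ?_)
  intro i j k l hij hkl hil hjk α β a ha b hb
  rw [Submodule.mem_bot, ← clsF_apply]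
  rcases h with h | ⟨rfl, rfl⟩
  · obtain ⟨r, hr⟩ := exists_notMem_of_card_lt ({i, j, k, l} : Finset _)
      (Finset.card_le_four.trans_lt h)
    simp only [Finset.mem_insert, Finset.mem_singleton, not_or] at hr
    exact 𝒟.clsF_eq_zero_of_index hthird hij hkl hil hjk hr.1 hr.2.1 hr.2.2.1 hr.2.2.2 ha hb
  · by_cases hik : i = k
    · subst hik
      by_cases hjl : j = l
      · subst hjl
        exact 𝒟.cls_same_eq_zero hthird hij ha hb
      · refine 𝒟.clsF_eq_zero_of_row hthird hij hkl hjl ?_ ha hb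
        clear ha hb
        revert i j l; decide
    · have hjl : j = l := by
        clear ha hb
        revert i j k l; decide
      subst hjl
      refine 𝒟.clsF_eq_zero_of_column hthird hij hkl hik ?_ ha hb
      clear ha hb
      revert i j k; decide

end UnitalSuperdialgebra

/-! ### Relations between the exceptional classes -/

namespace UnitalSuperdialgebra

variable {R D : Type*} [CommRing R] [AddCommGroup D] [Module R D]
  (𝒟 : UnitalSuperdialgebra R D) {m n : ℕ}

/-- Exchange of the second indices, from `F_{ij}(a ⊣ a') = [F_{ik}(a), F_{kj}(a')]`. -/
theorem clsF_left {i j k l : Fin m ⊕ Fin n} (hij : i ≠ j) (hkl : k ≠ l) (hil : i ≠ l)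
    (hkj : k ≠ j) (hik : i ≠ k) {α α' β : ZMod 2} {a a' b : D} (ha : a ∈ 𝒟.gr α)
    (ha' : a' ∈ 𝒟.gr α') (hb : b ∈ 𝒟.gr β) :
    𝒟.clsF hij hkl (𝒟.left a a') b =
      koszulSign (indexDeg m n k + indexDeg m n j + α') (indexDeg m n k + indexDeg m n l + β) •
        𝒟.clsF hil hkj (𝒟.left a b) a' := by
  have h := (𝒟.steinberg m n).cls_leibniz (𝒟.stF hik a) (𝒟.stF_mem hkj ha') (𝒟.stF_mem hkl hb)
  rw [𝒟.bracket_zero hkj hkl hkl hkj.symm ha' hb, 𝒟.bracket_left hik hkj hij ha ha',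
    𝒟.bracket_left hik hkl hil ha hb, map_zero] at h
  exact (sub_eq_zero.1 h.symm)

/-- Exchange of the first indices, from `F_{kl}(b ⊣ b') = [F_{ki}(b), F_{il}(b')]`. -/
theorem clsF_right {i j k l : Fin m ⊕ Fin n} (hij : i ≠ j) (hkl : k ≠ l) (hil : i ≠ l)
    (hkj : k ≠ j) (hik : i ≠ k) {α β β' : ZMod 2} {a b b' : D} (ha : a ∈ 𝒟.gr α)
    (hb : b ∈ 𝒟.gr β) (hb' : b' ∈ 𝒟.gr β') :
    𝒟.clsF hij hkl a (𝒟.left b b') =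
      -(koszulSign (indexDeg m n i + indexDeg m n j + α) (indexDeg m n k + indexDeg m n i + β) •
        𝒟.clsF hkj hil (𝒟.right b a) b') := by
  have h := (𝒟.steinberg m n).cls_leibniz (𝒟.stF hij a) (𝒟.stF_mem hik.symm hb)
    (𝒟.stF_mem hil hb')
  rw [𝒟.bracket_left hik.symm hil hkl hb hb', 𝒟.bracket_right hij hik.symm hkj ha hb,
    𝒟.bracket_zero hij hil hil hij.symm ha hb', map_zero, LinearMap.zero_apply, smul_zero, sub_zero,
    map_neg, map_zsmul, LinearMap.neg_apply, LinearMap.smul_apply] at h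
  exact h

/-- The class of `F_{ij}(a) ⊗ F_{kl}(b)` in terms of that of `F_{ij}(a ⊣ b) ⊗ F_{kl}(1)`. -/
theorem clsF_eq_left {i j k l : Fin m ⊕ Fin n} (hij : i ≠ j) (hkl : k ≠ l) (hil : i ≠ l)
    (hkj : k ≠ j) (hik : i ≠ k) {α β : ZMod 2} {a b : D} (ha : a ∈ 𝒟.gr α) (hb : b ∈ 𝒟.gr β) :
    𝒟.clsF hij hkl a b = koszulSign (indexDeg m n k + indexDeg m n j) β •
      𝒟.clsF hij hkl (𝒟.left a b) 𝒟.one := by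
  have h1 := 𝒟.clsF_left hij hkl hil hkj hik ha 𝒟.one_mem hb
  have h2 := 𝒟.clsF_left hil hkj hij hkl hik (𝒟.left_mem ha hb) 𝒟.one_mem 𝒟.one_mem
  rw [𝒟.left_one] at h1 h2
  rw [h1, h2, smul_smul]
  congr 1
  generalize indexDeg m n j = u
  generalize indexDeg m n k = v
  generalize indexDeg m n l = w
  clear ha hb h1 h2
  revert u v w β; decide

/-- Supersymmetry in the last two factors, by exchanging the second indices in two ways. -/
theorem clsF_left_left {i j k l : Fin m ⊕ Fin n} (hij : i ≠ j) (hkl : k ≠ l) (hil : i ≠ l)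
    (hkj : k ≠ j) (hik : i ≠ k) {α β γ : ZMod 2} {a b c : D} (ha : a ∈ 𝒟.gr α) (hb : b ∈ 𝒟.gr β)
    (hc : c ∈ 𝒟.gr γ) :
    𝒟.clsF hij hkl (𝒟.left (𝒟.left a b) c) 𝒟.one =
      koszulSign β γ • 𝒟.clsF hij hkl (𝒟.left (𝒟.left a c) b) 𝒟.one := by
  have h0 := 𝒟.clsF_eq_left hij hkl hil hkj hik (𝒟.left_mem ha hb) hc
  have h1 := 𝒟.clsF_left hij hkl hil hkj hik ha hb hc
  have h2 := 𝒟.clsF_eq_left hil hkj hij hkl hik (𝒟.left_mem ha hc) hb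
  have h3 := 𝒟.clsF_left hil hkj hij hkl hik (𝒟.left_mem (𝒟.left_mem ha hc) hb) 𝒟.one_mem
    𝒟.one_mem
  rw [𝒟.left_one] at h3
  rw [h1, h2, h3, smul_smul, smul_smul] at h0
  have h4 := congrArg (koszulSign (indexDeg m n k + indexDeg m n j) γ • ·) h0
  simp only [smul_smul, koszulSign_mul_self, one_smul] at h4
  rw [← h4]
  congr 1
  generalize indexDeg m n j = u
  generalize indexDeg m n k = v
  generalize indexDeg m n l = w
  clear ha hb hc h0 h1 h2 h3 h4
  revert u v w β γ; decide

/-- Supercommutativity, by exchanging the first indices twice. This produces the sign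
`(-1)^{|i|+|k|}`, which disappears under the assumption `h2`. -/
theorem clsF_left_comm {i j k l : Fin m ⊕ Fin n} (hij : i ≠ j) (hkl : k ≠ l) (hil : i ≠ l)
    (hkj : k ≠ j) (hik : i ≠ k)
    (h2 : indexDeg m n i = indexDeg m n k ∨ ∀ a, (2 : ℤ) • 𝒟.clsF hij hkl a 𝒟.one = 0)
    {α β : ZMod 2} {a b : D} (ha : a ∈ 𝒟.gr α) (hb : b ∈ 𝒟.gr β) :
    𝒟.clsF hij hkl (𝒟.left a b) 𝒟.one =
      koszulSign α β • 𝒟.clsF hij hkl (𝒟.right b a) 𝒟.one := by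
  have h0 := 𝒟.clsF_eq_left hij hkl hil hkj hik ha hb
  have h1 := 𝒟.clsF_right hij hkl hil hkj hik ha hb 𝒟.one_mem
  have h3 := 𝒟.clsF_right hkj hil hkl hij hik.symm (𝒟.right_mem hb ha) 𝒟.one_mem 𝒟.one_mem
  rw [𝒟.left_one] at h1 h3
  rw [h1, h3, 𝒟.one_right, smul_neg, neg_neg, smul_smul] at h0
  have h4 := congrArg (koszulSign (indexDeg m n k + indexDeg m n j) β • ·) h0
  simp only [smul_smul, koszulSign_mul_self, one_smul] at h4
  rw [← h4]
  have hsign : ∀ u v w α β : ZMod 2, koszulSign (w + v) β *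
      (koszulSign (u + v + α) (w + u + β) * koszulSign (w + v + (β + α)) (u + w + 0)) =
      koszulSign α β * koszulSign (u + w) (u + w) := by decide
  rw [hsign, mul_smul]
  congr 1
  rcases h2 with h2 | h2
  · rw [h2, zmod_two_add_self, koszulSign_zero_left, one_smul]
  · -- a sign acts trivially on an element killed by `2`
    have hs : ∀ u : ZMod 2, koszulSign u u = 1 ∨ koszulSign u u = 1 - 2 := by decide
    rcases hs (indexDeg m n i + indexDeg m n k) with h | h
    · rw [h, one_smul]
    · rw [h, sub_smul, h2, one_smul, sub_zero]

/-- The classes with the same weight as `F_{ij}(a) ⊗ F_{kl}(1)` all lie in the image of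
`a ↦ F_{ij}(a) ⊗ F_{kl}(1)`. -/
theorem clsF_mem_range {i j k l : Fin m ⊕ Fin n} (hij : i ≠ j) (hkl : k ≠ l) (hil : i ≠ l)
    (hkj : k ≠ j) (hik : i ≠ k) {i' j' k' l' : Fin m ⊕ Fin n} (hij' : i' ≠ j') (hkl' : k' ≠ l')
    (hi : (i' = i ∧ k' = k) ∨ (i' = k ∧ k' = i)) (hj : (j' = j ∧ l' = l) ∨ (j' = l ∧ l' = j))
    {α β : ZMod 2} {a b : D} (ha : a ∈ 𝒟.gr α) (hb : b ∈ 𝒟.gr β) :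
    𝒟.clsF hij' hkl' a b ∈ LinearMap.range ((𝒟.clsF hij hkl).flip 𝒟.one) := by
  have h1 : ∀ a, 𝒟.clsF hij hkl a 𝒟.one ∈ LinearMap.range ((𝒟.clsF hij hkl).flip 𝒟.one) :=
    fun a => ⟨a, rfl⟩
  have h2 : ∀ {α : ZMod 2} {a : D}, a ∈ 𝒟.gr α →
      𝒟.clsF hkj hil a 𝒟.one ∈ LinearMap.range ((𝒟.clsF hij hkl).flip 𝒟.one) := by
    intro α a ha
    have h := 𝒟.clsF_right hkj hil hkl hij hik.symm ha 𝒟.one_mem 𝒟.one_mem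
    rw [𝒟.left_one] at h
    rw [h]
    exact neg_mem (zsmul_mem (h1 _) _)
  rcases hi with ⟨rfl, rfl⟩ | ⟨rfl, rfl⟩ <;> rcases hj with ⟨rfl, rfl⟩ | ⟨rfl, rfl⟩
  · rw [𝒟.clsF_eq_left hij hkl hil hkj hik ha hb]
    exact zsmul_mem (h1 _) _
  · have h := 𝒟.clsF_left hij' hkl' hij hkl hik ha 𝒟.one_mem hb
    rw [𝒟.left_one] at h
    rw [h]
    exact zsmul_mem (h1 _) _
  · rw [𝒟.clsF_eq_left hij' hkl' hkl hij hik.symm ha hb]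
    exact zsmul_mem (h2 (𝒟.left_mem ha hb)) _
  · have h := 𝒟.clsF_left hij' hkl' hkj hil hik.symm ha 𝒟.one_mem hb
    rw [𝒟.left_one] at h
    rw [h]
    exact zsmul_mem (h2 (𝒟.left_mem ha hb)) _

/-- Exchange of the second indices for equal first indices, from
`F_{il}(b ⊢ b') = ±[F_{jl}(b'), F_{ij}(b)]`. -/
theorem clsF_row {i j l : Fin m ⊕ Fin n} (hij : i ≠ j) (hil : i ≠ l) (hjl : j ≠ l)
    {α β β' : ZMod 2} {a b b' : D} (ha : a ∈ 𝒟.gr α) (hb : b ∈ 𝒟.gr β) (hb' : b' ∈ 𝒟.gr β') :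
    𝒟.clsF hij hil a (𝒟.right b b') =
      -(koszulSign (indexDeg m n j + indexDeg m n l + β') (indexDeg m n i + indexDeg m n j + β) •
        𝒟.clsF hil hij (𝒟.left a b') b) := by
  have h := (𝒟.steinberg m n).cls_leibniz (𝒟.stF hij a) (𝒟.stF_mem hjl hb') (𝒟.stF_mem hij hb)
  rw [𝒟.bracket_right hjl hij hil hb' hb, 𝒟.bracket_left hij hjl hil ha hb',
    𝒟.bracket_zero hij hij hij hij.symm ha hb, map_zero, LinearMap.zero_apply, smul_zero, sub_zero,
    map_neg, map_zsmul, neg_eq_iff_eq_neg] at h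
  have h' := congrArg (koszulSign (indexDeg m n j + indexDeg m n l + β')
    (indexDeg m n i + indexDeg m n j + β) • ·) h
  simp only [smul_smul, koszulSign_mul_self, one_smul, smul_neg] at h'
  exact h'

/-- Exchange of the arguments for equal first indices, from
`F_{ij}(a ⊢ a') = ±[F_{lj}(a'), F_{il}(a)]`. -/
theorem clsF_row_right {i j l : Fin m ⊕ Fin n} (hij : i ≠ j) (hil : i ≠ l) (hjl : j ≠ l)
    {α α' β : ZMod 2} {a a' b : D} (ha : a ∈ 𝒟.gr α) (ha' : a' ∈ 𝒟.gr α') (hb : b ∈ 𝒟.gr β) :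
    𝒟.clsF hij hil (𝒟.right a a') b =
      (koszulSign (indexDeg m n l + indexDeg m n j + α') (indexDeg m n i + indexDeg m n l + α) *
        koszulSign (indexDeg m n i + indexDeg m n l + α) (indexDeg m n i + indexDeg m n l + β) *
        koszulSign (indexDeg m n l + indexDeg m n j + α') (indexDeg m n i + indexDeg m n l + β)) •
        𝒟.clsF hij hil (𝒟.right b a') a := by
  have h := (𝒟.steinberg m n).cls_leibniz (𝒟.stF hjl.symm a') (𝒟.stF_mem hil ha)
    (𝒟.stF_mem hil hb)
  rw [𝒟.bracket_right hjl.symm hil hij ha' ha, 𝒟.bracket_right hjl.symm hil hij ha' hb,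
    𝒟.bracket_zero hil hil hil hil.symm ha hb, map_zero, map_neg, map_neg, map_zsmul, map_zsmul,
    LinearMap.neg_apply, LinearMap.neg_apply, LinearMap.smul_apply, LinearMap.smul_apply, smul_neg,
    sub_neg_eq_add, eq_comm, neg_add_eq_zero, smul_smul] at h
  have h' := congrArg (koszulSign (indexDeg m n l + indexDeg m n j + α')
    (indexDeg m n i + indexDeg m n l + α) • ·) h
  simp only [smul_smul, koszulSign_mul_self, one_smul, ← mul_assoc] at h'
  exact h'

theorem clsF_row_swap (hπ : ∀ i, indexDeg m n i = 0) {i j l : Fin m ⊕ Fin n}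
    (hij : i ≠ j) (hil : i ≠ l) (hjl : j ≠ l) {α β : ZMod 2} {a b : D}
    (ha : a ∈ 𝒟.gr α) (hb : b ∈ 𝒟.gr β) :
    𝒟.clsF hij hil a b = -𝒟.clsF hil hij (𝒟.left a b) 𝒟.one := by
  have h := 𝒟.clsF_row hij hil hjl ha 𝒟.one_mem hb
  rw [𝒟.one_right] at h
  rw [h]
  simp [hπ]

theorem clsF_row_eq_left (hπ : ∀ i, indexDeg m n i = 0) {i j l : Fin m ⊕ Fin n}
    (hij : i ≠ j) (hil : i ≠ l) (hjl : j ≠ l) {α β : ZMod 2} {a b : D}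
    (ha : a ∈ 𝒟.gr α) (hb : b ∈ 𝒟.gr β) :
    𝒟.clsF hij hil a b = 𝒟.clsF hij hil (𝒟.left a b) 𝒟.one := by
  rw [𝒟.clsF_row_swap hπ hij hil hjl ha hb,
    𝒟.clsF_row_swap hπ hil hij hjl.symm (𝒟.left_mem ha hb) 𝒟.one_mem, 𝒟.left_one, neg_neg]

theorem clsF_row_left_left (hπ : ∀ i, indexDeg m n i = 0) {i j l : Fin m ⊕ Fin n}
    (hij : i ≠ j) (hil : i ≠ l) (hjl : j ≠ l) {α β γ : ZMod 2}
    {a b c : D} (ha : a ∈ 𝒟.gr α) (hb : b ∈ 𝒟.gr β) (hc : c ∈ 𝒟.gr γ) :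
    𝒟.clsF hij hil (𝒟.left (𝒟.left a b) c) 𝒟.one =
      koszulSign β γ • 𝒟.clsF hij hil (𝒟.left (𝒟.left a c) b) 𝒟.one := by
  have h1 := 𝒟.clsF_row_swap hπ hil hij hjl.symm ha (𝒟.right_mem hc hb)
  have h2 := 𝒟.clsF_row hil hij hjl.symm ha hc hb
  rw [h2, 𝒟.clsF_row_eq_left hπ hij hil hjl (𝒟.left_mem ha hb) hc, neg_inj, ← 𝒟.left_left,
    ← 𝒟.left_assoc a] at h1
  rw [← h1, smul_smul]
  simp [hπ, koszulSign_mul_self]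

theorem clsF_row_left_comm (hπ : ∀ i, indexDeg m n i = 0) {i j l : Fin m ⊕ Fin n}
    (hij : i ≠ j) (hil : i ≠ l) (hjl : j ≠ l) {α β : ZMod 2} {a b : D}
    (ha : a ∈ 𝒟.gr α) (hb : b ∈ 𝒟.gr β) :
    𝒟.clsF hij hil (𝒟.left a b) 𝒟.one =
      koszulSign α β • 𝒟.clsF hij hil (𝒟.right b a) 𝒟.one := by
  have h1 := 𝒟.clsF_row_right hij hil hjl hb ha 𝒟.one_mem
  rw [𝒟.one_right, 𝒟.clsF_row_eq_left hπ hij hil hjl ha hb] at h1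
  rw [h1, smul_smul]
  simp [hπ, koszulSign_mul_self]

/-- `a ↦ F_{ij}(a) ⊗ F_{kl}(1)` factors through `D_N`. -/
theorem idealOf_le_ker_clsF
    {i j k l : Fin m ⊕ Fin n} (hij : i ≠ j) (hkl : k ≠ l) (hil : i ≠ l) (hkj : k ≠ j)
    (hik : i ≠ k) (N : ℕ) (hN : ∀ a, (N : ℤ) • 𝒟.clsF hij hkl a 𝒟.one = 0)
    (h2 : indexDeg m n i = indexDeg m n k ∨ ∀ a, (2 : ℤ) • 𝒟.clsF hij hkl a 𝒟.one = 0) :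
    𝒟.idealOf N ≤ LinearMap.ker ((𝒟.clsF hij hkl).flip 𝒟.one) := by
  refine 𝒟.idealOf_le_ker _ N hN (fun p q a ha b hb => ?_) (fun p q r a ha b hb c hc => ?_)
  · simp only [LinearMap.flip_apply]
    exact 𝒟.clsF_left_comm hij hkl hil hkj hik h2 ha hb
  · simp only [LinearMap.flip_apply]
    exact 𝒟.clsF_left_left hij hkl hil hkj hik ha hb hc

theorem idealOf_le_ker_clsF_row (hπ : ∀ i, indexDeg m n i = 0) {i j l : Fin m ⊕ Fin n}
    (hij : i ≠ j) (hil : i ≠ l) (hjl : j ≠ l) (N : ℕ)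
    (hN : ∀ a, (N : ℤ) • 𝒟.clsF hij hil a 𝒟.one = 0) :
    𝒟.idealOf N ≤ LinearMap.ker ((𝒟.clsF hij hil).flip 𝒟.one) := by
  refine 𝒟.idealOf_le_ker _ N hN (fun p q a ha b hb => ?_) (fun p q r a ha b hb c hc => ?_)
  · simp only [LinearMap.flip_apply]
    exact 𝒟.clsF_row_left_comm hπ hij hil hjl ha hb
  · simp only [LinearMap.flip_apply]
    exact 𝒟.clsF_row_left_left hπ hij hil hjl ha hb hc

end UnitalSuperdialgebra

/-! ### The quotients `D_N` -/

namespace Superdialgebra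

variable {R D : Type*} [CommRing R] [AddCommGroup D] [Module R D] (𝒟 : Superdialgebra R D)

theorem idealOf_isIdeal (N : ℕ) : 𝒟.IsIdeal (𝒟.idealOf N) := by
  intro x y h
  simp only [idealOf, Submodule.mem_sInf]
  simp only [idealOf, Submodule.mem_sInf] at h
  exact ⟨fun I hI => (hI.1 x y (h.imp (fun h => h I hI) (fun h => h I hI))).1,
    fun I hI => (hI.1 x y (h.imp (fun h => h I hI) (fun h => h I hI))).2⟩

theorem idealGenerators_subset (N : ℕ) : 𝒟.idealGenerators N ⊆ 𝒟.idealOf N := by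
  intro x hx
  simp only [idealOf, SetLike.mem_coe, Submodule.mem_sInf]
  exact fun I hI => hI.2 hx

theorem left_sub_right_mem (N : ℕ) {p q : ZMod 2} {a b : D} (ha : a ∈ 𝒟.gr p) (hb : b ∈ 𝒟.gr q) :
    𝒟.left a b - koszulSign p q • 𝒟.right b a ∈ 𝒟.idealOf N :=
  𝒟.idealGenerators_subset N (.inr ⟨p, q, a, ha, b, hb, rfl⟩)

theorem natCast_smul_quot (N : ℕ) (t : 𝒟.Quot N) : (N : ℤ) • t = 0 := by
  obtain ⟨a, rfl⟩ := Submodule.mkQ_surjective _ t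
  rw [natCast_zsmul, ← Nat.cast_smul_eq_nsmul R, ← map_smul]
  exact (Submodule.Quotient.mk_eq_zero _).2 (𝒟.idealGenerators_subset N (.inl ⟨a, rfl⟩))

theorem zsmul_quot_eq {N : ℕ} {c d : ℤ} (h : (N : ℤ) ∣ c - d) (t : 𝒟.Quot N) :
    c • t = d • t := by
  obtain ⟨e, he⟩ := h
  rw [← sub_eq_zero, ← sub_smul, he, mul_comm, mul_smul, 𝒟.natCast_smul_quot, smul_zero]

/-- The class of `a ⊣ (b ⊣ c)` in `D_N`. -/
def triple (N : ℕ) (a b c : D) : 𝒟.Quot N := (𝒟.idealOf N).mkQ (𝒟.left a (𝒟.left b c))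

section Quot

variable (N : ℕ) {p q r : ZMod 2} {a b c : D}

theorem mkQ_left (ha : a ∈ 𝒟.gr p) (hb : b ∈ 𝒟.gr q) :
    (𝒟.idealOf N).mkQ (𝒟.left a b) = koszulSign p q • (𝒟.idealOf N).mkQ (𝒟.right b a) := by
  rw [← sub_eq_zero, ← map_zsmul, ← map_sub]
  exact (Submodule.Quotient.mk_eq_zero _).2 (𝒟.left_sub_right_mem N ha hb)

theorem mkQ_right (ha : a ∈ 𝒟.gr p) (hb : b ∈ 𝒟.gr q) :
    (𝒟.idealOf N).mkQ (𝒟.right b a) = koszulSign p q • (𝒟.idealOf N).mkQ (𝒟.left a b) := by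
  rw [𝒟.mkQ_left N ha hb, smul_smul, koszulSign_mul_self, one_smul]

theorem mkQ_left_left : (𝒟.idealOf N).mkQ (𝒟.left (𝒟.left a b) c) = 𝒟.triple N a b c := by
  rw [𝒟.left_assoc]; rfl

theorem triple_swap (hb : b ∈ 𝒟.gr q) (hc : c ∈ 𝒟.gr r) :
    𝒟.triple N a c b = koszulSign q r • 𝒟.triple N a b c := by
  have h := 𝒟.idealOf_isIdeal N a _ (.inr (𝒟.left_sub_right_mem N hb hc))
  have h0 := (Submodule.Quotient.mk_eq_zero _).2 h.1
  rw [← Submodule.mkQ_apply, map_sub, map_sub, map_zsmul, map_zsmul, ← 𝒟.left_left, sub_eq_zero]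
    at h0
  rw [triple, triple, h0, smul_smul, koszulSign_mul_self, one_smul]

theorem mkQ_left_right (hb : b ∈ 𝒟.gr q) (hc : c ∈ 𝒟.gr r) :
    (𝒟.idealOf N).mkQ (𝒟.left a (𝒟.right c b)) = koszulSign q r • 𝒟.triple N a b c := by
  rw [← 𝒟.left_left, ← 𝒟.triple_swap N hb hc]; rfl

theorem mkQ_right_left (ha : a ∈ 𝒟.gr p) (hb : b ∈ 𝒟.gr q) (hc : c ∈ 𝒟.gr r) :
    (𝒟.idealOf N).mkQ (𝒟.left (𝒟.right b a) c) = koszulSign p q • 𝒟.triple N a b c := by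
  rw [𝒟.right_left, 𝒟.mkQ_right N (𝒟.left_mem ha hc) hb, 𝒟.mkQ_left_left,
    𝒟.triple_swap N hb hc, smul_smul]
  congr 1
  clear ha hb hc
  revert p q r; decide

end Quot

/-- The projection of `D` onto its component of parity `p`. -/
def proj (p : ZMod 2) : D →ₗ[R] D :=
  if p = 0 then (𝒟.gr 0).projection (𝒟.gr 1) 𝒟.isCompl
  else (𝒟.gr 1).projection (𝒟.gr 0) 𝒟.isCompl.symm

theorem proj_apply {p q : ZMod 2} {x : D} (hx : x ∈ 𝒟.gr q) :
    𝒟.proj p x = if p = q then x else 0 := by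
  have h10 : (1 : ZMod 2) ≠ 0 := by decide
  rcases zmod_two_eq_zero_or_one p with rfl | rfl <;>
    rcases zmod_two_eq_zero_or_one q with rfl | rfl
  · simpa [proj] using Submodule.projection_apply_left 𝒟.isCompl ⟨x, hx⟩
  · simpa [proj, h10.symm] using hx
  · simpa [proj, h10] using hx
  · simpa [proj, h10] using Submodule.projection_apply_left 𝒟.isCompl.symm ⟨x, hx⟩

/-- The automorphism of `D` multiplying elements of parity `p` by `(-1)^{up}`. -/
def twist (u : ZMod 2) : D →ₗ[R] D := ∑ p : ZMod 2, koszulSign u p • 𝒟.proj p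

theorem twist_apply (u : ZMod 2) {q : ZMod 2} {x : D} (hx : x ∈ 𝒟.gr q) :
    𝒟.twist u x = koszulSign u q • x := by
  simp only [twist, LinearMap.sum_apply, LinearMap.smul_apply, 𝒟.proj_apply hx]
  simp

/-! ### Matrices over a superdialgebra -/

variable {I : Type*} (π : I → ZMod 2)

/-- The matrices of parity `p`: the entry at `(i, j)` has parity `p + |i| + |j|`. -/
def matGr (p : ZMod 2) : Submodule R (I → I → D) where
  carrier := {x | ∀ i j, x i j ∈ 𝒟.gr (p + π i + π j)}
  zero_mem' _ _ := zero_mem _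
  add_mem' hx hy i j := add_mem (hx i j) (hy i j)
  smul_mem' c _ hx i j := Submodule.smul_mem _ c (hx i j)

/-- The projection onto the matrices of parity `p`. -/
def matProj (p : ZMod 2) : (I → I → D) →ₗ[R] (I → I → D) :=
  LinearMap.pi fun i => LinearMap.pi fun j =>
    𝒟.proj (p + π i + π j) ∘ₗ LinearMap.proj j ∘ₗ LinearMap.proj i

theorem matProj_apply {p q : ZMod 2} {x : I → I → D} (hx : x ∈ 𝒟.matGr π q) :
    𝒟.matProj π p x = if p = q then x else 0 := by
  ext i j
  have : 𝒟.matProj π p x i j = 𝒟.proj (p + π i + π j) (x i j) := rfl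
  rw [this, 𝒟.proj_apply (hx i j)]
  by_cases h : p = q <;> simp [h]

variable (R) in
/-- The matrix with the single non-zero entry `a` at `(i, j)`. -/
def matSingle [DecidableEq I] (i j : I) : D →ₗ[R] (I → I → D) :=
  LinearMap.single R (fun _ => I → D) i ∘ₗ LinearMap.single R (fun _ => D) j

theorem matSingle_apply [DecidableEq I] (i j : I) (a : D) (k l : I) :
    matSingle R i j a k l = if i = k ∧ j = l then a else 0 := by
  simp only [matSingle, LinearMap.comp_apply, LinearMap.single_apply, Pi.single_apply]
  by_cases h : k = i
  · subst h
    simp [Pi.single_apply, eq_comm]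
  · simp [h, Ne.symm h]

theorem matSingle_mem [DecidableEq I] (i j : I) {p : ZMod 2} {a : D}
    (ha : a ∈ 𝒟.gr (p + π i + π j)) : matSingle R i j a ∈ 𝒟.matGr π p := by
  intro k l
  rw [matSingle_apply]
  split_ifs with h
  · rw [← h.1, ← h.2]; exact ha
  · exact zero_mem _

variable [Fintype I]

/-- The product `⊣` of matrices. -/
def matLeft : (I → I → D) →ₗ[R] (I → I → D) →ₗ[R] (I → I → D) :=
  LinearMap.mk₂ R (fun x y i l => ∑ j, 𝒟.left (x i j) (y j l))
    (fun x x' y => by ext; simp [Finset.sum_add_distrib])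
    (fun c x y => by ext; simp [Finset.smul_sum])
    (fun x y y' => by ext; simp [Finset.sum_add_distrib])
    (fun c x y => by ext; simp [Finset.smul_sum])

/-- The product `⊢` of matrices. -/
def matRight : (I → I → D) →ₗ[R] (I → I → D) →ₗ[R] (I → I → D) :=
  LinearMap.mk₂ R (fun x y i l => ∑ j, 𝒟.right (x i j) (y j l))
    (fun x x' y => by ext; simp [Finset.sum_add_distrib])
    (fun c x y => by ext; simp [Finset.smul_sum])
    (fun x y y' => by ext; simp [Finset.sum_add_distrib])
    (fun c x y => by ext; simp [Finset.smul_sum])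

theorem matLeft_apply (x y : I → I → D) (i l : I) :
    𝒟.matLeft x y i l = ∑ j, 𝒟.left (x i j) (y j l) := rfl

theorem matRight_apply (x y : I → I → D) (i l : I) :
    𝒟.matRight x y i l = ∑ j, 𝒟.right (x i j) (y j l) := rfl

theorem matLeft_assoc (x y z : I → I → D) :
    𝒟.matLeft (𝒟.matLeft x y) z = 𝒟.matLeft x (𝒟.matLeft y z) := by
  ext i l
  simp only [matLeft_apply, map_sum, LinearMap.sum_apply, 𝒟.left_assoc]
  exact Finset.sum_comm

theorem matRight_assoc (x y z : I → I → D) :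
    𝒟.matRight (𝒟.matRight x y) z = 𝒟.matRight x (𝒟.matRight y z) := by
  ext i l
  simp only [matRight_apply, map_sum, LinearMap.sum_apply, 𝒟.right_assoc]
  exact Finset.sum_comm

theorem matLeft_left (x y z : I → I → D) :
    𝒟.matLeft x (𝒟.matRight y z) = 𝒟.matLeft x (𝒟.matLeft y z) := by
  ext i l
  simp only [matLeft_apply, matRight_apply, map_sum, 𝒟.left_left]

theorem matRight_left (x y z : I → I → D) :
    𝒟.matLeft (𝒟.matRight x y) z = 𝒟.matRight x (𝒟.matLeft y z) := by
  ext i l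
  simp only [matLeft_apply, matRight_apply, map_sum, LinearMap.sum_apply, 𝒟.right_left]
  exact Finset.sum_comm

theorem matRight_right (x y z : I → I → D) :
    𝒟.matRight (𝒟.matLeft x y) z = 𝒟.matRight (𝒟.matRight x y) z := by
  ext i l
  simp only [matLeft_apply, matRight_apply, map_sum, LinearMap.sum_apply, 𝒟.right_right]

theorem matLeft_mem {p q : ZMod 2} {x y : I → I → D} (hx : x ∈ 𝒟.matGr π p)
    (hy : y ∈ 𝒟.matGr π q) : 𝒟.matLeft x y ∈ 𝒟.matGr π (p + q) := by
  intro i l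
  refine sum_mem fun j _ => ?_
  convert 𝒟.left_mem (hx i j) (hy j l) using 2
  linear_combination -zmod_two_add_self (π j)

theorem matRight_mem {p q : ZMod 2} {x y : I → I → D} (hx : x ∈ 𝒟.matGr π p)
    (hy : y ∈ 𝒟.matGr π q) : 𝒟.matRight x y ∈ 𝒟.matGr π (p + q) := by
  intro i l
  refine sum_mem fun j _ => ?_
  convert 𝒟.right_mem (hx i j) (hy j l) using 2
  linear_combination -zmod_two_add_self (π j)

/-- The Leibniz bracket `x ⊣ y - (-1)^{|x||y|} y ⊢ x` of matrices. -/
def glBracket : (I → I → D) →ₗ[R] (I → I → D) →ₗ[R] (I → I → D) :=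
  𝒟.matLeft - ∑ p : ZMod 2, ∑ q : ZMod 2,
    koszulSign p q • (𝒟.matRight.flip.compl₁₂ (𝒟.matProj π p) (𝒟.matProj π q))

theorem glBracket_apply {p q : ZMod 2} {x y : I → I → D} (hx : x ∈ 𝒟.matGr π p)
    (hy : y ∈ 𝒟.matGr π q) :
    𝒟.glBracket π x y = 𝒟.matLeft x y - koszulSign p q • 𝒟.matRight y x := by
  simp only [glBracket, LinearMap.sub_apply, LinearMap.sum_apply, LinearMap.smul_apply,
    LinearMap.compl₁₂_apply, LinearMap.flip_apply, 𝒟.matProj_apply π hx, 𝒟.matProj_apply π hy]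
  rw [Finset.sum_eq_single p, Finset.sum_eq_single q]
  · simp
  · intro b _ hb; simp [hb]
  · simp
  · intro b _ hb; simp [hb]
  · simp

theorem glBracket_mem {p q : ZMod 2} {x y : I → I → D} (hx : x ∈ 𝒟.matGr π p)
    (hy : y ∈ 𝒟.matGr π q) : 𝒟.glBracket π x y ∈ 𝒟.matGr π (p + q) := by
  rw [𝒟.glBracket_apply π hx hy]
  exact sub_mem (𝒟.matLeft_mem π hx hy) (zsmul_mem (add_comm q p ▸ 𝒟.matRight_mem π hy hx) _)

theorem glBracket_leibniz {p q r : ZMod 2} {x y z : I → I → D} (hx : x ∈ 𝒟.matGr π p)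
    (hy : y ∈ 𝒟.matGr π q) (hz : z ∈ 𝒟.matGr π r) :
    𝒟.glBracket π x (𝒟.glBracket π y z) = 𝒟.glBracket π (𝒟.glBracket π x y) z
      - koszulSign q r • 𝒟.glBracket π (𝒟.glBracket π x z) y := by
  rw [𝒟.glBracket_apply π hx (𝒟.glBracket_mem π hy hz),
    𝒟.glBracket_apply π (𝒟.glBracket_mem π hx hy) hz,
    𝒟.glBracket_apply π (𝒟.glBracket_mem π hx hz) hy, 𝒟.glBracket_apply π hy hz,
    𝒟.glBracket_apply π hx hy, 𝒟.glBracket_apply π hx hz]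
  simp only [map_sub, map_zsmul, LinearMap.sub_apply, LinearMap.smul_apply, matLeft_assoc,
    matLeft_left, matRight_left, matRight_right, matRight_assoc, koszulSign_add_left,
    koszulSign_add_right]
  rw [koszulSign_comm r q]
  clear hx hy hz
  rcases zmod_two_eq_zero_or_one p with rfl | rfl <;>
    rcases zmod_two_eq_zero_or_one q with rfl | rfl <;>
    rcases zmod_two_eq_zero_or_one r with rfl | rfl <;>
    simp only [koszulSign_zero_left, koszulSign_zero_right,
      show koszulSign 1 1 = -1 by decide] <;> module

/-- The supertrace of a matrix of parity `p`. -/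
def str (p : ZMod 2) : (I → I → D) →ₗ[R] D :=
  ∑ i, koszulSign (π i) (1 + p) •
    ((LinearMap.proj i : (I → D) →ₗ[R] D) ∘ₗ (LinearMap.proj i : (I → I → D) →ₗ[R] I → D))

theorem str_apply (p : ZMod 2) (x : I → I → D) :
    str (R := R) π p x = ∑ i, koszulSign (π i) (1 + p) • x i i := by
  simp [str]

/-- The matrices of parity `p` whose supertrace lies in `I_N`. -/
def slGr (N : ℕ) (p : ZMod 2) : Submodule R (I → I → D) :=
  𝒟.matGr π p ⊓ (𝒟.idealOf N).comap (str π p)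

/-- The supertrace of a bracket vanishes in the supercommutative quotient `D_N`. -/
theorem glBracket_mem_slGr (N : ℕ) {p q : ZMod 2} {x y : I → I → D} (hx : x ∈ 𝒟.matGr π p)
    (hy : y ∈ 𝒟.matGr π q) : 𝒟.glBracket π x y ∈ 𝒟.slGr π N (p + q) := by
  refine ⟨𝒟.glBracket_mem π hx hy, ?_⟩
  have h : str (R := R) π (p + q) (𝒟.glBracket π x y) =
      ∑ i, ∑ j, koszulSign (π i) (1 + (p + q)) • (𝒟.left (x i j) (y j i) -
        koszulSign (p + π i + π j) (q + π j + π i) • 𝒟.right (y j i) (x i j)) := by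
    rw [𝒟.glBracket_apply π hx hy, map_sub, map_zsmul, str_apply, str_apply]
    simp only [matLeft_apply, matRight_apply, smul_sub, Finset.sum_sub_distrib, Finset.smul_sum]
    congr 1
    rw [Finset.sum_comm]
    refine Finset.sum_congr rfl fun i _ => Finset.sum_congr rfl fun j _ => ?_
    rw [smul_smul, smul_smul]
    congr 1
    generalize π i = u
    generalize π j = v
    clear hx hy
    revert u v p q; decide
  rw [SetLike.mem_coe, Submodule.mem_comap, h]
  exact sum_mem fun i _ => sum_mem fun j _ =>
    zsmul_mem (𝒟.left_sub_right_mem N (hx i j) (hy j i)) _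

variable [DecidableEq I]

theorem sum_matSingle (x : I → I → D) : x = ∑ u : I × I, matSingle R u.1 u.2 (x u.1 u.2) := by
  ext k l
  rw [Finset.sum_apply, Finset.sum_apply, Finset.sum_eq_single (k, l)]
  · simp [matSingle_apply]
  · rintro ⟨i, j⟩ _ h
    rw [matSingle_apply, if_neg]
    rintro ⟨rfl, rfl⟩
    exact h rfl
  · simp

theorem matLeft_matSingle (i j k l : I) (a b : D) :
    𝒟.matLeft (matSingle R i j a) (matSingle R k l b) =
      if j = k then matSingle R i l (𝒟.left a b) else 0 := by
  ext u v
  rw [matLeft_apply, Finset.sum_eq_single j]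
  · by_cases hjk : j = k
    · subst hjk
      by_cases hiu : i = u <;> by_cases hlv : l = v <;> simp [matSingle_apply, hiu, hlv]
    · simp [matSingle_apply, hjk, Ne.symm hjk]
  · intro w _ hw
    simp [matSingle_apply, Ne.symm hw]
  · simp

theorem matRight_matSingle (i j k l : I) (a b : D) :
    𝒟.matRight (matSingle R i j a) (matSingle R k l b) =
      if j = k then matSingle R i l (𝒟.right a b) else 0 := by
  ext u v
  rw [matRight_apply, Finset.sum_eq_single j]
  · by_cases hjk : j = k
    · subst hjk
      by_cases hiu : i = u <;> by_cases hlv : l = v <;> simp [matSingle_apply, hiu, hlv]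
    · simp [matSingle_apply, hjk, Ne.symm hjk]
  · intro w _ hw
    simp [matSingle_apply, Ne.symm hw]
  · simp

theorem glBracket_matSingle {i j k l : I} {p q : ZMod 2} {a b : D} (ha : a ∈ 𝒟.gr (p + π i + π j))
    (hb : b ∈ 𝒟.gr (q + π k + π l)) :
    𝒟.glBracket π (matSingle R i j a) (matSingle R k l b) =
      (if j = k then matSingle R i l (𝒟.left a b) else 0) -
        koszulSign p q • (if l = i then matSingle R k j (𝒟.right b a) else 0) := by
  rw [𝒟.glBracket_apply π (𝒟.matSingle_mem π i j ha) (𝒟.matSingle_mem π k l hb), matLeft_matSingle,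
    matRight_matSingle]

theorem matSingle_mem_slGr (N : ℕ) {i j : I} (hij : i ≠ j) {p : ZMod 2} {a : D}
    (ha : a ∈ 𝒟.gr (p + π i + π j)) : matSingle R i j a ∈ 𝒟.slGr π N p := by
  refine ⟨𝒟.matSingle_mem π i j ha, ?_⟩
  rw [SetLike.mem_coe, Submodule.mem_comap, str_apply, Finset.sum_eq_zero]
  · exact zero_mem _
  · intro k _
    rw [matSingle_apply, if_neg, smul_zero]
    rintro ⟨rfl, rfl⟩
    exact hij rfl

end Superdialgebra

namespace UnitalSuperdialgebra

variable {R D : Type*} [CommRing R] [AddCommGroup D] [Module R D]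
  (𝒟 : UnitalSuperdialgebra R D) (m n : ℕ)

/-- The image of a word in the generators under `F_{ij}(a) ↦ a e_{ij}`. -/
def wordMatrix : FreeMagma (𝒟.SteinbergGen m n) → (Fin m ⊕ Fin n → Fin m ⊕ Fin n → D)
  | .of x => Superdialgebra.matSingle R x.i x.j (x.a : D)
  | .mul u v => 𝒟.glBracket (indexDeg m n) (wordMatrix u) (wordMatrix v)

variable {m n}

theorem deg_gen (x : 𝒟.SteinbergGen m n) :
    (x.a : D) ∈ 𝒟.gr (x.deg + indexDeg m n x.i + indexDeg m n x.j) := by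
  convert x.a.2 using 2
  rw [SteinbergGen.deg]
  linear_combination zmod_two_add_self (indexDeg m n x.i) + zmod_two_add_self (indexDeg m n x.j)

theorem wordMatrix_mem (N : ℕ) (w : FreeMagma (𝒟.SteinbergGen m n)) :
    𝒟.wordMatrix m n w ∈ 𝒟.slGr (indexDeg m n) N
      (LeibnizPresentation.wordDeg (SteinbergGen.deg 𝒟) w) := by
  induction w with
  | ih1 x => exact 𝒟.matSingle_mem_slGr _ N x.ne (𝒟.deg_gen x)
  | ih2 u v hu hv => exact 𝒟.glBracket_mem_slGr _ N hu.1 hv.1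

/-- The homomorphism from the free algebra on the generators of `𝔰𝔱(m, n, D)` to matrices. -/
def freeMatrix : FreeNonUnitalNonAssocAlgebra R (𝒟.SteinbergGen m n) →ₗ[R]
    (Fin m ⊕ Fin n → Fin m ⊕ Fin n → D) :=
  LeibnizPresentation.wordLift (𝒟.wordMatrix m n)

theorem freeMatrix_F {i j : Fin m ⊕ Fin n} (h : i ≠ j) {p : ZMod 2} (a : 𝒟.gr p) :
    𝒟.freeMatrix (𝒟.F h a) = Superdialgebra.matSingle R i j (a : D) :=
  LeibnizPresentation.wordLift_of _ _

theorem freeMatrix_mul (x y : FreeNonUnitalNonAssocAlgebra R (𝒟.SteinbergGen m n)) :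
    𝒟.freeMatrix (x * y) =
      𝒟.glBracket (indexDeg m n) (𝒟.freeMatrix x) (𝒟.freeMatrix y) :=
  LeibnizPresentation.wordLift_mul _ _ _ (fun _ _ => rfl) x y

theorem freeMatrix_mem (N : ℕ) {p : ZMod 2}
    {x : FreeNonUnitalNonAssocAlgebra R (𝒟.SteinbergGen m n)}
    (hx : x ∈ LeibnizPresentation.freeGr R (SteinbergGen.deg 𝒟) p) :
    𝒟.freeMatrix x ∈ 𝒟.slGr (indexDeg m n) N p := by
  have : LeibnizPresentation.freeGr R (SteinbergGen.deg 𝒟) p ≤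
      (𝒟.slGr (indexDeg m n) N p).comap 𝒟.freeMatrix := by
    refine Submodule.span_le.2 ?_
    rintro _ ⟨w, rfl, rfl⟩
    rw [SetLike.mem_coe, Submodule.mem_comap, freeMatrix, LeibnizPresentation.wordLift_single,
      one_smul]
    exact 𝒟.wordMatrix_mem N w
  exact this hx

theorem freeMatrix_relator {t : FreeNonUnitalNonAssocAlgebra R (𝒟.SteinbergGen m n)}
    (ht : 𝒟.SteinbergRelator m n t) : 𝒟.freeMatrix t = 0 := by
  have hdeg : ∀ {i j : Fin m ⊕ Fin n} {p : ZMod 2} (a : 𝒟.gr p), (a : D) ∈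
      𝒟.gr (indexDeg m n i + indexDeg m n j + p + indexDeg m n i + indexDeg m n j) := by
    intro i j p a
    convert a.2 using 2
    linear_combination zmod_two_add_self (indexDeg m n i) + zmod_two_add_self (indexDeg m n j)
  cases ht with
  | add h a b => simp [freeMatrix_F]
  | smul h c a => simp [freeMatrix_F]
  | @left i j l hij hjl hil p q a b =>
    rw [map_sub, freeMatrix_mul, freeMatrix_F, freeMatrix_F, freeMatrix_F,
      𝒟.glBracket_matSingle _ (hdeg a) (hdeg b)]
    simp [hil.symm, hleft]
  | @right i j k hij hki hkj p q a b =>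
    rw [map_add, map_zsmul, freeMatrix_mul, freeMatrix_F, freeMatrix_F, freeMatrix_F,
      𝒟.glBracket_matSingle _ (hdeg a) (hdeg b)]
    simp [hkj.symm, hright]
  | zero hij hkl hil hjk a b =>
    rw [freeMatrix_mul, freeMatrix_F, freeMatrix_F, 𝒟.glBracket_matSingle _ (hdeg a) (hdeg b)]
    simp [hil.symm, hjk]

theorem relIdeal_le_ker_freeMatrix :
    LeibnizPresentation.relIdeal (SteinbergGen.deg 𝒟) {t | 𝒟.SteinbergRelator m n t} ≤
      LinearMap.ker 𝒟.freeMatrix := by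
  refine sInf_le ⟨?_, fun t ht => 𝒟.freeMatrix_relator ht, ?_⟩
  · rintro x y (h | h)
    · rw [LinearMap.mem_ker, freeMatrix_mul, LinearMap.mem_ker.1 h, map_zero, LinearMap.zero_apply]
    · rw [LinearMap.mem_ker, freeMatrix_mul, LinearMap.mem_ker.1 h, map_zero]
  · rintro _ ⟨p, q, r, x, hx, y, hy, z, hz, rfl⟩
    rw [SetLike.mem_coe, LinearMap.mem_ker, map_add, map_sub, map_zsmul, freeMatrix_mul,
      freeMatrix_mul, freeMatrix_mul, freeMatrix_mul, freeMatrix_mul, freeMatrix_mul,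
      𝒟.glBracket_leibniz _ (𝒟.freeMatrix_mem 0 hx).1 (𝒟.freeMatrix_mem 0 hy).1
        (𝒟.freeMatrix_mem 0 hz).1]
    abel

/-- The homomorphism `F_{ij}(a) ↦ a e_{ij}` from `𝔰𝔱(m, n, D)` to matrices over `D`. -/
def toMatrix : 𝒟.St m n →ₗ[R] (Fin m ⊕ Fin n → Fin m ⊕ Fin n → D) :=
  (LeibnizPresentation.relIdeal _ _).liftQ 𝒟.freeMatrix 𝒟.relIdeal_le_ker_freeMatrix

theorem toMatrix_bracket (x y : 𝒟.St m n) : 𝒟.toMatrix ((𝒟.steinberg m n).bracket x y) =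
    𝒟.glBracket (indexDeg m n) (𝒟.toMatrix x) (𝒟.toMatrix y) := by
  obtain ⟨x, rfl⟩ := Submodule.mkQ_surjective _ x
  obtain ⟨y, rfl⟩ := Submodule.mkQ_surjective _ y
  exact 𝒟.freeMatrix_mul x y

theorem toMatrix_mem (N : ℕ) {p : ZMod 2} {x : 𝒟.St m n} (hx : x ∈ (𝒟.steinberg m n).gr p) :
    𝒟.toMatrix x ∈ 𝒟.slGr (indexDeg m n) N p := by
  obtain ⟨x, hx, rfl⟩ := hx
  exact 𝒟.freeMatrix_mem N hx

theorem toMatrix_stF {i j : Fin m ⊕ Fin n} (h : i ≠ j) (a : D) :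
    𝒟.toMatrix (𝒟.stF h a) = Superdialgebra.matSingle R i j a := by
  refine induction_homogeneous 𝒟.isCompl
    (P := fun a => 𝒟.toMatrix (𝒟.stF h a) = Superdialgebra.matSingle R i j a)
    (fun p a ha => ?_) (fun x y hx hy => by rw [map_add, map_add, map_add, hx, hy]) a
  rw [𝒟.stF_apply h ha]
  exact 𝒟.freeMatrix_F h ⟨a, ha⟩

end UnitalSuperdialgebra

/-! ### Cocycles of a given weight -/

section Weight

variable {I : Type*} [DecidableEq I]

/-- For a form `ψ` on matrices with `ψ(a e_{ij}, b e_{kl}) = ± ε_{ijkl} [a ⊣ b]`, the coefficient of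
`[a ⊣ (b ⊣ c)]` in `ψ(x, [y, z]) - ψ([x, y], z) + (-1)^{|y||z|} ψ([x, z], y)` for `x = a e_{ij}`,
`y = b e_{kl}`, `z = c e_{uv}` of parities `p`, `q`, `r`. -/
def leibnizDefect (π : I → ZMod 2) (ε : I → I → I → I → ℤ) (i j k l u v : I) (p q r : ZMod 2) :
    ℤ :=
  ((if l = u then
      ε i j k v * koszulSign (π k + π j) (q + π k + π l + (r + π u + π v)) else 0) -
    koszulSign q r * (if v = k then
      ε i j u l * koszulSign (π u + π j) (r + π u + π v + (q + π k + π l)) *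
        koszulSign (q + π k + π l) (r + π u + π v) else 0)) -
  ((if j = k then ε i l u v * koszulSign (π u + π l) (r + π u + π v) else 0) -
    koszulSign p q * (if l = i then
      ε k j u v * koszulSign (π u + π j) (r + π u + π v) *
        koszulSign (p + π i + π j) (q + π k + π l) else 0)) +
  koszulSign q r *
    ((if j = u then ε i v k l * koszulSign (π k + π v) (q + π k + π l) *
        koszulSign (q + π k + π l) (r + π u + π v) else 0) -
      koszulSign p r * (if v = i then
        ε u j k l * koszulSign (π k + π j) (q + π k + π l) *
          koszulSign (p + π i + π j) (r + π u + π v) *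
          koszulSign (q + π k + π l) (r + π u + π v) else 0))

/-- The condition on the coefficients `ε` for `ψ` to be a 2-cocycle with values in `D_N` on matrices
of supertrace zero: modulo `N`, the defect of the Leibniz identity is a combination of the
supertraces of the three arguments. -/
def IsWeightCocycle (π : I → ZMod 2) (ε : I → I → I → I → ℤ) (N : ℕ) : Prop :=
  ∃ c₁ c₂ c₃ : I → I → I → I → ZMod 2 → ZMod 2 → ZMod 2 → ℤ, ∀ i j k l u v p q r,
    (N : ℤ) ∣ leibnizDefect π ε i j k l u v p q r -
      ((if i = j then koszulSign (π i) (1 + p) * c₁ k l u v p q r else 0) +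
        (if k = l then koszulSign (π k) (1 + q) * c₂ i j u v p q r else 0) +
        (if u = v then koszulSign (π u) (1 + r) * c₃ i j k l p q r else 0))

end Weight

namespace Superdialgebra

variable {R D : Type*} [CommRing R] [AddCommGroup D] [Module R D] (𝒟 : Superdialgebra R D)
  {I : Type*} [Fintype I]

/-- The form on matrices with `ψ(a e_{ij}, b e_{kl}) = (-1)^{(|k| + |j|)|b|} ε_{ijkl} [a ⊣ b]`. -/
def weightForm (π : I → ZMod 2) (ε : I → I → I → I → ℤ) (N : ℕ) :
    (I → I → D) →ₗ[R] (I → I → D) →ₗ[R] 𝒟.Quot N :=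
  ∑ i, ∑ j, ∑ k, ∑ l, ε i j k l •
    (𝒟.left.compl₁₂ (LinearMap.proj j ∘ₗ LinearMap.proj (φ := fun _ : I => I → D) i)
      (𝒟.twist (π k + π j) ∘ₗ LinearMap.proj l ∘ₗ
        LinearMap.proj (φ := fun _ : I => I → D) k)).compr₂ (𝒟.idealOf N).mkQ

variable (π : I → ZMod 2) (ε : I → I → I → I → ℤ) (N : ℕ)

theorem weightForm_apply (x y : I → I → D) : 𝒟.weightForm π ε N x y = ∑ i, ∑ j, ∑ k, ∑ l,
    ε i j k l • (𝒟.idealOf N).mkQ (𝒟.left (x i j) (𝒟.twist (π k + π j) (y k l))) := by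
  simp [weightForm]

theorem weightForm_mem {s : ZMod 2} (hε : ∀ i j k l, ε i j k l ≠ 0 → π i + π j + π k + π l = s)
    {p q : ZMod 2} {x y : I → I → D} (hx : x ∈ 𝒟.matGr π p) (hy : y ∈ 𝒟.matGr π q) :
    𝒟.weightForm π ε N x y ∈ 𝒟.quotGr N (p + q + s) := by
  rw [weightForm_apply]
  refine sum_mem fun i _ => sum_mem fun j _ => sum_mem fun k _ => sum_mem fun l _ => ?_
  by_cases h : ε i j k l = 0
  · rw [h, zero_smul]
    exact zero_mem _
  · refine zsmul_mem (Submodule.mem_map_of_mem ?_) _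
    rw [𝒟.twist_apply _ (hy k l), map_zsmul, ← hε i j k l h]
    refine zsmul_mem ?_ _
    convert 𝒟.left_mem (hx i j) (hy k l) using 2
    ring

/-- The defect of the Leibniz identity of `weightForm`, for `y`, `z` of parities `q`, `r`. -/
def formDefect (q r : ZMod 2) (x y z : I → I → D) : 𝒟.Quot N :=
  𝒟.weightForm π ε N x (𝒟.glBracket π y z) - 𝒟.weightForm π ε N (𝒟.glBracket π x y) z +
    koszulSign q r • 𝒟.weightForm π ε N (𝒟.glBracket π x z) y

theorem formDefect_sum_left {S : Type*} [Fintype S] (q r : ZMod 2) (f : S → I → I → D)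
    (y z : I → I → D) : 𝒟.formDefect π ε N q r (∑ s, f s) y z =
      ∑ s, 𝒟.formDefect π ε N q r (f s) y z := by
  simp only [formDefect, map_sum, LinearMap.sum_apply, Finset.smul_sum, Finset.sum_add_distrib,
    Finset.sum_sub_distrib]

theorem formDefect_sum_mid {S : Type*} [Fintype S] (q r : ZMod 2) (f : S → I → I → D)
    (x z : I → I → D) : 𝒟.formDefect π ε N q r x (∑ s, f s) z =
      ∑ s, 𝒟.formDefect π ε N q r x (f s) z := by
  simp only [formDefect, map_sum, LinearMap.sum_apply, Finset.smul_sum, Finset.sum_add_distrib,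
    Finset.sum_sub_distrib]

theorem formDefect_sum_right {S : Type*} [Fintype S] (q r : ZMod 2) (f : S → I → I → D)
    (x y : I → I → D) : 𝒟.formDefect π ε N q r x y (∑ s, f s) =
      ∑ s, 𝒟.formDefect π ε N q r x y (f s) := by
  simp only [formDefect, map_sum, LinearMap.sum_apply, Finset.smul_sum, Finset.sum_add_distrib,
    Finset.sum_sub_distrib]

theorem triple_eq_zero {a b c : D} (h : a ∈ 𝒟.idealOf N ∨ b ∈ 𝒟.idealOf N ∨ c ∈ 𝒟.idealOf N) :
    𝒟.triple N a b c = 0 := by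
  refine (Submodule.Quotient.mk_eq_zero _).2 (𝒟.idealOf_isIdeal N _ _ ?_).1
  rcases h with h | h
  · exact .inl h
  · exact .inr (𝒟.idealOf_isIdeal N _ _ h).1

variable [DecidableEq I]

theorem weightForm_matSingle (i j k l : I) (a : D) {β : ZMod 2} {b : D} (hb : b ∈ 𝒟.gr β) :
    𝒟.weightForm π ε N (matSingle R i j a) (matSingle R k l b) =
      (ε i j k l * koszulSign (π k + π j) β) • (𝒟.idealOf N).mkQ (𝒟.left a b) := by
  rw [weightForm_apply, Finset.sum_eq_single i, Finset.sum_eq_single j, Finset.sum_eq_single k,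
    Finset.sum_eq_single l]
  · simp [matSingle_apply, 𝒟.twist_apply _ hb, mul_smul]
  · intro w _ hw
    simp [matSingle_apply, Ne.symm hw]
  · simp
  · intro w _ hw
    simp [matSingle_apply, Ne.symm hw]
  · simp
  · intro w _ hw
    simp [matSingle_apply, Ne.symm hw]
  · simp
  · intro w _ hw
    simp [matSingle_apply, Ne.symm hw]
  · simp

theorem formDefect_matSingle {i j k l u v : I} {p q r : ZMod 2} {a b c : D}
    (ha : a ∈ 𝒟.gr (p + π i + π j)) (hb : b ∈ 𝒟.gr (q + π k + π l))
    (hc : c ∈ 𝒟.gr (r + π u + π v)) :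
    𝒟.formDefect π ε N q r (matSingle R i j a) (matSingle R k l b) (matSingle R u v c) =
      leibnizDefect π ε i j k l u v p q r • 𝒟.triple N a b c := by
  have t1 : 𝒟.weightForm π ε N (matSingle R i j a)
      (if l = u then matSingle R k v (𝒟.left b c) else 0) = (if l = u then
        ε i j k v * koszulSign (π k + π j) (q + π k + π l + (r + π u + π v)) else 0) •
        𝒟.triple N a b c := by
    split_ifs
    · rw [𝒟.weightForm_matSingle π ε N i j k v a (𝒟.left_mem hb hc)]
      rfl
    · simp
  have t2 : 𝒟.weightForm π ε N (matSingle R i j a)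
      (if v = k then matSingle R u l (𝒟.right c b) else 0) = (if v = k then
        ε i j u l * koszulSign (π u + π j) (r + π u + π v + (q + π k + π l)) *
          koszulSign (q + π k + π l) (r + π u + π v) else 0) • 𝒟.triple N a b c := by
    split_ifs
    · rw [𝒟.weightForm_matSingle π ε N i j u l a (𝒟.right_mem hc hb), 𝒟.mkQ_left_right N hb hc,
        smul_smul]
    · simp
  have t3 : 𝒟.weightForm π ε N (if j = k then matSingle R i l (𝒟.left a b) else 0)
      (matSingle R u v c) =
        (if j = k then ε i l u v * koszulSign (π u + π l) (r + π u + π v) else 0) •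
        𝒟.triple N a b c := by
    split_ifs
    · rw [𝒟.weightForm_matSingle π ε N i l u v _ hc, 𝒟.mkQ_left_left]
    · simp
  have t4 : 𝒟.weightForm π ε N (if l = i then matSingle R k j (𝒟.right b a) else 0)
      (matSingle R u v c) = (if l = i then
        ε k j u v * koszulSign (π u + π j) (r + π u + π v) *
          koszulSign (p + π i + π j) (q + π k + π l) else 0) • 𝒟.triple N a b c := by
    split_ifs
    · rw [𝒟.weightForm_matSingle π ε N k j u v _ hc, 𝒟.mkQ_right_left N ha hb hc, smul_smul]
    · simp
  have t5 : 𝒟.weightForm π ε N (if j = u then matSingle R i v (𝒟.left a c) else 0)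
      (matSingle R k l b) = (if j = u then ε i v k l * koszulSign (π k + π v) (q + π k + π l) *
        koszulSign (q + π k + π l) (r + π u + π v) else 0) • 𝒟.triple N a b c := by
    split_ifs
    · rw [𝒟.weightForm_matSingle π ε N i v k l _ hb, 𝒟.mkQ_left_left, 𝒟.triple_swap N hb hc,
        smul_smul]
    · simp
  have t6 : 𝒟.weightForm π ε N (if v = i then matSingle R u j (𝒟.right c a) else 0)
      (matSingle R k l b) = (if v = i then
        ε u j k l * koszulSign (π k + π j) (q + π k + π l) *
          koszulSign (p + π i + π j) (r + π u + π v) *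
          koszulSign (q + π k + π l) (r + π u + π v) else 0) • 𝒟.triple N a b c := by
    split_ifs
    · rw [𝒟.weightForm_matSingle π ε N u j k l _ hb, 𝒟.mkQ_right_left N ha hc hb,
        𝒟.triple_swap N hb hc, smul_smul, smul_smul]
    · simp
  rw [formDefect, 𝒟.glBracket_matSingle π hb hc, 𝒟.glBracket_matSingle π ha hb,
    𝒟.glBracket_matSingle π ha hc]
  simp only [map_sub, map_zsmul, LinearMap.sub_apply, LinearMap.smul_apply, t1, t2, t3, t4, t5, t6,
    leibnizDefect, sub_smul, add_smul, mul_smul, smul_sub]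

/-- Summation over the diagonal entries of a matrix, weighted as in the supertrace. -/
theorem sum_diagonal {V : Type*} [AddCommGroup V] [Module R V] (p : ZMod 2) (x : I → I → D)
    (e : ℤ) (f : D →ₗ[R] V) :
    ∑ u : I × I, (if u.1 = u.2 then koszulSign (π u.1) (1 + p) * e else 0) • f (x u.1 u.2) =
      e • f (str (R := R) π p x) := by
  rw [Fintype.sum_prod_type, str_apply, map_sum, Finset.smul_sum]
  refine Finset.sum_congr rfl fun i _ => ?_
  rw [Finset.sum_eq_single i]
  · simp [mul_smul, smul_comm e]
  · intro j _ hj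
    simp [Ne.symm hj]
  · simp

/-- The form is a 2-cocycle on the matrices whose supertrace vanishes in `D_N`. -/
theorem formDefect_eq_zero (hε : IsWeightCocycle π ε N) {p q r : ZMod 2} {x y z : I → I → D}
    (hx : x ∈ 𝒟.slGr π N p) (hy : y ∈ 𝒟.slGr π N q) (hz : z ∈ 𝒟.slGr π N r) :
    𝒟.formDefect π ε N q r x y z = 0 := by
  obtain ⟨c₁, c₂, c₃, hc⟩ := hε
  have hsum : 𝒟.formDefect π ε N q r x y z = ∑ s : I × I, ∑ t : I × I, ∑ w : I × I,
      ((if s.1 = s.2 then koszulSign (π s.1) (1 + p) * c₁ t.1 t.2 w.1 w.2 p q r else 0) +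
        (if t.1 = t.2 then koszulSign (π t.1) (1 + q) * c₂ s.1 s.2 w.1 w.2 p q r else 0) +
        (if w.1 = w.2 then koszulSign (π w.1) (1 + r) * c₃ s.1 s.2 t.1 t.2 p q r else 0)) •
      𝒟.triple N (x s.1 s.2) (y t.1 t.2) (z w.1 w.2) := by
    conv_lhs => rw [sum_matSingle (R := R) x, sum_matSingle (R := R) y, sum_matSingle (R := R) z]
    rw [formDefect_sum_left]
    refine Finset.sum_congr rfl fun s _ => ?_
    rw [formDefect_sum_mid]
    refine Finset.sum_congr rfl fun t _ => ?_
    rw [formDefect_sum_right]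
    refine Finset.sum_congr rfl fun w _ => ?_
    rw [𝒟.formDefect_matSingle π ε N (hx.1 _ _) (hy.1 _ _) (hz.1 _ _)]
    exact 𝒟.zsmul_quot_eq (hc _ _ _ _ _ _ _ _ _) _
  rw [hsum]
  simp only [add_smul, Finset.sum_add_distrib]
  have h1 : ∀ b c e, ∑ s : I × I, (if s.1 = s.2 then koszulSign (π s.1) (1 + p) * e else 0) •
      𝒟.triple N (x s.1 s.2) b c = 0 := fun b c e => by
    have := sum_diagonal π p x e ((𝒟.idealOf N).mkQ ∘ₗ 𝒟.left.flip (𝒟.left b c))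
    refine this.trans ?_
    have h0 : 𝒟.triple N (str (R := R) π p x) b c = 0 := 𝒟.triple_eq_zero N (.inl hx.2)
    exact (congrArg (e • ·) h0).trans (smul_zero e)
  have h2 : ∀ a c e, ∑ s : I × I, (if s.1 = s.2 then koszulSign (π s.1) (1 + q) * e else 0) •
      𝒟.triple N a (y s.1 s.2) c = 0 := fun a c e => by
    have := sum_diagonal π q y e ((𝒟.idealOf N).mkQ ∘ₗ 𝒟.left a ∘ₗ 𝒟.left.flip c)
    refine this.trans ?_
    have h0 : 𝒟.triple N a (str (R := R) π q y) c = 0 := 𝒟.triple_eq_zero N (.inr (.inl hy.2))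
    exact (congrArg (e • ·) h0).trans (smul_zero e)
  have h3 : ∀ a b e, ∑ s : I × I, (if s.1 = s.2 then koszulSign (π s.1) (1 + r) * e else 0) •
      𝒟.triple N a b (z s.1 s.2) = 0 := fun a b e => by
    have := sum_diagonal π r z e ((𝒟.idealOf N).mkQ ∘ₗ 𝒟.left a ∘ₗ 𝒟.left b)
    refine this.trans ?_
    have h0 : 𝒟.triple N a b (str (R := R) π r z) = 0 := 𝒟.triple_eq_zero N (.inr (.inr hz.2))
    exact (congrArg (e • ·) h0).trans (smul_zero e)
  have e1 : ∑ s : I × I, ∑ t : I × I, ∑ w : I × I,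
      (if s.1 = s.2 then koszulSign (π s.1) (1 + p) * c₁ t.1 t.2 w.1 w.2 p q r else 0) •
      𝒟.triple N (x s.1 s.2) (y t.1 t.2) (z w.1 w.2) = 0 := by
    rw [Finset.sum_comm]
    refine Finset.sum_eq_zero fun t _ => ?_
    rw [Finset.sum_comm]
    exact Finset.sum_eq_zero fun w _ => h1 _ _ _
  have e2 : ∑ s : I × I, ∑ t : I × I, ∑ w : I × I,
      (if t.1 = t.2 then koszulSign (π t.1) (1 + q) * c₂ s.1 s.2 w.1 w.2 p q r else 0) •
      𝒟.triple N (x s.1 s.2) (y t.1 t.2) (z w.1 w.2) = 0 := by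
    refine Finset.sum_eq_zero fun s _ => ?_
    rw [Finset.sum_comm]
    exact Finset.sum_eq_zero fun w _ => h2 _ _ _
  have e3 : ∑ s : I × I, ∑ t : I × I, ∑ w : I × I,
      (if w.1 = w.2 then koszulSign (π w.1) (1 + r) * c₃ s.1 s.2 t.1 t.2 p q r else 0) •
      𝒟.triple N (x s.1 s.2) (y t.1 t.2) (z w.1 w.2) = 0 :=
    Finset.sum_eq_zero fun s _ => Finset.sum_eq_zero fun t _ => h3 _ _ _
  rw [e1, e2, e3, add_zero, add_zero]

end Superdialgebra

namespace UnitalSuperdialgebra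

variable {R D : Type*} [CommRing R] [AddCommGroup D] [Module R D]
  (𝒟 : UnitalSuperdialgebra R D) {m n : ℕ}

/-- The map on `(L ⊗ L) / Im δ₃`, `L = 𝔰𝔱(m, n, D)`, given by the cocycle with coefficients `ε`. -/
def covForm (ε : Fin m ⊕ Fin n → Fin m ⊕ Fin n → Fin m ⊕ Fin n → Fin m ⊕ Fin n → ℤ) (N : ℕ)
    (hε : IsWeightCocycle (indexDeg m n) ε N) : (𝒟.steinberg m n).Cov →ₗ[R] 𝒟.Quot N :=
  (LinearMap.range (𝒟.steinberg m n).delta3).liftQ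
    (TensorProduct.lift ((𝒟.weightForm (indexDeg m n) ε N).compl₁₂ 𝒟.toMatrix 𝒟.toMatrix))
    ((𝒟.steinberg m n).range_delta3_le_ker _ fun p q r x hx y hy z hz => by
      have h := 𝒟.formDefect_eq_zero _ ε N hε (𝒟.toMatrix_mem N hx) (𝒟.toMatrix_mem N hy)
        (𝒟.toMatrix_mem N hz)
      rw [Superdialgebra.formDefect] at h
      simp only [TensorProduct.lift.tmul, LinearMap.compl₁₂_apply, toMatrix_bracket]
      rw [← sub_eq_zero, ← h]
      abel)

theorem covForm_cls {ε : Fin m ⊕ Fin n → Fin m ⊕ Fin n → Fin m ⊕ Fin n → Fin m ⊕ Fin n → ℤ}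
    {N : ℕ} (hε : IsWeightCocycle (indexDeg m n) ε N) (x y : 𝒟.St m n) :
    𝒟.covForm ε N hε ((𝒟.steinberg m n).cls x y) =
      𝒟.weightForm (indexDeg m n) ε N (𝒟.toMatrix x) (𝒟.toMatrix y) := rfl

theorem covForm_clsF {ε : Fin m ⊕ Fin n → Fin m ⊕ Fin n → Fin m ⊕ Fin n → Fin m ⊕ Fin n → ℤ}
    {N : ℕ} (hε : IsWeightCocycle (indexDeg m n) ε N) {i j k l : Fin m ⊕ Fin n} (hij : i ≠ j)
    (hkl : k ≠ l) (a : D) : 𝒟.covForm ε N hε (𝒟.clsF hij hkl a 𝒟.one) =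
      ε i j k l • (𝒟.idealOf N).mkQ a := by
  rw [clsF_apply, covForm_cls, toMatrix_stF, toMatrix_stF,
    𝒟.weightForm_matSingle _ _ _ _ _ _ _ _ 𝒟.one_mem, koszulSign_zero_right, mul_one]
  exact congrArg (fun b => ε i j k l • (𝒟.idealOf N).mkQ b) (𝒟.left_one a)

end UnitalSuperdialgebra

/-! ### The exceptional cocycles -/

section Weight

variable {I J : Type*} [DecidableEq I] [DecidableEq J]

theorem IsWeightCocycle.comp {π : J → ZMod 2} {ε : J → J → J → J → ℤ} {N : ℕ}
    (h : IsWeightCocycle π ε N) {f : I → J} (hf : Function.Injective f) {π' : I → ZMod 2}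
    (hπ : ∀ i, π' i = π (f i)) :
    IsWeightCocycle π' (fun i j k l => ε (f i) (f j) (f k) (f l)) N := by
  obtain ⟨c₁, c₂, c₃, hc⟩ := h
  refine ⟨fun k l u v => c₁ (f k) (f l) (f u) (f v), fun k l u v => c₂ (f k) (f l) (f u) (f v),
    fun k l u v => c₃ (f k) (f l) (f u) (f v), fun i j k l u v p q r => ?_⟩
  have := hc (f i) (f j) (f k) (f l) (f u) (f v) p q r
  simpa only [leibnizDefect, hf.eq_iff, hπ] using this

/-- The cocycle condition only depends on the differences of the parities of the indices. -/
theorem IsWeightCocycle.add_one {π : I → ZMod 2} {ε : I → I → I → I → ℤ} {N : ℕ}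
    (h : IsWeightCocycle π ε N) : IsWeightCocycle (fun i => π i + 1) ε N := by
  obtain ⟨c₁, c₂, c₃, hc⟩ := h
  refine ⟨fun k l u v p q r => koszulSign 1 (1 + p) * c₁ k l u v p q r,
    fun k l u v p q r => koszulSign 1 (1 + q) * c₂ k l u v p q r,
    fun k l u v p q r => koszulSign 1 (1 + r) * c₃ k l u v p q r, fun i j k l u v p q r => ?_⟩
  have h2 : ∀ x y : ZMod 2, x + 1 + (y + 1) = x + y := by decide
  have h3 : ∀ x y z : ZMod 2, x + (y + 1) + (z + 1) = x + y + z := by decide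
  have h4 : ∀ (x y : ZMod 2) (c : ℤ), koszulSign (x + 1) y * (koszulSign 1 y * c) =
      koszulSign x y * c := fun x y c => by
    rw [koszulSign_add_left, mul_assoc, ← mul_assoc (koszulSign 1 y), koszulSign_mul_self, one_mul]
  simpa only [leibnizDefect, h2, h3, h4] using hc i j k l u v p q r

/-- Modulo `2` the signs, hence the parities, do not matter. -/
theorem IsWeightCocycle.of_two {π : I → ZMod 2} {ε : I → I → I → I → ℤ}
    (h : IsWeightCocycle π ε 2) (π' : I → ZMod 2) : IsWeightCocycle π' ε 2 := by
  obtain ⟨c₁, c₂, c₃, hc⟩ := h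
  refine ⟨c₁, c₂, c₃, fun i j k l u v p q r => ?_⟩
  have hs : ∀ p q, ((koszulSign p q : ℤ) : ZMod 2) = 1 := by decide
  have := hc i j k l u v p q r
  rw [← ZMod.intCast_zmod_eq_zero_iff_dvd] at this ⊢
  simpa [leibnizDefect, hs] using this

/-- Some term of `leibnizDefect`, or of the supertrace correction to it, has a non-zero
coefficient. -/
def IsRelevant (ε : I → I → I → I → ℤ) (i j k l u v : I) : Prop :=
  (l = u ∧ ε i j k v ≠ 0) ∨ (v = k ∧ ε i j u l ≠ 0) ∨ (j = k ∧ ε i l u v ≠ 0) ∨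
    (l = i ∧ ε k j u v ≠ 0) ∨ (j = u ∧ ε i v k l ≠ 0) ∨ (v = i ∧ ε u j k l ≠ 0) ∨
    (i = j ∧ ε k l u v ≠ 0) ∨ (k = l ∧ ε i j u v ≠ 0) ∨ (u = v ∧ ε i j k l ≠ 0)

instance (ε : I → I → I → I → ℤ) (i j k l u v : I) : Decidable (IsRelevant ε i j k l u v) :=
  inferInstanceAs (Decidable (_ ∨ _))

/-- The supertrace correction occurring for the exceptional cocycles; `d` is the difference of the
parities of sources and sinks, and `e` a global sign. -/
def traceTerm (π : I → ZMod 2) (ε : I → I → I → I → ℤ) (d : ZMod 2) (e : ℤ) (i j k l u v : I)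
    (p q r : ZMod 2) : ℤ :=
  (if i = j then koszulSign (π i) (1 + p) *
      (-e * koszulSign d (r + π u + π v) * ε k l u v) else 0) +
    (if k = l then koszulSign (π k) (1 + q) *
      (e * koszulSign d (q + (r + π u + π v)) * ε i j u v) else 0) +
    (if u = v then koszulSign (π u) (1 + r) *
      (-e * koszulSign d (q + π k + π l) * ε i j k l) else 0)

/-- Only the relevant sextuples of indices need to be inspected. -/
theorem isWeightCocycle_of_relevant (π : I → ZMod 2) (ε : I → I → I → I → ℤ) (N : ℕ) (d : ZMod 2)
    (e : ℤ)
    (h : ∀ i j k l u v, IsRelevant ε i j k l u v → ∀ p q r,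
      (N : ℤ) ∣ leibnizDefect π ε i j k l u v p q r - traceTerm π ε d e i j k l u v p q r) :
    IsWeightCocycle π ε N := by
  refine ⟨fun k l u v _ _ r => -e * koszulSign d (r + π u + π v) * ε k l u v,
    fun i j u v _ q r => e * koszulSign d (q + (r + π u + π v)) * ε i j u v,
    fun i j k l _ q _ => -e * koszulSign d (q + π k + π l) * ε i j k l,
    fun i j k l u v p q r => ?_⟩
  change (N : ℤ) ∣ leibnizDefect π ε i j k l u v p q r - traceTerm π ε d e i j k l u v p q r
  by_cases hr : IsRelevant ε i j k l u v
  · exact h i j k l u v hr p q r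
  · simp only [IsRelevant, not_or, not_and, not_not] at hr
    obtain ⟨h1, h2, h3, h4, h5, h6, h7, h8, h9⟩ := hr
    have ite_mul_zero : ∀ (P : Prop) [Decidable P] (a b : ℤ), (P → a = 0) →
        (if P then a * b else 0) = 0 := by
      intro P _ a b h
      split_ifs with hP
      · rw [h hP, zero_mul]
      · rfl
    have ite_mul_mul_zero : ∀ (P : Prop) [Decidable P] (a b c : ℤ), (P → a = 0) →
        (if P then b * (c * a) else 0) = 0 := by
      intro P _ a b c h
      split_ifs with hP
      · rw [h hP, mul_zero, mul_zero]
      · rfl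
    simp only [leibnizDefect, traceTerm, mul_assoc (ε _ _ _ _)]
    rw [ite_mul_zero _ _ _ h1, ite_mul_zero _ _ _ h2, ite_mul_zero _ _ _ h3, ite_mul_zero _ _ _ h4,
      ite_mul_zero _ _ _ h5, ite_mul_zero _ _ _ h6, ite_mul_mul_zero _ _ _ _ h7,
      ite_mul_mul_zero _ _ _ _ h8, ite_mul_mul_zero _ _ _ _ h9]
    simp

end Weight

/-- The coefficients supported on the four pairs of arrows from the sources `0`, `1` to the sinks
`2`, `3`, invariant under both exchanges. -/
def symCoeff (i j k l : Fin 4) : ℤ :=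
  if (i, k) ∈ [(0, 1), (1, 0)] ∧ (j, l) ∈ [(2, 3), (3, 2)] then 1 else 0

/-- The coefficients supported on the four pairs of arrows from the sources `0`, `1` to the sinks
`2`, `3`, alternating under both exchanges. -/
def altCoeff (i j k l : Fin 4) : ℤ :=
  if (i, j, k, l) ∈ [(0, 2, 1, 3), (1, 3, 0, 2)] then 1
  else if (i, j, k, l) ∈ [(0, 3, 1, 2), (1, 2, 0, 3)] then -1 else 0

/-- The coefficients supported on the two pairs of distinct arrows with source `0`, alternating. -/
def rowCoeff (i j k l : Fin 3) : ℤ :=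
  if (i, j, k, l) = (0, 1, 0, 2) then 1 else if (i, j, k, l) = (0, 2, 0, 1) then -1 else 0

/-- The coefficients supported on the two pairs of distinct arrows with sink `0`, alternating. -/
def columnCoeff (i j k l : Fin 3) : ℤ := rowCoeff j i l k

theorem isWeightCocycle_symCoeff (π : Fin 4 → ZMod 2) : IsWeightCocycle π symCoeff 2 :=
  IsWeightCocycle.of_two
    (isWeightCocycle_of_relevant (fun _ => 0) symCoeff 2 0 1 (by decide +kernel)) π

theorem isWeightCocycle_altCoeff : IsWeightCocycle ![0, 0, 1, 1] altCoeff 0 :=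
  isWeightCocycle_of_relevant _ _ 0 1 1 (by decide +kernel)

theorem isWeightCocycle_rowCoeff : IsWeightCocycle (fun _ => 0) rowCoeff 3 :=
  isWeightCocycle_of_relevant _ _ 3 0 (-1) (by decide +kernel)

theorem isWeightCocycle_columnCoeff : IsWeightCocycle (fun _ => 0) columnCoeff 3 :=
  isWeightCocycle_of_relevant _ _ 3 0 1 (by decide +kernel)

/-! ### Reindexing direct sums of supermodules -/

section Reindex

variable {R : Type*} [CommRing R]

theorem superIso_powGr {M T : Type*} [AddCommGroup M] [Module R M] (gr : ZMod 2 → Submodule R M)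
    {k : ℕ} (e : T ≃ Fin k) :
    SuperIso (fun p => Submodule.pi Set.univ fun _ : T => gr p) (powGr gr k) := by
  refine ⟨LinearEquiv.funCongrLeft R M e.symm, fun p => le_antisymm ?_ fun w hw => ?_⟩
  · rintro _ ⟨w, hw, rfl⟩ t -
    exact hw (e.symm t) (Set.mem_univ _)
  · refine ⟨w ∘ e, fun t _ => hw (e t) (Set.mem_univ _), ?_⟩
    ext t
    simp [LinearEquiv.funCongrLeft_apply]

theorem superIso_sumGr {k l : ℕ} {W : Fin k ⊕ Fin l → Type*} [∀ t, AddCommGroup (W t)]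
    [∀ t, Module R (W t)]
    (gr : ∀ t, ZMod 2 → Submodule R (W t)) :
    SuperIso (fun p => Submodule.pi Set.univ fun t => gr t p)
      (sumGr (fun p => Submodule.pi Set.univ fun t => gr (.inl t) p)
        (fun p => Submodule.pi Set.univ fun t => gr (.inr t) p)) := by
  refine ⟨LinearEquiv.sumPiEquivProdPi R (Fin k) (Fin l) W, fun p => le_antisymm ?_ fun w hw => ?_⟩
  · rintro _ ⟨w, hw, rfl⟩
    exact ⟨fun t _ => hw (.inl t) (Set.mem_univ _), fun t _ => hw (.inr t) (Set.mem_univ _)⟩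
  · refine ⟨(LinearEquiv.sumPiEquivProdPi R (Fin k) (Fin l) W).symm w, ?_, by simp⟩
    rintro (t | t) -
    · exact hw.1 t (Set.mem_univ _)
    · exact hw.2 t (Set.mem_univ _)

end Reindex

namespace UnitalSuperdialgebra

variable {R D : Type*} [CommRing R] [AddCommGroup D] [Module R D]
  (𝒟 : UnitalSuperdialgebra R D) {m n : ℕ}

/-! ### Second homology from a family of exceptional cocycles -/

/-- If `HL₂` is spanned by the classes of `F_{ij}(a) ⊗ F_{kl}(1)` for a finite family of quadruples
`(i, j, k, l)`, these classes only depend on the image of `a` in `D_N`, and the family has dual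
cocycles, then `HL₂` is the direct sum of the modules `D_N`, up to a shift of the parity. -/
theorem superIso_hl2_pi (hthird : ∀ i j : Fin m ⊕ Fin n, ∃ r, r ≠ i ∧ r ≠ j) {T : Type*}
    [Fintype T] [DecidableEq T] (N : T → ℕ) (s : ZMod 2) {i j k l : T → Fin m ⊕ Fin n}
    (hij : ∀ t, i t ≠ j t) (hkl : ∀ t, k t ≠ l t) (hil : ∀ t, i t ≠ l t) (hjk : ∀ t, j t ≠ k t)
    (hker : ∀ t, 𝒟.idealOf (N t) ≤ LinearMap.ker ((𝒟.clsF (hij t) (hkl t)).flip 𝒟.one))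
    (hspan : ∀ i' j' k' l', ∀ (hij' : i' ≠ j') (hkl' : k' ≠ l'), i' ≠ l' → j' ≠ k' →
      ∀ α β, ∀ a ∈ 𝒟.gr α, ∀ b ∈ 𝒟.gr β, 𝒟.clsF hij' hkl' a b = 0 ∨
        ∃ t, 𝒟.clsF hij' hkl' a b ∈ LinearMap.range ((𝒟.clsF (hij t) (hkl t)).flip 𝒟.one))
    (ε : T → Fin m ⊕ Fin n → Fin m ⊕ Fin n → Fin m ⊕ Fin n → Fin m ⊕ Fin n → ℤ)
    (hε : ∀ t, IsWeightCocycle (indexDeg m n) (ε t) (N t))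
    (hεs : ∀ t i j k l, ε t i j k l ≠ 0 →
      indexDeg m n i + indexDeg m n j + indexDeg m n k + indexDeg m n l = s)
    (hdual : ∀ t t', ε t (i t') (j t') (k t') (l t') = if t = t' then 1 else 0) :
    SuperIso (𝒟.steinberg m n).HL2Gr
      (fun p => Submodule.pi Set.univ fun t => 𝒟.quotGr (N t) (p + s)) := by
  let ω' : ∀ t, 𝒟.Quot (N t) →ₗ[R] (𝒟.steinberg m n).Cov := fun t =>
    (𝒟.idealOf (N t)).liftQ ((𝒟.clsF (hij t) (hkl t)).flip 𝒟.one) (hker t)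
  let ω : (∀ t, 𝒟.Quot (N t)) →ₗ[R] (𝒟.steinberg m n).Cov :=
    ∑ t, ω' t ∘ₗ LinearMap.proj t
  have hω' : ∀ t a, ω' t ((𝒟.idealOf (N t)).mkQ a) = 𝒟.clsF (hij t) (hkl t) a 𝒟.one :=
    fun t a => rfl
  have hω : ∀ w, ω w = ∑ t, ω' t (w t) := fun w => by simp [ω]
  refine (𝒟.steinberg m n).superIso_hl2
    (LinearMap.pi fun t => 𝒟.covForm (ε t) (N t) (hε t)) ω (le_antisymm ?_ ?_) ?_ ?_ ?_
  · refine 𝒟.ker_covBracket_le hthird _ fun i' j' k' l' hij' hkl' hil' hjk' α β a ha b hb => ?_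
    rcases hspan i' j' k' l' hij' hkl' hil' hjk' α β a ha b hb with h | ⟨t, c, hc⟩
    · rw [← clsF_apply, h]
      exact zero_mem _
    · refine ⟨Pi.single t ((𝒟.idealOf (N t)).mkQ c), ?_⟩
      rw [hω, Finset.sum_eq_single t, Pi.single_eq_same, hω']
      · exact hc
      · intro t' _ h
        rw [Pi.single_eq_of_ne h, map_zero]
      · simp
  · rintro _ ⟨w, rfl⟩
    rw [LinearMap.mem_ker, hω, map_sum]
    refine Finset.sum_eq_zero fun t _ => ?_
    obtain ⟨a, ha⟩ := Submodule.mkQ_surjective _ (w t)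
    rw [← ha, hω']
    exact 𝒟.covBracket_clsF _ _ (hil t) (hjk t) a _
  · intro w
    ext t
    rw [LinearMap.pi_apply, hω, map_sum, Finset.sum_eq_single t]
    · obtain ⟨a, ha⟩ := Submodule.mkQ_surjective _ (w t)
      rw [← ha, hω', covForm_clsF, hdual, if_pos rfl, one_smul]
    · intro t' _ h
      obtain ⟨a, ha⟩ := Submodule.mkQ_surjective _ (w t')
      rw [← ha, hω', covForm_clsF, hdual, if_neg h.symm, zero_smul]
    · simp
  · intro p q x hx y hy t _
    exact 𝒟.weightForm_mem _ _ _ (hεs t) (𝒟.toMatrix_mem (N t) hx).1 (𝒟.toMatrix_mem (N t) hy).1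
  · intro p w hw
    rw [hω]
    refine sum_mem fun t _ => ?_
    obtain ⟨a, ha, hat⟩ := hw t (Set.mem_univ _)
    rw [← hat, hω']
    refine ⟨_, Submodule.subset_span ⟨_, _, ?_, _, 𝒟.stF_mem (hij t) ha, _,
      𝒟.stF_mem (hkl t) 𝒟.one_mem, rfl⟩, rfl⟩
    have hs := hεs t (i t) (j t) (k t) (l t) (by rw [hdual, if_pos rfl]; exact one_ne_zero)
    linear_combination hs + zmod_two_add_self s

/-- The integer `-c` is the weight of `F_{ij}(a) ⊗ F_{kl}(1)` under `[F_{pq}(1), F_{qp}(1)]`. -/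
theorem zsmul_clsF_one_eq_zero (hthird : ∀ i j : Fin m ⊕ Fin n, ∃ r, r ≠ i ∧ r ≠ j)
    {p q i j k l : Fin m ⊕ Fin n} (h : p ≠ q) (hij : i ≠ j) (hkl : k ≠ l) (hil : i ≠ l)
    (hjk : j ≠ k) {c : ℤ}
    (hc : weight m n p q j - weight m n p q i + (weight m n p q l - weight m n p q k) = -c)
    (a : D) : c • 𝒟.clsF hij hkl a 𝒟.one = 0 := by
  induction a using induction_homogeneous 𝒟.isCompl with
  | hom α a ha =>
    have := 𝒟.weight_smul_cls hthird h hij hkl hil hjk ha 𝒟.one_mem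
    rwa [hc, neg_smul, neg_eq_zero] at this
  | add x y hx hy => rw [map_add, LinearMap.add_apply, smul_add, hx, hy, add_zero]

/-! ### Four indices -/

/-- For four distinct indices, some diagonal element has weight `-2` on `F_{ij}(a) ⊗ F_{kl}(1)`,
unless the sources `i`, `k` have one parity and the sinks `j`, `l` the other. -/
theorem two_zsmul_clsF_one (hthird : ∀ i j : Fin m ⊕ Fin n, ∃ r, r ≠ i ∧ r ≠ j)
    {i j k l : Fin m ⊕ Fin n} (hij : i ≠ j) (hkl : k ≠ l) (hil : i ≠ l) (hjk : j ≠ k)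
    (hik : i ≠ k) (hjl : j ≠ l)
    (hπ : ¬(indexDeg m n i = indexDeg m n k ∧ indexDeg m n j = indexDeg m n l ∧
      indexDeg m n i ≠ indexDeg m n j)) (a : D) : (2 : ℤ) • 𝒟.clsF hij hkl a 𝒟.one = 0 := by
  have h01 : ∀ {x y z : ZMod 2}, x ≠ y → x ≠ z → y = z := by decide
  by_cases h1 : indexDeg m n i = indexDeg m n k
  · by_cases h2 : indexDeg m n i = indexDeg m n j
    · refine 𝒟.zsmul_clsF_one_eq_zero hthird hij hij hkl hil hjk ?_ a
      simp [weight, h2, hij.symm, hil.symm, hjl.symm, hik.symm, hjk.symm, zmod_two_add_self]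
    · by_cases h3 : indexDeg m n i = indexDeg m n l
      · refine 𝒟.zsmul_clsF_one_eq_zero hthird hil hij hkl hil hjk ?_ a
        simp [weight, h3, hij.symm, hil.symm, hjl, hik.symm, hkl, zmod_two_add_self]
      · exact absurd ⟨h1, h01 h2 h3, h2⟩ hπ
  · refine 𝒟.zsmul_clsF_one_eq_zero hthird hik hij hkl hil hjk ?_ a
    have h : indexDeg m n i + indexDeg m n k = 1 := by
      have : ∀ {x y : ZMod 2}, x ≠ y → x + y = 1 := by decide
      exact this h1
    simp [weight, h, hij.symm, hil.symm, hjk, hkl.symm, hik.symm, show koszulSign 1 1 = -1 from rfl]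

/-- Among four indices, only quadruples of distinct ones give non-zero classes. -/
theorem clsF_eq_zero_of_four (hmn : m + n = 4) {i j k l : Fin m ⊕ Fin n} (hij : i ≠ j)
    (hkl : k ≠ l) (hil : i ≠ l) (hjk : j ≠ k) (hd : i = k ∨ j = l) {α β : ZMod 2} {a b : D}
    (ha : a ∈ 𝒟.gr α) (hb : b ∈ 𝒟.gr β) : 𝒟.clsF hij hkl a b = 0 := by
  have hthird := exists_third (m := m) (n := n) (by omega)
  rcases hd with rfl | rfl
  · obtain ⟨r, hr⟩ := exists_notMem_of_card_lt (m := m) (n := n) {i, j, l}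
      (Finset.card_le_three.trans_lt (by omega))
    simp only [Finset.mem_insert, Finset.mem_singleton, not_or] at hr
    exact 𝒟.clsF_eq_zero_of_index hthird hij hkl hil hjk hr.1 hr.2.1 hr.1 hr.2.2 ha hb
  · obtain ⟨r, hr⟩ := exists_notMem_of_card_lt (m := m) (n := n) {i, j, k}
      (Finset.card_le_three.trans_lt (by omega))
    simp only [Finset.mem_insert, Finset.mem_singleton, not_or] at hr
    exact 𝒟.clsF_eq_zero_of_index hthird hij hkl hil hjk hr.1 hr.2.1 hr.2.2 hr.2.1 ha hb

theorem isWeightCocycle_altCoeff_of_ne {π : Fin 4 → ZMod 2} (h01 : π 0 = π 1) (h23 : π 2 = π 3)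
    (h02 : π 0 ≠ π 2) : IsWeightCocycle π altCoeff 0 := by
  have key : ∀ x y : ZMod 2, x ≠ y → (x = 0 ∧ y = 1) ∨ (x = 1 ∧ y = 0) := by decide
  rcases key _ _ h02 with ⟨h0, h2⟩ | ⟨h0, h2⟩
  · have hπ : π = ![0, 0, 1, 1] := by
      ext i
      fin_cases i
      exacts [h0, h01.symm.trans h0, h2, h23.symm.trans h2]
    rw [hπ]
    exact isWeightCocycle_altCoeff
  · have hπ : π = fun i => ![0, 0, 1, 1] i + 1 := by
      ext i
      fin_cases i
      exacts [h0, h01.symm.trans h0, h2, h23.symm.trans h2]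
    rw [hπ]
    exact isWeightCocycle_altCoeff.add_one

theorem sum_indexDeg (E : Fin m ⊕ Fin n ≃ Fin 4) :
    indexDeg m n (E.symm 0) + indexDeg m n (E.symm 1) + indexDeg m n (E.symm 2) +
      indexDeg m n (E.symm 3) = n := by
  rw [← Fin.sum_univ_four (fun x => indexDeg m n (E.symm x)), Equiv.sum_comp E.symm]
  simp [indexDeg]

/-- For `m + n = 4` there is one summand for each pair of sources: the family `E` of numberings of
the indices puts every pair of indices exactly once in the positions `0`, `1` of the sources, with the
sinks in the positions `2`, `3`. -/
theorem superIso_hl2_four {T : Type*} [Fintype T] [DecidableEq T]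
    (E : T → Fin m ⊕ Fin n ≃ Fin 4)
    (hE : ∀ i k, i ≠ k → ∃! t, (E t i, E t k) ∈ [((0 : Fin 4), (1 : Fin 4)), (1, 0)]) (N : T → ℕ)
    (hN : ∀ t, N t = if indexDeg m n ((E t).symm 0) = indexDeg m n ((E t).symm 1) ∧
      indexDeg m n ((E t).symm 2) = indexDeg m n ((E t).symm 3) ∧
      indexDeg m n ((E t).symm 0) ≠ indexDeg m n ((E t).symm 2) then 0 else 2)
    [Nonempty T] :
    SuperIso (𝒟.steinberg m n).HL2Gr
      (fun p => Submodule.pi Set.univ fun t => 𝒟.quotGr (N t) (p + n)) := by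
  have hmn : m + n = 4 := by
    have := Fintype.card_congr (E (Classical.arbitrary T))
    simpa using this
  have hthird := exists_third (m := m) (n := n) (by omega)
  have hne : ∀ t {x y : Fin 4}, x ≠ y → (E t).symm x ≠ (E t).symm y :=
    fun t _ _ h => (E t).symm.injective.ne h
  have hsym : ∀ i j k l : Fin 4, symCoeff i j k l ≠ 0 →
      (i, k) ∈ [((0 : Fin 4), (1 : Fin 4)), (1, 0)] ∧
        (j, l) ∈ [((2 : Fin 4), (3 : Fin 4)), (3, 2)] := by decide
  have halt : ∀ i j k l : Fin 4, altCoeff i j k l ≠ 0 →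
      (i, k) ∈ [((0 : Fin 4), (1 : Fin 4)), (1, 0)] ∧
        (j, l) ∈ [((2 : Fin 4), (3 : Fin 4)), (3, 2)] := by decide
  let ε₀ : T → Fin 4 → Fin 4 → Fin 4 → Fin 4 → ℤ := fun t =>
    if N t = 0 then altCoeff else symCoeff
  have hε₀ : ∀ t i j k l, ε₀ t i j k l ≠ 0 → (i, k) ∈ [((0 : Fin 4), (1 : Fin 4)), (1, 0)] ∧
      (j, l) ∈ [((2 : Fin 4), (3 : Fin 4)), (3, 2)] := by
    intro t i j k l
    by_cases h : N t = 0
    · simpa only [ε₀, if_pos h] using halt i j k l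
    · simpa only [ε₀, if_neg h] using hsym i j k l
  have h2 : ∀ t, ¬ (indexDeg m n ((E t).symm 0) = indexDeg m n ((E t).symm 1) ∧
      indexDeg m n ((E t).symm 2) = indexDeg m n ((E t).symm 3) ∧
      indexDeg m n ((E t).symm 0) ≠ indexDeg m n ((E t).symm 2)) → ∀ a,
      (2 : ℤ) • 𝒟.clsF (hne t (x := 0) (y := 2) (by decide))
        (hne t (x := 1) (y := 3) (by decide)) a 𝒟.one = 0 := fun t h a =>
    𝒟.two_zsmul_clsF_one hthird _ _ (hne t (by decide)) (hne t (by decide)) (hne t (by decide))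
      (hne t (by decide)) h a
  refine 𝒟.superIso_hl2_pi hthird N n (i := fun t => (E t).symm 0) (j := fun t => (E t).symm 2)
    (k := fun t => (E t).symm 1) (l := fun t => (E t).symm 3) (fun t => hne t (by decide))
    (fun t => hne t (by decide)) (fun t => hne t (by decide)) (fun t => hne t (by decide))
    (fun t => ?_) ?_ (fun t i j k l => ε₀ t (E t i) (E t j) (E t k) (E t l)) (fun t => ?_) ?_ ?_
  · refine 𝒟.idealOf_le_ker_clsF _ _ (hne t (by decide)) (hne t (by decide)) (hne t (by decide)) _
      (fun a => ?_) ?_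
    · rw [hN t]
      split_ifs with h
      · exact zero_smul ℤ _
      · exact h2 t h a
    · by_cases h : indexDeg m n ((E t).symm 0) = indexDeg m n ((E t).symm 1)
      · exact .inl h
      · exact .inr (h2 t fun h' => h h'.1)
  · intro i j k l hij hkl hil hjk α β a ha b hb
    by_cases hd : i = k ∨ j = l
    · exact .inl (𝒟.clsF_eq_zero_of_four hmn hij hkl hil hjk hd ha hb)
    · right
      push Not at hd
      obtain ⟨t, ht, -⟩ := hE i k hd.1
      refine ⟨t, 𝒟.clsF_mem_range _ _ (hne t (by decide)) (hne t (by decide)) (hne t (by decide))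
        hij hkl ?_ ?_ ha hb⟩
      · simpa [Equiv.eq_symm_apply] using ht
      · have key : ∀ x y z w : Fin 4, x ≠ y → z ≠ w → x ≠ w → y ≠ z → y ≠ w →
            (x, z) ∈ [((0 : Fin 4), (1 : Fin 4)), (1, 0)] → (y = 2 ∧ w = 3) ∨ (y = 3 ∧ w = 2) := by
          decide
        have := key _ _ _ _ ((E t).injective.ne hij) ((E t).injective.ne hkl)
          ((E t).injective.ne hil) ((E t).injective.ne hjk) ((E t).injective.ne hd.2) ht
        simpa only [Equiv.eq_symm_apply] using this
  · by_cases h : N t = 0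
    · simp only [ε₀, if_pos h]
      rw [hN t] at h
      rw [ite_eq_left_iff] at h
      obtain ⟨h01, h23, h02⟩ := not_imp_comm.1 h (by decide)
      rw [hN t, if_pos ⟨h01, h23, h02⟩]
      refine (isWeightCocycle_altCoeff_of_ne (π := fun x => indexDeg m n ((E t).symm x))
        h01 h23 h02).comp (E t).injective fun i => ?_
      rw [Equiv.symm_apply_apply]
    · simp only [ε₀, if_neg h]
      rw [hN t] at h ⊢
      rw [if_neg fun h' => h (if_pos h')]
      refine (isWeightCocycle_symCoeff fun x => indexDeg m n ((E t).symm x)).comp (E t).injective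
        fun i => ?_
      rw [Equiv.symm_apply_apply]
  · intro t i j k l h
    have := hε₀ t _ _ _ _ h
    simp only [List.mem_cons, Prod.mk.injEq, List.not_mem_nil, or_false,
      ← Equiv.eq_symm_apply] at this
    rw [← sum_indexDeg (E t)]
    rcases this with ⟨⟨rfl, rfl⟩ | ⟨rfl, rfl⟩, ⟨rfl, rfl⟩ | ⟨rfl, rfl⟩⟩ <;> ring
  · intro t t'
    by_cases h : t = t'
    · subst h
      simp only [Equiv.apply_symm_apply, if_true, ε₀]
      split_ifs <;> rfl
    · rw [if_neg h]
      by_contra h0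
      refine h ((hE ((E t').symm 0) ((E t').symm 1) (hne t' (by decide))).unique
        (hε₀ t _ _ _ _ h0).1 ?_)
      simp

end UnitalSuperdialgebra

namespace UnitalSuperdialgebra

variable {R D : Type*} [CommRing R] [AddCommGroup D] [Module R D]
  (𝒟 : UnitalSuperdialgebra R D)

/-! ### Three even indices -/

/-- For three even indices there are two summands for each index, which is either the common source
or the common sink of two arrows: `E t` is a numbering of the indices that puts this index in the
position `0`. -/
theorem superIso_hl2_three (E : Fin 3 → Fin 3 ⊕ Fin 0 ≃ Fin 3) (hE : ∀ i, ∃! t, E t i = 0) :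
    SuperIso (𝒟.steinberg 3 0).HL2Gr
      (fun p => Submodule.pi Set.univ fun _ : Fin 3 ⊕ Fin 3 => 𝒟.quotGr 3 p) := by
  have hthird := exists_third (m := 3) (n := 0) (by omega)
  have hπ : ∀ i, indexDeg 3 0 i = 0 := by decide
  have hne : ∀ t {x y : Fin 3}, x ≠ y → (E t).symm x ≠ (E t).symm y :=
    fun t _ _ h => (E t).symm.injective.ne h
  have h01 : (0 : Fin 3) ≠ 1 := by decide
  have h02 : (0 : Fin 3) ≠ 2 := by decide
  have h12 : (1 : Fin 3) ≠ 2 := by decide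
  -- the arrows `0 → 1`, `0 → 2` for the row type and `1 → 0`, `2 → 0` for the column type
  let i : Fin 3 ⊕ Fin 3 → Fin 3 ⊕ Fin 0 := Sum.elim (fun t => (E t).symm 0) (fun t => (E t).symm 1)
  let j : Fin 3 ⊕ Fin 3 → Fin 3 ⊕ Fin 0 := Sum.elim (fun t => (E t).symm 1) (fun t => (E t).symm 0)
  let k : Fin 3 ⊕ Fin 3 → Fin 3 ⊕ Fin 0 := Sum.elim (fun t => (E t).symm 0) (fun t => (E t).symm 2)
  let l : Fin 3 ⊕ Fin 3 → Fin 3 ⊕ Fin 0 := Sum.elim (fun t => (E t).symm 2) (fun t => (E t).symm 0)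
  have hij : ∀ t, i t ≠ j t := by rintro (t | t); exacts [hne t h01, hne t h01.symm]
  have hkl : ∀ t, k t ≠ l t := by rintro (t | t); exacts [hne t h02, hne t h02.symm]
  have hil : ∀ t, i t ≠ l t := by rintro (t | t); exacts [hne t h02, hne t h01.symm]
  have hjk : ∀ t, j t ≠ k t := by rintro (t | t); exacts [hne t h01.symm, hne t h02]
  have h3 : ∀ t a, (3 : ℤ) • 𝒟.clsF (hij t) (hkl t) a 𝒟.one = 0 := by
    intro t a
    refine 𝒟.zsmul_clsF_one_eq_zero hthird (hij t) (hij t) (hkl t) (hil t) (hjk t) ?_ a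
    rcases t with t | t
    · simp [i, j, k, l, weight, hπ]
    · simp [i, j, k, l, weight, hπ]
  let ε : Fin 3 ⊕ Fin 3 → Fin 3 ⊕ Fin 0 → Fin 3 ⊕ Fin 0 → Fin 3 ⊕ Fin 0 → Fin 3 ⊕ Fin 0 → ℤ :=
    Sum.elim (fun t i j k l => rowCoeff (E t i) (E t j) (E t k) (E t l))
      (fun t i j k l => columnCoeff (E t i) (E t j) (E t k) (E t l))
  have := 𝒟.superIso_hl2_pi hthird (fun _ => 3) 0 hij hkl hil hjk ?_ ?_ ε ?_ ?_ ?_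
  · simpa only [add_zero] using this
  · rintro (t | t)
    · exact 𝒟.idealOf_le_ker_clsF_row hπ _ _ (hne t h12) 3 (h3 (.inl t))
    · exact 𝒟.idealOf_le_ker_clsF _ _ (hil (.inr t)) (hkl (.inr t)) (hne t h12) 3 (h3 (.inr t))
        (.inl ((hπ _).trans (hπ _).symm))
  · intro i' j' k' l' hij' hkl' hil' hjk' α β a ha b hb
    have key : ∀ x y z w : Fin 3, x ≠ y → z ≠ w → x ≠ w → y ≠ z → x = z ∨ y = w := by decide
    have key2 : ∀ x y z : Fin 3, x ≠ y → x ≠ z → y ≠ z → x = 0 →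
        (y = 1 ∧ z = 2) ∨ (y = 2 ∧ z = 1) := by decide
    by_cases hik : i' = k'
    · subst hik
      by_cases hjl : j' = l'
      · subst hjl
        exact .inl (𝒟.cls_same_eq_zero hthird hij' ha hb)
      · obtain ⟨t, ht, -⟩ := hE i'
        refine .inr ⟨.inl t, ?_⟩
        obtain rfl := ((E t).eq_symm_apply).2 ht
        rcases key2 _ _ _ ((E t).injective.ne hij') ((E t).injective.ne hil')
          ((E t).injective.ne hjl) ht with h | h
        · obtain rfl := ((E t).eq_symm_apply).2 h.1
          obtain rfl := ((E t).eq_symm_apply).2 h.2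
          exact ⟨_, (𝒟.clsF_row_eq_left hπ hij' hil' hjl ha hb).symm⟩
        · obtain rfl := ((E t).eq_symm_apply).2 h.1
          obtain rfl := ((E t).eq_symm_apply).2 h.2
          refine ⟨-𝒟.left a b, ?_⟩
          rw [𝒟.clsF_row_swap hπ hij' hil' hjl ha hb, map_neg]
          rfl
    · obtain ⟨t, ht, -⟩ := hE j'
      refine .inr ⟨.inr t, ?_⟩
      have hjl : j' = l' := (E t).injective ((key _ _ _ _ ((E t).injective.ne hij')
        ((E t).injective.ne hkl') ((E t).injective.ne hil') ((E t).injective.ne hjk')).resolve_left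
          ((E t).injective.ne hik))
      subst hjl
      have h := key2 _ _ _ ((E t).injective.ne hij'.symm) ((E t).injective.ne hjk')
        ((E t).injective.ne hik) ht
      simp only [← Equiv.eq_symm_apply] at h ht
      exact 𝒟.clsF_mem_range (hij (.inr t)) (hkl (.inr t)) (hil (.inr t)) (hkl (.inr t))
        (hne t h12) hij' hkl' h (.inl ⟨ht, ht⟩) ha hb
  · rintro (t | t)
    · exact isWeightCocycle_rowCoeff.comp (E t).injective hπ
    · exact isWeightCocycle_columnCoeff.comp (E t).injective hπ
  · intro t i j k l _
    simp [hπ]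
  · have row : ∀ x y z w : Fin 3, rowCoeff x y z w ≠ 0 → x = 0 ∧ z = 0 ∧ y ≠ w := by decide
    have uniq : ∀ t t', E t ((E t').symm 0) = 0 → t = t' := fun t t' h =>
      (hE ((E t').symm 0)).unique h (by simp)
    rintro (t | t) (t' | t')
    · by_cases h : t = t'
      · subst h
        simp [ε, i, j, k, l, rowCoeff]
      · rw [if_neg (by simpa using h)]
        by_contra h0
        exact h (uniq _ _ (row _ _ _ _ h0).1)
    · rw [if_neg (by simp)]
      by_contra h0
      exact (row _ _ _ _ h0).2.2 rfl
    · rw [if_neg (by simp)]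
      by_contra h0
      exact (row _ _ _ _ h0).2.2 rfl
    · by_cases h : t = t'
      · subst h
        simp [ε, i, j, k, l, columnCoeff, rowCoeff]
      · rw [if_neg (by simpa using h)]
        by_contra h0
        exact h (uniq _ _ (row _ _ _ _ h0).1)

/-- Permutations of four indices taking each of the six pairs of indices to `{0, 1}`. The pairs
`{0, 1}` and `{2, 3}` come last, since for two even and two odd indices they are the pairs of equal
parity. -/
def pairPerm : Fin 4 ⊕ Fin 2 → Equiv.Perm (Fin 4) :=
  Sum.elim ![.swap 1 2, .swap 1 3, .swap 0 2, .swap 0 3] ![1, .swap 0 2 * .swap 1 3]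

theorem existsUnique_pairPerm : ∀ i k : Fin 4, i ≠ k →
    ∃! t, (pairPerm t i, pairPerm t k) ∈ [((0 : Fin 4), (1 : Fin 4)), (1, 0)] := by
  unfold ExistsUnique
  decide

theorem superIso_hl2_pairPerm {m n : ℕ} (σ : Fin m ⊕ Fin n ≃ Fin 4) (N : Fin 4 ⊕ Fin 2 → ℕ)
    (hN : ∀ t, N t =
      if indexDeg m n (σ.symm ((pairPerm t).symm 0)) = indexDeg m n (σ.symm ((pairPerm t).symm 1)) ∧
      indexDeg m n (σ.symm ((pairPerm t).symm 2)) = indexDeg m n (σ.symm ((pairPerm t).symm 3)) ∧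
      indexDeg m n (σ.symm ((pairPerm t).symm 0)) ≠ indexDeg m n (σ.symm ((pairPerm t).symm 2))
      then 0 else 2) :
    SuperIso (𝒟.steinberg m n).HL2Gr
      (fun p => Submodule.pi Set.univ fun t => 𝒟.quotGr (N t) (p + n)) :=
  𝒟.superIso_hl2_four (fun t => σ.trans (pairPerm t))
    (fun i k h => existsUnique_pairPerm (σ i) (σ k) (σ.injective.ne h)) N hN

end UnitalSuperdialgebra

end

theorem mainTheorem10 {R D : Type*} [CommRing R] [AddCommGroup D] [Module R D]
    (𝒟 : UnitalSuperdialgebra R D)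
    {ι : Type*} (B : Module.Basis ι R D) (hB : 𝒟.one ∈ Set.range B) :
    (∀ m n : ℕ, (5 ≤ m + n ∨ (m = 2 ∧ n = 1)) → Subsingleton (𝒟.steinberg m n).HL2) ∧
    SuperIso (𝒟.steinberg 3 0).HL2Gr (powGr (𝒟.quotGr 3) 6) ∧
    SuperIso (𝒟.steinberg 4 0).HL2Gr (powGr (𝒟.quotGr 2) 6) ∧
    SuperIso (𝒟.steinberg 3 1).HL2Gr (powGr (parityChange (𝒟.quotGr 2)) 6) ∧
    SuperIso (𝒟.steinberg 2 2).HL2Gr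
      (sumGr (powGr (𝒟.quotGr 2) 4) (powGr (𝒟.quotGr 0) 2)) := by
  -- the shift of the parity by `n` is trivial for even `n`
  have p0 : ∀ p : ZMod 2, p + (0 : ℕ) = p := by decide
  have p2 : ∀ p : ZMod 2, p + (2 : ℕ) = p := by decide
  refine ⟨fun m n => 𝒟.subsingleton_hl2, ?_, ?_, ?_, ?_⟩
  · exact (𝒟.superIso_hl2_three (fun t => finSumFinEquiv.trans (Equiv.swap 0 t))
      (by unfold ExistsUnique; decide)).trans (superIso_powGr _ finSumFinEquiv)
  · have h := 𝒟.superIso_hl2_pairPerm (m := 4) (n := 0) finSumFinEquiv (fun _ => 2) (by decide)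
    simp only [p0] at h
    exact h.trans (superIso_powGr _ finSumFinEquiv)
  · have h := 𝒟.superIso_hl2_pairPerm (m := 3) (n := 1) finSumFinEquiv (fun _ => 2) (by decide)
    simp only [Nat.cast_one] at h
    exact h.trans (superIso_powGr (parityChange (𝒟.quotGr 2)) finSumFinEquiv)
  · let N : Fin 4 ⊕ Fin 2 → ℕ := Sum.elim (fun _ => 2) (fun _ => 0)
    have h := 𝒟.superIso_hl2_pairPerm (m := 2) (n := 2) finSumFinEquiv N (by decide)
    simp only [p2] at h
    exact h.trans (superIso_sumGr fun t => 𝒟.quotGr (N t))
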